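/- For a graph $G$ on $n\ge 2$ vertices let $\lambda_1\ge\lambda_2\ge\dots\ge\lambda_n$ be the eigenvalues of its adjacency matrix and put $\lambda(G)=\max\{|\lambda_2|,|\lambda_n|\}$. An $(n,d,\lambda)$-graph is a $d$-regular graph on $n$ vertices with $\lambda(G)\le\lambda$. The $k$th power of a graph $H$ is the graph on the same vertex set in which two distinct vertices are adjacent if and only if their distance in $H$ is at most $k$ (the square is the case $k=2$). A $K_r$-factor of $G$ is a collection of vertex-disjoint copies of $K_r$ in $G$ that cover all vertices of $G$. For every integer $k\ge 2$ there is $\varepsilon>0$ such that the following holds for all integers $n,d\ge 1$, every real $\lambda$, and every $(n,d,\lambda)$-graph $G$. (a) If $\lambda\le\varepsilon d^{5/2}n^{-3/2}$, then $G$ contains the square of a Hamilton cycle; and if moreover $3\mid n$, then $G$ contains a triangle factor (that is, a $K_3$-factor). (b) If $\lambda\le\varepsilon d^{3k/2}n^{1-3k/2}$, then $G$ contains the $k$th power of a Hamilton cycle; and if moreover $(k+1)\mid n$, then $G$ contains a $K_{k+1}$-factor. -/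

import Mathlib

/-- The adjacency matrix of a graph is Hermitian over `ℝ`. -/
theorem adjMatrix_real_isHermitian {V : Type*} [Fintype V] (G : SimpleGraph V)
    [DecidableRel G.Adj] : (G.adjMatrix ℝ).IsHermitian := by
  rw [Matrix.IsHermitian, Matrix.conjTranspose_eq_transpose_of_trivial]
  exact G.isSymm_adjMatrix

/-- The adjacency eigenvalues `λ₁ ≥ λ₂ ≥ ⋯ ≥ λₙ` of a graph on `n` vertices, counted with
multiplicity and sorted decreasingly; the index set starts at `0`. -/
noncomputable def adjEigenvalues {V : Type*} [Fintype V] [DecidableEq V] (G : SimpleGraph V)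
    [DecidableRel G.Adj] : Fin (Fintype.card V) → ℝ :=
  (adjMatrix_real_isHermitian G).eigenvalues₀

/-- `λ(G) = max {|λ₂|, |λₙ|}`. On fewer than two vertices, where there is no `λ₂`, it is `0`. -/
noncomputable def secondEigenvalue {V : Type*} [Fintype V] [DecidableEq V] (G : SimpleGraph V)
    [DecidableRel G.Adj] : ℝ :=
  if h : 2 ≤ Fintype.card V then
    max |adjEigenvalues G ⟨1, by omega⟩| |adjEigenvalues G ⟨Fintype.card V - 1, by omega⟩|
  else 0

/-- An `(n, d, λ)`-graph: a `d`-regular graph on `n` vertices with `λ(G) ≤ λ`. -/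
structure IsNDLambdaGraph {V : Type*} [Fintype V] [DecidableEq V] (G : SimpleGraph V)
    [DecidableRel G.Adj] (n d : ℕ) (lam : ℝ) : Prop where
  card_eq : Fintype.card V = n
  regular : G.IsRegularOfDegree d
  secondEigenvalue_le : secondEigenvalue G ≤ lam

/-- The `k`th power of a graph `H`: distinct vertices are adjacent iff their distance in `H` is
at most `k` (the extended distance, so vertices in different components stay non-adjacent). -/
def graphPower {V : Type*} (H : SimpleGraph V) (k : ℕ) : SimpleGraph V where
  Adj u v := u ≠ v ∧ H.edist u v ≤ k
  symm := ⟨fun _ _ h => ⟨h.1.symm, by rw [SimpleGraph.edist_comm]; exact h.2⟩⟩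
  loopless := ⟨fun _ h => h.1 rfl⟩

/-- `G` contains the `k`th power of a Hamilton cycle: `G` has `n ≥ 3` vertices and has a subgraph
isomorphic to the `k`th power of the cycle on `n` vertices. -/
def ContainsHamiltonCyclePower {V : Type*} [Fintype V] (G : SimpleGraph V) (k : ℕ) : Prop :=
  3 ≤ Fintype.card V ∧
    (graphPower (SimpleGraph.cycleGraph (Fintype.card V)) k).IsContained G

/-- `G` has a (spanning) `K_r`-factor: a family of `r`-cliques such that every vertex lies in
exactly one of them. -/
def HasCliqueFactor {V : Type*} (G : SimpleGraph V) (r : ℕ) : Prop :=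
  ∃ F : Set (Finset V), (∀ s ∈ F, G.IsNClique r s) ∧ ∀ v : V, ∃! s, s ∈ F ∧ v ∈ s

-- Put `p = d/n`. By the expander mixing lemma the number of edges between any sets `X` and `Y` is
-- `p|X||Y|` up to an error `p√(κ|X||Y|)`, where `κ = ε p^s n²`; here `s = 3` under the hypothesis
-- of (a) and `s = 3k - 2` under that of (b). Consequently at most `4κ/|Y|` vertices have fewer than
-- half of the expected number of neighbours in `Y`, so a choice between two sets is harmless
-- whenever the product of their sizes is a large multiple of `p^s n²`. Which configurations can be
-- found is therefore decided by counting powers of `p`.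
--
-- The power of a Hamilton cycle is found by absorption. It is handled as a list `l` of all vertices
-- such that `l ++ x` is a `k`-path, where `x` consists of the first `k` entries of `l`. Averaging
-- over random colourings yields a reservoir `R` and many disjoint sets inside and outside `R` into
-- which every vertex has proportionally many neighbours. Outside `R` a path is built that stays a
-- `k`-path with the same ends when any subset of `R` is deleted from it (`Flexible.absorb`); it is
-- prolonged greedily until few vertices are left (`Flexible.greedy`). The leftover vertices are
-- threaded onto a second path, by the same lemma but through sets inside `R`, and the cycle is
-- closed through `R`. The vertices of `R` used on the way are finally deleted from the first path.
-- Cutting the list into blocks of `k + 1` gives the clique factor.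
--
-- Two gadgets are needed. An absorber of `r` is a pair of `k`-paths with the same ends whose vertex
-- sets differ exactly in `r` (`absorbs_general` for `k ≥ 3`, `absorbs_square` for `k = 2`). A
-- connection joins two given `k`-cliques through prescribed sets (`LeftReach.connects`): most
-- cliques of some middle sets are reached from the left and most from the right, so one is reached
-- from both sides. Here "most" is a nested quantifier over vertices chosen in turn, and the two
-- sides choose them in opposite orders. That the order is irrelevant up to constants
-- (`Jumbled.swap`, `Most.rot`, `Most.reverse`) is the heart of the argument. For `s = 3k - 2` most
-- cliques are reached by sliding a window of `k` sets (`leftReach_general`); for squares with `s =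
-- 3` one factor `p` is missing and is regained by an expansion argument (`leftReach_square`).

universe u

/-- A list is a `k`-path when entries at positions at most `k` apart are adjacent. -/
def KPath {V : Type*} (G : SimpleGraph V) (k : ℕ) (l : List V) : Prop :=
  ∀ (i j : ℕ) (a b : V), i < j → j ≤ i + k → l[i]? = some a → l[j]? = some b → G.Adj a b

/-- `U` is the vertex set of a `k`-path without repetitions that starts with `x` and ends with
`e`. -/
def PathOn {V : Type*} [DecidableEq V] (G : SimpleGraph V) (k : ℕ) (x e : List V)
    (U : Finset V) : Prop :=
  ∃ P : List V, KPath G k P ∧ P.Nodup ∧ P.toFinset = U ∧ x <+: P ∧ e <:+ P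

/-- Entry `j` of the second list is adjacent to all but the first `j` entries of the first. -/
def Cross {V : Type*} (G : SimpleGraph V) : List V → List V → Prop
  | _, [] => True
  | e, v :: ys => (∀ u ∈ e, G.Adj u v) ∧ Cross G e.tail ys

/-! ### Lists as `k`-paths. -/

section KPaths

variable {V : Type*} {G : SimpleGraph V} {k : ℕ}

/-- Two positions at most `k` apart cannot lie on different sides of the shared block `m`, whose
length is at least `k`; hence both lie in `A ++ m` or both in `m ++ B`. -/
theorem KPath.glue {A m B : List V} (h₁ : KPath G k (A ++ m)) (h₂ : KPath G k (m ++ B))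
    (hm : k ≤ m.length) : KPath G k (A ++ m ++ B) := by
  intro i j a b hij hjk ha hb
  by_cases hj : j < (A ++ m).length
  · rw [List.getElem?_append_left hj] at hb
    rw [List.getElem?_append_left (hij.trans hj)] at ha
    exact h₁ i j a b hij hjk ha hb
  · rw [List.length_append] at hj
    rw [List.append_assoc, List.getElem?_append_right (by omega)] at ha hb
    exact h₂ _ _ a b (by omega) (by omega) ha hb

theorem KPath.left {A B : List V} (h : KPath G k (A ++ B)) : KPath G k A := by
  intro i j a b hij hjk ha hb
  have hj : j < A.length := (List.getElem?_eq_some_iff.1 hb).1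
  refine h i j a b hij hjk ?_ ?_
  · rwa [List.getElem?_append_left (hij.trans hj)]
  · rwa [List.getElem?_append_left hj]

theorem KPath.right {A B : List V} (h : KPath G k (A ++ B)) : KPath G k B := by
  intro i j a b hij hjk ha hb
  refine h (A.length + i) (A.length + j) a b (by omega) (by omega) ?_ ?_
  · rw [List.getElem?_append_right (by omega)]; simpa using ha
  · rw [List.getElem?_append_right (by omega)]; simpa using hb

theorem KPath.of_pairwise {l : List V} (h : l.Pairwise G.Adj) : KPath G k l := by
  intro i j a b hij _ ha hb
  obtain ⟨hi, rfl⟩ := List.getElem?_eq_some_iff.1 ha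
  obtain ⟨hj, rfl⟩ := List.getElem?_eq_some_iff.1 hb
  exact List.pairwise_iff_getElem.1 h i j hi hj hij

theorem KPath.pairwise {l : List V} (h : KPath G k l) (hl : l.length ≤ k + 1) :
    l.Pairwise G.Adj := by
  rw [List.pairwise_iff_getElem]
  intro i j hi hj hij
  exact h i j _ _ hij (by omega) (List.getElem?_eq_getElem hi) (List.getElem?_eq_getElem hj)

theorem KPath.reverse {l : List V} (h : KPath G k l) : KPath G k l.reverse := by
  intro i j a b hij hjk ha hb
  have hj : j < l.length := by
    have := (List.getElem?_eq_some_iff.1 hb).1; simpa using this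
  rw [List.getElem?_reverse (by omega)] at ha hb
  exact (h _ _ b a (by omega) (by omega) hb ha).symm

theorem KPath.snoc {z m : List V} {v : V} (h : KPath G k (z ++ m)) (hm : m.length = k)
    (hv : ∀ u ∈ m, G.Adj u v) : KPath G k (z ++ (m ++ [v])) := by
  rw [← List.append_assoc]
  refine h.glue (.of_pairwise ?_) hm.ge
  rw [List.pairwise_append]
  exact ⟨h.right.pairwise (by omega), by simp, by simpa using hv⟩

theorem Cross.adj : ∀ {ys e : List V}, Cross G e ys → ∀ {i j : ℕ} {a b : V}, j ≤ i →
    e[i]? = some a → ys[j]? = some b → G.Adj a b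
  | [], _, _, _, _, _, _, _, _, hb => by simp at hb
  | v :: ys, e, h, i, 0, a, b, _, ha, hb => by
    obtain rfl : v = b := by simpa using hb
    exact h.1 a (List.mem_of_getElem? ha)
  | v :: ys, [], _, _, _ + 1, _, _, _, ha, _ => by simp at ha
  | v :: ys, u :: e, h, 0, j + 1, a, b, hij, ha, hb => by omega
  | v :: ys, u :: e, h, i + 1, j + 1, a, b, hij, ha, hb =>
    Cross.adj (ys := ys) (e := e) h.2 (Nat.le_of_succ_le_succ hij) (by simpa using ha)
      (by simpa using hb)

/-- If `e` has length `k`, entry `i` of `e` and entry `j` of `ys` are `k + j - i` positions apart,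
so adjacency is required exactly for `j ≤ i`: the staircase recorded by `Cross`. -/
theorem KPath.of_cross {e ys : List V} (he : e.Pairwise G.Adj) (hys : ys.Pairwise G.Adj)
    (hc : Cross G e ys) (hk : e.length = k ∨ e = []) : KPath G k (e ++ ys) := by
  intro i j a b hij hjk ha hb
  by_cases hj : j < e.length
  · rw [List.getElem?_append_left hj] at hb
    rw [List.getElem?_append_left (hij.trans hj)] at ha
    exact KPath.of_pairwise (k := k) he i j a b hij hjk ha hb
  rw [List.getElem?_append_right (by omega)] at hb
  by_cases hi : i < e.length
  · rw [List.getElem?_append_left hi] at ha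
    rcases hk with hk | rfl
    · exact hc.adj (by omega) ha hb
    · simp at hi
  · rw [List.getElem?_append_right (by omega)] at ha
    exact KPath.of_pairwise (k := k) hys _ _ a b (by omega) (by omega) ha hb

/-- Inserting a vertex only moves the old entries further apart, so no new adjacency between them is
needed. -/
theorem KPath.insert_middle {xs ys : List V} {r : V} (h : KPath G k (xs ++ ys))
    (hr : ∀ u ∈ xs ++ ys, G.Adj u r) : KPath G k (xs ++ r :: ys) := by
  have key : ∀ i a, (xs ++ r :: ys)[i]? = some a → (i = xs.length ∧ a = r) ∨
      (i < xs.length ∧ (xs ++ ys)[i]? = some a) ∨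
      (xs.length < i ∧ (xs ++ ys)[i - 1]? = some a) := by
    intro i a ha
    rcases lt_trichotomy i xs.length with hi | hi | hi
    · right; left
      rw [List.getElem?_append_left hi] at ha ⊢
      exact ⟨hi, ha⟩
    · left; subst hi; simp at ha; exact ⟨rfl, ha.symm⟩
    · right; right
      refine ⟨hi, ?_⟩
      rw [List.getElem?_append_right (by omega)] at ha ⊢
      obtain ⟨m, hm⟩ : ∃ m, i - xs.length = m + 1 := ⟨i - xs.length - 1, by omega⟩
      rw [hm, List.getElem?_cons_succ] at ha
      rwa [show i - 1 - xs.length = m by omega]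
  intro i j a b hij hjk ha hb
  rcases key i a ha with ⟨hi, rfl⟩ | ⟨hi, ha'⟩ | ⟨hi, ha'⟩ <;>
  rcases key j b hb with ⟨hj, rfl⟩ | ⟨hj, hb'⟩ | ⟨hj, hb'⟩
  · omega
  · omega
  · exact (hr b (List.mem_of_getElem? hb')).symm
  · exact hr a (List.mem_of_getElem? ha')
  · exact h _ _ a b hij hjk ha' hb'
  · exact h _ _ a b (by omega) (by omega) ha' hb'
  · exact hr a (List.mem_of_getElem? ha')
  · omega
  · exact h _ _ a b (by omega) (by omega) ha' hb'

variable [DecidableEq V]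

theorem PathOn.of_kpath {l : List V} {U : Finset V} (h : KPath G k l) (hl : l.Nodup)
    (hU : l.toFinset = U) : PathOn G k l l U :=
  ⟨l, h, hl, hU, List.prefix_rfl, List.suffix_rfl⟩

theorem PathOn.glue {x e c q f : List V} {U U' : Finset V} (h : PathOn G k x e U)
    (hc : KPath G k (e ++ c ++ q)) (hcn : c.Nodup) (h' : PathOn G k q f U')
    (he : e.length = k) (hq : q.length = k) (hUc : Disjoint U c.toFinset)
    (hUU : Disjoint U U') (hcU : Disjoint c.toFinset U') :
    PathOn G k x f (U ∪ c.toFinset ∪ U') := by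
  obtain ⟨P, hP, hPn, rfl, hxP, A, rfl⟩ := h
  obtain ⟨P', hP', hPn', rfl, ⟨B, rfl⟩, hfP⟩ := h'
  refine ⟨A ++ e ++ c ++ (q ++ B), ?_, ?_, ?_, ?_, ?_⟩
  · have h₁ : KPath G k (A ++ e ++ (c ++ q)) := hP.glue (by simpa using hc) he.ge
    have h₂ := KPath.glue (A := A ++ e ++ c) (by simpa using h₁) hP' hq.ge
    simpa using h₂
  · rw [List.nodup_append, List.nodup_append]
    refine ⟨⟨hPn, hcn, ?_⟩, hPn', ?_⟩
    · intro a ha b hb hab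
      subst hab
      exact Finset.disjoint_left.1 hUc (List.mem_toFinset.2 ha) (List.mem_toFinset.2 hb)
    · intro a ha b hb hab
      subst hab
      rcases List.mem_append.1 ha with ha | ha
      · exact Finset.disjoint_left.1 hUU (List.mem_toFinset.2 ha) (List.mem_toFinset.2 hb)
      · exact Finset.disjoint_left.1 hcU (List.mem_toFinset.2 ha) (List.mem_toFinset.2 hb)
  · simp only [List.toFinset_append]
  · exact hxP.trans ⟨c ++ (q ++ B), by simp⟩
  · exact hfP.trans ⟨A ++ e ++ c, by simp⟩

end KPaths

/-! ### Jumbled graphs and the greedy choice of cliques. -/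

section Jumbledness

open scoped Classical in
/-- The neighbours of `v` in `Y`. -/
noncomputable def nb {V : Type*} (G : SimpleGraph V) (v : V) (Y : Finset V) : Finset V :=
  Y.filter fun u => G.Adj v u

open scoped Classical in
/-- The common neighbours of `W` in `S`. -/
noncomputable def cn {V : Type*} (G : SimpleGraph V) (W S : Finset V) : Finset V :=
  S.filter fun u => ∀ w ∈ W, G.Adj w u

/-- Edge counts between any two sets deviate little from those of a random graph of
density `p`. -/
structure Jumbled {V : Type*} (G : SimpleGraph V) (p κ : ℝ) : Prop where
  pos : 0 < p
  le_one : p ≤ 1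
  nonneg : 0 ≤ κ
  dev (X Y : Finset V) :
    ((∑ x ∈ X, ((nb G x Y).card : ℝ)) - p * X.card * Y.card) ^ 2 ≤ κ * p ^ 2 * X.card * Y.card

variable {V : Type*} {G : SimpleGraph V} {p κ : ℝ}

@[simp] theorem mem_nb {v u : V} {Y : Finset V} : u ∈ nb G v Y ↔ u ∈ Y ∧ G.Adj v u := by
  simp [nb]

@[simp] theorem mem_cn {u : V} {W S : Finset V} :
    u ∈ cn G W S ↔ u ∈ S ∧ ∀ w ∈ W, G.Adj w u := by
  simp [cn]

theorem nb_subset (v : V) (Y : Finset V) : nb G v Y ⊆ Y := fun _ h => (mem_nb.1 h).1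

theorem cn_subset (W S : Finset V) : cn G W S ⊆ S := fun _ h => (mem_cn.1 h).1

theorem nb_mono (v : V) {Y Y' : Finset V} (h : Y ⊆ Y') : nb G v Y ⊆ nb G v Y' :=
  fun _ hu => mem_nb.2 ⟨h (mem_nb.1 hu).1, (mem_nb.1 hu).2⟩

theorem cn_mono (W : Finset V) {Y Y' : Finset V} (h : Y ⊆ Y') : cn G W Y ⊆ cn G W Y' :=
  fun _ hu => mem_cn.2 ⟨h (mem_cn.1 hu).1, (mem_cn.1 hu).2⟩

theorem nb_comm (u v : V) (Y : Finset V) : nb G u (nb G v Y) = nb G v (nb G u Y) := by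
  ext w; simp only [mem_nb]; tauto

theorem cn_nb (v : V) (W Y : Finset V) : cn G W (nb G v Y) = nb G v (cn G W Y) := by
  ext w; simp only [mem_nb, mem_cn]; tauto

@[simp] theorem cn_empty (S : Finset V) : cn G ∅ S = S := by ext; simp

theorem cn_insert [DecidableEq V] (v : V) (W S : Finset V) :
    cn G (insert v W) S = nb G v (cn G W S) := by
  ext w; simp only [mem_nb, mem_cn, Finset.mem_insert, forall_eq_or_imp]; tauto

theorem cn_singleton (v : V) (S : Finset V) : cn G {v} S = nb G v S := by
  ext; simp

theorem sum_nb_comm (X Y : Finset V) :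
    ∑ x ∈ X, ((nb G x Y).card : ℝ) = ∑ y ∈ Y, ((nb G y X).card : ℝ) := by
  classical
  have h := Finset.sum_card_bipartiteAbove_eq_sum_card_bipartiteBelow (s := X) (t := Y)
    (fun a b => G.Adj a b)
  have h₁ : ∀ x, nb G x Y = Finset.bipartiteAbove (fun a b => G.Adj a b) Y x := by
    intro x; ext; simp [Finset.mem_bipartiteAbove]
  have h₂ : ∀ y, nb G y X = Finset.bipartiteBelow (fun a b => G.Adj a b) X y := by
    intro x; ext; simp [Finset.mem_bipartiteBelow, G.adj_comm]
  simp only [h₁, h₂]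
  exact_mod_cast h

/-- At least half of the expected `p|X||Y|` edges are missing, so the square of `p|X||Y|/2` is at
most `κp²|X||Y|`; a common factor cancels. -/
theorem Jumbled.few_low (h : Jumbled G p κ) {X Y : Finset V}
    (hX : ∀ v ∈ X, ((nb G v Y).card : ℝ) ≤ p / 2 * Y.card) :
    (X.card : ℝ) * Y.card ≤ 4 * κ := by
  have hp := h.pos
  have h₁ : ∑ x ∈ X, ((nb G x Y).card : ℝ) ≤ p / 2 * (X.card * Y.card) := by
    calc _ ≤ ∑ x ∈ X, p / 2 * (Y.card : ℝ) := Finset.sum_le_sum fun x hx => hX x hx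
      _ = _ := by rw [Finset.sum_const, nsmul_eq_mul]; ring
  have h₂ := h.dev X Y
  set t : ℝ := X.card * Y.card with ht
  have ht0 : 0 ≤ t := by positivity
  have h₃ : (p / 2 * t) ^ 2 ≤ κ * p ^ 2 * t := by
    have e1 : κ * p ^ 2 * X.card * Y.card = κ * p ^ 2 * t := by rw [ht]; ring
    have e2 : p * X.card * Y.card = p * t := by rw [ht]; ring
    rw [e1, e2] at h₂
    nlinarith [mul_nonneg hp.le ht0]
  rcases ht0.eq_or_lt with h0 | h0
  · linarith [h.nonneg]
  · have : (p ^ 2 * t) * t ≤ (p ^ 2 * t) * (4 * κ) := by nlinarith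
    exact le_of_mul_le_mul_left this (by positivity)

theorem Jumbled.few_high (h : Jumbled G p κ) {X Y : Finset V}
    (hX : ∀ v ∈ X, 2 * p * Y.card ≤ ((nb G v Y).card : ℝ)) :
    (X.card : ℝ) * Y.card ≤ κ := by
  have hp := h.pos
  have h₁ : 2 * p * (X.card * Y.card) ≤ ∑ x ∈ X, ((nb G x Y).card : ℝ) := by
    calc _ = ∑ x ∈ X, 2 * p * (Y.card : ℝ) := by rw [Finset.sum_const, nsmul_eq_mul]; ring
      _ ≤ _ := Finset.sum_le_sum fun x hx => hX x hx
  have h₂ := h.dev X Y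
  set t : ℝ := X.card * Y.card with ht
  have ht0 : 0 ≤ t := by positivity
  have h₃ : (p * t) ^ 2 ≤ κ * p ^ 2 * t := by
    have e1 : κ * p ^ 2 * X.card * Y.card = κ * p ^ 2 * t := by rw [ht]; ring
    have e2 : p * X.card * Y.card = p * t := by rw [ht]; ring
    rw [e1, e2] at h₂
    nlinarith [mul_nonneg hp.le ht0]
  rcases ht0.eq_or_lt with h0 | h0
  · linarith [h.nonneg]
  · have : (p ^ 2 * t) * t ≤ (p ^ 2 * t) * κ := by nlinarith
    exact le_of_mul_le_mul_left this (by positivity)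

theorem Jumbled.few_disconnected (h : Jumbled G p κ) {X Y : Finset V}
    (hX : ∀ v ∈ X, ∀ u ∈ Y, ¬ G.Adj v u) : (X.card : ℝ) * Y.card ≤ 4 * κ := by
  refine h.few_low fun v hv => ?_
  have : nb G v Y = ∅ := by
    ext u; simp only [mem_nb, Finset.notMem_empty, iff_false]; exact fun hu => hX v hv u hu.1 hu.2
  rw [this]; have := h.pos; simp; positivity

theorem Jumbled.sum_le (h : Jumbled G p κ) (X Y : Finset V) :
    ∑ x ∈ X, ((nb G x Y).card : ℝ) ≤ p * X.card * Y.card + p * √(κ * X.card * Y.card) := by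
  have h₁ := Real.abs_le_sqrt (h.dev X Y)
  have e : √(κ * p ^ 2 * X.card * Y.card) = p * √(κ * X.card * Y.card) := by
    rw [show κ * p ^ 2 * X.card * Y.card = p ^ 2 * (κ * X.card * Y.card) by ring,
      Real.sqrt_mul (by positivity), Real.sqrt_sq h.pos.le]
  rw [e] at h₁
  linarith [(abs_le.1 h₁).2]

/-- A large set contains a vertex with the right number of neighbours in each of finitely many
large sets. -/
theorem Jumbled.pick (h : Jumbled G p κ) (B : Finset V) (Z : Finset (Finset V))
    {β : ℝ} (hβ : 0 < β) (hZ : ∀ Y ∈ Z, β ≤ B.card * Y.card) (hB : 0 < B.card)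
    (hκ : 4 * Z.card * κ < β) :
    ∃ v ∈ B, ∀ Y ∈ Z, p / 2 * Y.card ≤ ((nb G v Y).card : ℝ) := by
  classical
  by_contra hcon
  push Not at hcon
  -- Otherwise `B` is covered by the sets of vertices with low degree into some `Y ∈ Z`, each of
  -- which has at most `4κ|B|/β` elements by `Jumbled.few_low`.
  have hcov : B ⊆ Z.biUnion fun Y => B.filter fun v => ((nb G v Y).card : ℝ) < p / 2 * Y.card := by
    intro v hv
    obtain ⟨Y, hY, hlt⟩ := hcon v hv
    exact Finset.mem_biUnion.2 ⟨Y, hY, Finset.mem_filter.2 ⟨hv, hlt⟩⟩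
  have hb : (0 : ℝ) < B.card := by exact_mod_cast hB
  have h₁ : (B.card : ℝ) ≤ ∑ Y ∈ Z, 4 * κ * B.card / β := by
    calc (B.card : ℝ) ≤ ∑ Y ∈ Z,
          ((B.filter fun v => ((nb G v Y).card : ℝ) < p / 2 * Y.card).card : ℝ) := by
          exact_mod_cast (Finset.card_le_card hcov).trans Finset.card_biUnion_le
      _ ≤ _ := by
          refine Finset.sum_le_sum fun Y hY => ?_
          have h₂ := h.few_low (X := B.filter fun v => ((nb G v Y).card : ℝ) < p / 2 * Y.card)
            (Y := Y) fun v hv => (Finset.mem_filter.1 hv).2.le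
          rw [le_div_iff₀ hβ]
          have h₃ := hZ Y hY
          have h₄ := mul_le_mul_of_nonneg_left h₃ (Nat.cast_nonneg (α := ℝ)
            (B.filter fun v => ((nb G v Y).card : ℝ) < p / 2 * Y.card).card)
          nlinarith
  rw [Finset.sum_const, nsmul_eq_mul] at h₁
  have h₂ : (Z.card : ℝ) * (4 * κ * B.card / β) < B.card := by
    rw [mul_div_assoc', div_lt_iff₀ hβ]
    nlinarith
  linarith

/-- Greedy extension of the clique `e` by vertices from the sets `Bs`, such that all sets of new
vertices have many common neighbours in each of the sets of `Z`. -/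
theorem Jumbled.greedy (h : Jumbled G p κ) [DecidableEq V] :
    ∀ (Bs : List (Finset V)) (e : List V) (Z : Finset (Finset V)) (γ : ℝ) (N : ℕ),
      (∀ B ∈ Bs, B ∈ Z) → 0 < γ →
      (∀ W ⊆ e.toFinset, ∀ Y ∈ Z, γ * p ^ W.card ≤ (cn G W Y).card) →
      2 * e.length ≤ N + 1 → 2 * Bs.length ≤ N + 2 →
      (Bs ≠ [] → 4 * (Z.card * 2 ^ Bs.length * 2 ^ e.length) * κ < γ ^ 2 * (p / 2) ^ N) →
      ∃ ys : List V, List.Forall₂ (· ∈ ·) ys Bs ∧ ys.Pairwise G.Adj ∧ Cross G e ys ∧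
        ∀ W ⊆ ys.toFinset, ∀ Y ∈ Z, (p / 2) ^ W.card * Y.card ≤ ((cn G W Y).card : ℝ)
  | [], e, Z, γ, N, _, _, _, _, _, _ => by
    refine ⟨[], .nil, .nil, trivial, fun W hW Y _ => ?_⟩
    obtain rfl : W = ∅ := by simpa using hW
    simp
  | B :: Bs, e, Z, γ, N, hBZ, hγ, hW, heN, hmN, hκ => by
    have hp := h.pos
    have hp1 := h.le_one
    have hκ' := hκ (by simp)
    -- The next vertex must be adjacent to all of `e`, but the later ones need not be adjacent to
    -- the first entry of `e`. So the vertex is picked in `C`, and its degree is controlled only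
    -- into the sets of `T`, the common neighbourhoods of subsets of the tail. The sizes multiply to
    -- at least `γ² p^(2|e| - 1)`, which is at least `γ² p^N`.
    set C := cn G e.toFinset B with hC
    set T : Finset (Finset V) := (e.tail.toFinset.powerset ×ˢ Z).image fun q => cn G q.1 q.2
      with hT
    have htail : e.tail.toFinset ⊆ e.toFinset := by
      intro a ha; simp only [List.mem_toFinset] at ha ⊢; exact List.mem_of_mem_tail ha
    have hCc : γ * p ^ e.length ≤ C.card := by
      refine le_trans ?_ (hW _ subset_rfl B (hBZ B (by simp)))
      exact mul_le_mul_of_nonneg_left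
        (pow_le_pow_of_le_one hp.le hp1 (List.toFinset_card_le e)) hγ.le
    have hTc : ∀ Y ∈ T, γ * p ^ (e.length - 1) ≤ Y.card := by
      intro Y hY
      obtain ⟨⟨W, Y'⟩, hmem, rfl⟩ := Finset.mem_image.1 hY
      obtain ⟨hW1, hY1⟩ := Finset.mem_product.1 hmem
      rw [Finset.mem_powerset] at hW1
      refine le_trans ?_ (hW W (hW1.trans htail) Y' hY1)
      refine mul_le_mul_of_nonneg_left (pow_le_pow_of_le_one hp.le hp1 ?_) hγ.le
      refine (Finset.card_le_card hW1).trans ((List.toFinset_card_le _).trans ?_)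
      simp
    have hTcard : (T.card : ℝ) ≤ Z.card * 2 ^ e.length := by
      have h1 : T.card ≤ Z.card * 2 ^ e.length := by
        refine Finset.card_image_le.trans ?_
        rw [Finset.card_product, Finset.card_powerset, mul_comm]
        refine Nat.mul_le_mul_left _ (Nat.pow_le_pow_right (by norm_num) ?_)
        exact (List.toFinset_card_le _).trans (by simp)
      exact_mod_cast h1
    have hp2 : (p / 2) ^ N ≤ p ^ N := by gcongr; linarith
    have hβ : ∀ Y ∈ T, γ ^ 2 * (p / 2) ^ N ≤ C.card * Y.card := by
      intro Y hY
      calc γ ^ 2 * (p / 2) ^ N ≤ γ ^ 2 * p ^ N := by gcongr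
        _ ≤ γ ^ 2 * p ^ (e.length + (e.length - 1)) := by
            refine mul_le_mul_of_nonneg_left (pow_le_pow_of_le_one hp.le hp1 ?_) (by positivity)
            omega
        _ = (γ * p ^ e.length) * (γ * p ^ (e.length - 1)) := by rw [pow_add]; ring
        _ ≤ _ := mul_le_mul hCc (hTc Y hY) (by positivity) (by positivity)
    have hκ0 := h.nonneg
    obtain ⟨v, hvC, hv⟩ := h.pick C T (β := γ ^ 2 * (p / 2) ^ N) (by positivity) hβ
      (by have : (0 : ℝ) < C.card := lt_of_lt_of_le (by positivity) hCc
          exact_mod_cast this) (by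
        refine lt_of_le_of_lt ?_ hκ'
        refine mul_le_mul_of_nonneg_right ?_ hκ0
        refine mul_le_mul_of_nonneg_left (hTcard.trans ?_) (by norm_num)
        have : (1 : ℝ) ≤ 2 ^ (B :: Bs).length := one_le_pow₀ (by norm_num)
        have h0 : (0 : ℝ) ≤ Z.card * 2 ^ e.length := by positivity
        nlinarith)
    have hv' : ∀ W ⊆ e.tail.toFinset, ∀ Y ∈ Z,
        p / 2 * (cn G W Y).card ≤ ((nb G v (cn G W Y)).card : ℝ) := fun W hW1 Y hY =>
      hv _ (Finset.mem_image.2 ⟨(W, Y), Finset.mem_product.2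
        ⟨Finset.mem_powerset.2 hW1, hY⟩, rfl⟩)
    -- Every set is kept together with its part inside the neighbourhood of `v`; this doubles the
    -- number of sets at each step and accounts for the factor `2 ^ Bs.length`. The lower bound `γ`
    -- loses a factor `p/2`, and since it enters squared, `N` drops by 2.
    obtain ⟨ys, hys1, hys2, hys3, hys4⟩ := Jumbled.greedy h (Bs.map (nb G v)) e.tail
      (Z ∪ Z.image (nb G v)) (γ * (p / 2)) (N - 2) (by
        intro B' hB'
        obtain ⟨B₀, hB₀, rfl⟩ := List.mem_map.1 hB'
        exact Finset.mem_union_right _ (Finset.mem_image_of_mem _ (hBZ B₀ (by simp [hB₀]))))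
      (by positivity) (by
        intro W hW1 Y hY
        rcases Finset.mem_union.1 hY with hY | hY
        · refine le_trans ?_ (hW W (hW1.trans htail) Y hY)
          have : 0 ≤ γ * p ^ W.card := by positivity
          nlinarith
        · obtain ⟨Y', hY', rfl⟩ := Finset.mem_image.1 hY
          rw [cn_nb]
          refine le_trans ?_ (hv' W hW1 Y' hY')
          have := hW W (hW1.trans htail) Y' hY'
          nlinarith)
      (by simp only [List.length_tail]; omega)
      (by simp only [List.length_map, List.length_cons] at hmN ⊢; omega) (by
        intro hne
        have hlen : 1 ≤ Bs.length := by
          rw [ne_eq, List.map_eq_nil_iff] at hne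
          exact List.length_pos_iff.2 hne
        obtain ⟨N', rfl⟩ : ∃ N', N = N' + 2 := ⟨N - 2, by simp only [List.length_cons] at hmN; omega⟩
        calc 4 * (((Z ∪ Z.image (nb G v)).card : ℝ) * 2 ^ (Bs.map (nb G v)).length *
              2 ^ e.tail.length) * κ
            ≤ 4 * ((Z.card * 2) * 2 ^ Bs.length * 2 ^ e.length) * κ := by
              have h1 : ((Z ∪ Z.image (nb G v)).card : ℝ) ≤ Z.card * 2 := by
                have : (Z ∪ Z.image (nb G v)).card ≤ Z.card * 2 := by
                  refine (Finset.card_union_le _ _).trans ?_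
                  have := Finset.card_image_le (s := Z) (f := nb G v)
                  omega
                exact_mod_cast this
              have h2 : (2 : ℝ) ^ e.tail.length ≤ 2 ^ e.length :=
                pow_le_pow_right₀ (by norm_num) (by simp)
              rw [List.length_map]
              gcongr
          _ = 4 * (Z.card * 2 ^ (B :: Bs).length * 2 ^ e.length) * κ := by
              rw [List.length_cons, pow_succ]; ring
          _ < γ ^ 2 * (p / 2) ^ (N' + 2) := hκ'
          _ = _ := by rw [Nat.add_sub_cancel, pow_add]; ring)
    have hmem : ∀ y ∈ ys, G.Adj v y := by
      intro y hy
      obtain ⟨i, hi, rfl⟩ := List.getElem_of_mem hy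
      have hl := hys1.length_eq
      have := List.forall₂_iff_get.1 hys1 |>.2 i hi (hl ▸ hi)
      simp only [List.get_eq_getElem, List.getElem_map, mem_nb] at this
      exact this.2
    refine ⟨v :: ys, .cons (cn_subset _ _ hvC) ?_, List.pairwise_cons.2 ⟨hmem, hys2⟩,
      ⟨fun u hu => (mem_cn.1 hvC).2 u (List.mem_toFinset.2 hu), hys3⟩, ?_⟩
    · rw [List.forall₂_map_right_iff] at hys1
      exact hys1.imp fun a b hab => nb_subset _ _ hab
    · intro W hW1 Y hY
      by_cases hvW : v ∈ W
      · have hsub : W.erase v ⊆ ys.toFinset := by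
          intro a ha
          have := hW1 (Finset.mem_of_mem_erase ha)
          simp only [List.toFinset_cons, Finset.mem_insert] at this
          exact this.resolve_left (Finset.ne_of_mem_erase ha)
        have h1 := hys4 _ hsub (nb G v Y)
          (Finset.mem_union_right _ (Finset.mem_image_of_mem _ hY))
        have h2 := hv' ∅ (by simp) Y hY
        rw [cn_empty] at h2
        have h3 : cn G W Y = cn G (W.erase v) (nb G v Y) := by
          rw [cn_nb, ← cn_insert, Finset.insert_erase hvW]
        rw [h3]
        refine le_trans ?_ h1
        rw [← Finset.card_erase_add_one hvW, pow_succ, mul_assoc]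
        gcongr
      · refine hys4 W ?_ Y (Finset.mem_union_left _ hY)
        intro a ha
        have := hW1 ha
        simp only [List.toFinset_cons, Finset.mem_insert] at this
        exact this.resolve_left (by rintro rfl; exact hvW ha)
termination_by Bs => Bs.length

end Jumbledness

/-! ### Nested "almost all" quantifiers over cliques. -/

open scoped Classical in
/-- For all but an `η`-fraction of the `v ∈ B`, the same holds, recursively, for the
neighbourhoods of `v` in the remaining sets; the tuples chosen in this way satisfy `P`. -/
def Most {V : Type*} (G : SimpleGraph V) (η : ℝ) : List (Finset V) → (List V → Prop) → Prop
  | [], P => P []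
  | B :: Bs, P =>
    ((B.filter fun v => ¬ Most G η (Bs.map (nb G v)) fun l => P (v :: l)).card : ℝ) ≤ η * B.card
termination_by Bs => Bs.length

/-- The common neighbours in `S` of the entries of a list. -/
noncomputable def cnl {V : Type*} (G : SimpleGraph V) : List V → Finset V → Finset V
  | [], S => S
  | v :: l, S => cnl G l (nb G v S)

section MostTuples

variable {V : Type*} {G : SimpleGraph V} {p κ : ℝ}

@[simp] theorem mem_cnl {u : V} : ∀ {l : List V} {S : Finset V},
    u ∈ cnl G l S ↔ u ∈ S ∧ ∀ w ∈ l, G.Adj w u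
  | [], S => by simp [cnl]
  | v :: l, S => by rw [cnl, mem_cnl, mem_nb]; simp [and_assoc]

theorem Most.nil {η : ℝ} {P : List V → Prop} : Most G η [] P ↔ P [] := by rw [Most]

open scoped Classical in
theorem Most.cons {η : ℝ} {B : Finset V} {Bs : List (Finset V)} {P : List V → Prop} :
    Most G η (B :: Bs) P ↔
      ((B.filter fun v => ¬ Most G η (Bs.map (nb G v)) fun l => P (v :: l)).card : ℝ)
        ≤ η * B.card := by rw [Most]

theorem Most.mono {η η' : ℝ} (hη : η ≤ η') : ∀ {Bs : List (Finset V)} {P Q : List V → Prop},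
    Most G η Bs P → (∀ l, P l → Q l) → Most G η' Bs Q
  | [], P, Q, h, hPQ => Most.nil.2 (hPQ _ (Most.nil.1 h))
  | B :: Bs, P, Q, h, hPQ => by
    classical
    rw [Most.cons] at h ⊢
    refine le_trans ?_ (h.trans (mul_le_mul_of_nonneg_right hη (Nat.cast_nonneg _)))
    refine Nat.cast_le.2 (Finset.card_le_card fun v hv => ?_)
    simp only [Finset.mem_filter] at hv ⊢
    exact ⟨hv.1, fun hm => hv.2 (Most.mono hη hm fun l => hPQ _)⟩
termination_by Bs => Bs.length

theorem Most.and {η η' : ℝ} (hη : 0 ≤ η) (hη' : 0 ≤ η') :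
    ∀ {Bs : List (Finset V)} {P Q : List V → Prop},
    Most G η Bs P → Most G η' Bs Q → Most G (η + η') Bs (fun l => P l ∧ Q l)
  | [], P, Q, h, h' => Most.nil.2 ⟨Most.nil.1 h, Most.nil.1 h'⟩
  | B :: Bs, P, Q, h, h' => by
    classical
    rw [Most.cons] at h h' ⊢
    rw [add_mul]
    refine le_trans ?_ (add_le_add h h')
    norm_cast
    refine (Finset.card_le_card fun v hv => ?_).trans (Finset.card_union_le _ _)
    simp only [Finset.mem_filter, Finset.mem_union] at hv ⊢
    by_contra hcon
    push Not at hcon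
    exact hv.2 (Most.and hη hη' (hcon.1 hv.1) (hcon.2 hv.1))
termination_by Bs => Bs.length

theorem Most.of_forall {η : ℝ} (hη : 0 ≤ η) : ∀ {Bs : List (Finset V)} {P : List V → Prop},
    (∀ l, List.Forall₂ (· ∈ ·) l Bs → l.Pairwise G.Adj → P l) → Most G η Bs P
  | [], P, h => Most.nil.2 (h _ .nil .nil)
  | B :: Bs, P, h => by
    classical
    rw [Most.cons, Finset.filter_false_of_mem]
    · simp; positivity
    intro v hv
    rw [not_not]
    refine Most.of_forall hη fun l hl hp => h _ ?_ ?_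
    · rw [List.forall₂_map_right_iff] at hl
      exact .cons hv (hl.imp fun a b hab => nb_subset _ _ hab)
    · refine List.pairwise_cons.2 ⟨fun y hy => ?_, hp⟩
      obtain ⟨i, hi, rfl⟩ := List.getElem_of_mem hy
      have := List.forall₂_iff_get.1 hl |>.2 i hi (hl.length_eq ▸ hi)
      simp only [List.get_eq_getElem, List.getElem_map, mem_nb] at this
      exact this.2
termination_by Bs => Bs.length

-- `Most` is defined by peeling off the first set; this form exposes the innermost quantifier, which
-- is where a path acquires a new last vertex.
open scoped Classical in
theorem Most.append_singleton {η : ℝ} {C : Finset V} :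
    ∀ {Bs : List (Finset V)} {P : List V → Prop}, Most G η (Bs ++ [C]) P ↔
      Most G η Bs fun l =>
        (((cnl G l C).filter fun v => ¬ P (l ++ [v])).card : ℝ) ≤ η * (cnl G l C).card
  | [], P => by simp [Most.nil, Most.cons, cnl]
  | B :: Bs, P => by
    have ih := fun v (Q : List V → Prop) =>
      Most.append_singleton (η := η) (C := nb G v C) (Bs := Bs.map (nb G v)) (P := Q)
    rw [List.cons_append, Most.cons, Most.cons]
    simp only [List.map_append, List.map_cons, List.map_nil, ih, cnl, List.cons_append]
termination_by Bs => Bs.length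

/-- The numerical contradiction behind `Jumbled.swap`. On the left stand the expected number of
edges from an exceptional set of size `A₀`, their deviation, and the bad edges at all other vertices
of `A`; on the right stands the number of bad edges seen from the other side. -/
theorem swap_arith {a b x κ η p A₀ : ℝ} (hη : 0 < η) (hη1 : η ≤ 1) (hp : 0 < p)
    (ha : 0 < a) (hx : 0 < x) (hA0 : 0 ≤ A₀) (hA : A₀ ≤ η ^ 2 / 16 * a) (hbx : η / 2 * b < x)
    (hab : 1000 * κ < η ^ 3 * (a * b)) :
    p * A₀ * x + p * √(κ * A₀ * x) + a * (η ^ 2 / 16 * p * b) < x * (η * (p / 2 * a)) := by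
  have hsq : √(κ * A₀ * x) ≤ η / 8 * (a * x) := by
    refine Real.sqrt_le_iff.2 ⟨by positivity, ?_⟩
    have h1 : κ ≤ η ^ 2 * (a * x) / 500 := by
      have : η ^ 3 * (a * b) = 2 * η ^ 2 * a * (η / 2 * b) := by ring
      have h2 : 2 * η ^ 2 * a * (η / 2 * b) ≤ 2 * η ^ 2 * a * x := by gcongr
      linarith
    calc κ * A₀ * x ≤ (η ^ 2 * (a * x) / 500) * (η ^ 2 / 16 * a) * x := by gcongr
      _ = η ^ 2 * (η ^ 2 * (a * x) ^ 2) / 8000 := by ring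
      _ ≤ 1 * (η ^ 2 * (a * x) ^ 2) / 8000 := by
          gcongr; exact pow_le_one₀ hη.le hη1
      _ ≤ _ := by
          have : 0 ≤ η ^ 2 * (a * x) ^ 2 := by positivity
          linarith
  have h1 : A₀ * x ≤ η / 16 * (a * x) := by
    calc A₀ * x ≤ η ^ 2 / 16 * a * x := by gcongr
      _ = η * (η / 16 * (a * x)) := by ring
      _ ≤ 1 * (η / 16 * (a * x)) := by gcongr
      _ = _ := one_mul _
  have h2 : a * (η ^ 2 / 16 * b) ≤ η / 8 * (a * x) := by
    calc a * (η ^ 2 / 16 * b) = η / 8 * a * (η / 2 * b) := by ring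
      _ ≤ η / 8 * a * x := by gcongr
      _ = _ := by ring
  have h3 : 0 < η * (a * x) := by positivity
  calc p * A₀ * x + p * √(κ * A₀ * x) + a * (η ^ 2 / 16 * p * b)
      = p * (A₀ * x + √(κ * A₀ * x) + a * (η ^ 2 / 16 * b)) := by ring
    _ ≤ p * (5 / 16 * (η * (a * x))) := by gcongr; linarith
    _ < p * (1 / 2 * (η * (a * x))) := mul_lt_mul_of_pos_left (by linarith) hp
    _ = _ := by ring

open scoped Classical in
/-- If for most `a ∈ A` most of the neighbours of `a` in `B` are good, then most `b ∈ B` are good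
for most of their neighbours in `A`. -/
theorem Jumbled.swap (h : Jumbled G p κ) {η : ℝ} (hη : 0 < η) (hη1 : η ≤ 1) (A B : Finset V)
    (R : V → V → Prop) (hAB : 1000 * κ < η ^ 3 * (A.card * B.card))
    (hR : ((A.filter fun a => ¬ (((nb G a B).filter fun b => ¬ R a b).card : ℝ) ≤
      η ^ 2 / 32 * (nb G a B).card).card : ℝ) ≤ η ^ 2 / 32 * A.card) :
    ((B.filter fun b => ¬ (p / 2 * A.card ≤ ((nb G b A).card : ℝ) ∧
      (((nb G b A).filter fun a => ¬ R a b).card : ℝ) ≤ η * (nb G b A).card)).card : ℝ)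
      ≤ η * B.card := by
  have hp := h.pos
  have hκ := h.nonneg
  set a : ℝ := (A.card : ℝ) with ha
  set b : ℝ := (B.card : ℝ) with hb
  have ha0 : 0 ≤ a := by positivity
  have hb0 : 0 ≤ b := by positivity
  have hab : 0 < a * b := by
    by_contra hcon
    have : a * b = 0 := le_antisymm (not_lt.1 hcon) (by positivity)
    rw [this] at hAB; linarith
  have ha1 : 0 < a := lt_of_le_of_ne ha0 (by rintro h0; rw [← h0] at hab; simp at hab)
  have hb1 : 0 < b := lt_of_le_of_ne hb0 (by rintro h0; rw [← h0] at hab; simp at hab)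
  -- vertices of `B` with few neighbours in `A`
  set B₁ := B.filter fun v => ((nb G v A).card : ℝ) < p / 2 * a with hB₁
  have hB₁c : (B₁.card : ℝ) * a ≤ 4 * κ :=
    h.few_low fun v hv => (Finset.mem_filter.1 hv).2.le
  have hB₁b : (B₁.card : ℝ) ≤ η / 2 * b := by
    have h1 : (B₁.card : ℝ) * a ≤ (η / 2 * b) * a := by
      have : η ^ 3 ≤ η := by
        calc η ^ 3 ≤ η ^ 1 := pow_le_pow_of_le_one hη.le hη1 (by norm_num)
          _ = η := pow_one η
      nlinarith
    exact le_of_mul_le_mul_right h1 ha1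
  -- vertices of `A` with too many neighbours in `B`
  set A₁ := A.filter fun v => 2 * p * b < ((nb G v B).card : ℝ) with hA₁
  have hA₁c : (A₁.card : ℝ) * b ≤ κ :=
    h.few_high fun v hv => (Finset.mem_filter.1 hv).2.le
  have hA₁b : (A₁.card : ℝ) ≤ η ^ 2 / 32 * a := by
    have h1 : (A₁.card : ℝ) * b ≤ (η ^ 2 / 32 * a) * b := by
      have : η ^ 3 ≤ η ^ 2 := pow_le_pow_of_le_one hη.le hη1 (by norm_num)
      nlinarith
    exact le_of_mul_le_mul_right h1 hb1
  set A₂ := A.filter fun a => ¬ (((nb G a B).filter fun b => ¬ R a b).card : ℝ) ≤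
      η ^ 2 / 32 * (nb G a B).card with hA₂
  set A₀ := A₁ ∪ A₂ with hA₀
  have hA₀c : (A₀.card : ℝ) ≤ η ^ 2 / 16 * a := by
    have : (A₀.card : ℝ) ≤ A₁.card + A₂.card := by exact_mod_cast Finset.card_union_le _ _
    linarith
  set X := B.filter fun b => p / 2 * a ≤ ((nb G b A).card : ℝ) ∧
    η * (nb G b A).card < (((nb G b A).filter fun a => ¬ R a b).card : ℝ) with hX
  have hXB : X ⊆ B := Finset.filter_subset _ _
  have hXb : (X.card : ℝ) ≤ b := Nat.cast_le.2 (Finset.card_le_card hXB)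
  -- Double counting of the bad edges between `A` and `X`. Each vertex of `X` has at least
  -- `η(p/2)|A|` of them. A vertex of `A` outside `A₀` has at most `(η²/32)·2p|B|`, and the edges at
  -- `A₀`, a set of at most `(η²/16)|A|` vertices, are few by jumbledness.
  have hXc : (X.card : ℝ) ≤ η / 2 * b := by
    by_contra hcon
    push Not at hcon
    set x : ℝ := (X.card : ℝ) with hx
    have hx0 : 0 < x := lt_of_le_of_lt (by positivity) hcon
    have lower : x * (η * (p / 2 * a)) ≤
        ∑ b ∈ X, (((nb G b A).filter fun a => ¬ R a b).card : ℝ) := by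
      calc x * (η * (p / 2 * a)) = ∑ b ∈ X, η * (p / 2 * a) := by
            rw [Finset.sum_const, nsmul_eq_mul]
        _ ≤ _ := Finset.sum_le_sum fun b hb => by
            have h1 := (Finset.mem_filter.1 hb).2
            exact (mul_le_mul_of_nonneg_left h1.1 hη.le).trans h1.2.le
    have dc : ∑ b ∈ X, ((nb G b A).filter fun a => ¬ R a b).card =
        ∑ a ∈ A, ((nb G a X).filter fun b => ¬ R a b).card := by
      have h0 := Finset.sum_card_bipartiteAbove_eq_sum_card_bipartiteBelow (s := X) (t := A)
        (fun b a => G.Adj a b ∧ ¬ R a b)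
      convert h0 using 2
      · rename_i z _
        congr 1; ext; simp only [Finset.mem_filter, mem_nb, Finset.mem_bipartiteAbove,
          G.adj_comm z]; tauto
      · congr 1; ext; simp only [Finset.mem_filter, mem_nb, Finset.mem_bipartiteBelow]; tauto
    have upper : (∑ b ∈ X, (((nb G b A).filter fun a => ¬ R a b).card : ℝ)) ≤
        ∑ a ∈ A₀, ((nb G a X).card : ℝ) + a * (η ^ 2 / 16 * p * b) := by
      have e : (∑ b ∈ X, (((nb G b A).filter fun a => ¬ R a b).card : ℝ)) =
          ∑ a ∈ A, (((nb G a X).filter fun b => ¬ R a b).card : ℝ) := by exact_mod_cast dc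
      rw [e, ← Finset.sum_sdiff (show A₀ ⊆ A from
        Finset.union_subset (Finset.filter_subset _ _) (Finset.filter_subset _ _)), add_comm]
      refine add_le_add (Finset.sum_le_sum fun v _ => ?_) ?_
      · exact_mod_cast Finset.card_filter_le _ _
      · calc _ ≤ ∑ v ∈ A \ A₀, (η ^ 2 / 16 * p * b) := Finset.sum_le_sum fun v hv => by
              obtain ⟨hvA, hv0⟩ := Finset.mem_sdiff.1 hv
              rw [hA₀, Finset.mem_union, not_or] at hv0
              have h1 : ((nb G v B).card : ℝ) ≤ 2 * p * b := by
                by_contra hc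
                exact hv0.1 (Finset.mem_filter.2 ⟨hvA, not_le.1 hc⟩)
              have h2 : (((nb G v B).filter fun b => ¬ R v b).card : ℝ) ≤
                  η ^ 2 / 32 * (nb G v B).card := by
                by_contra hc
                exact hv0.2 (Finset.mem_filter.2 ⟨hvA, hc⟩)
              have h3 : (((nb G v X).filter fun b => ¬ R v b).card : ℝ) ≤
                  ((nb G v B).filter fun b => ¬ R v b).card := by
                exact_mod_cast Finset.card_le_card (Finset.filter_subset_filter _ (nb_mono v hXB))
              have : 0 < η ^ 2 := by positivity
              nlinarith
          _ ≤ _ := by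
              rw [Finset.sum_const, nsmul_eq_mul]
              refine mul_le_mul_of_nonneg_right ?_ (by positivity)
              exact Nat.cast_le.2 (Finset.card_le_card Finset.sdiff_subset)
    have hA₀X := h.sum_le A₀ X
    have := swap_arith hη hη1 hp ha1 hx0 (Nat.cast_nonneg A₀.card) hA₀c hcon hAB
    linarith
  calc _ ≤ ((B₁ ∪ X).card : ℝ) := by
        refine Nat.cast_le.2 (Finset.card_le_card fun v hv => ?_)
        obtain ⟨hvB, hv⟩ := Finset.mem_filter.1 hv
        by_cases h1 : ((nb G v A).card : ℝ) < p / 2 * a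
        · exact Finset.mem_union_left _ (Finset.mem_filter.2 ⟨hvB, h1⟩)
        · refine Finset.mem_union_right _ (Finset.mem_filter.2 ⟨hvB, not_lt.1 h1, ?_⟩)
          by_contra h2
          exact hv ⟨not_lt.1 h1, not_lt.1 h2⟩
    _ ≤ B₁.card + X.card := by exact_mod_cast Finset.card_union_le _ _
    _ ≤ _ := by linarith

/-- A union bound: by `Jumbled.few_low` each `C ∈ Bs` excludes at most a fraction `η/|Bs|` of `B`.
-/
theorem few_untypical (h : Jumbled G p κ) {η : ℝ} (B : Finset V)
    (Bs : List (Finset V)) (hη : 0 ≤ η)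
    (hB : ∀ C ∈ Bs, 4 * Bs.length * κ ≤ η * (B.card * C.card)) (hC : ∀ C ∈ Bs, 0 < C.card) :
    ∃ X : Finset V, (X.card : ℝ) ≤ η * B.card ∧
      ∀ v ∈ B, v ∉ X → ∀ C ∈ Bs, p / 2 * C.card ≤ ((nb G v C).card : ℝ) := by
  classical
  rcases Nat.eq_zero_or_pos Bs.length with h0 | h0
  · obtain rfl := List.length_eq_zero_iff.1 h0
    exact ⟨∅, by simp; positivity, by simp⟩
  have hlen : (0 : ℝ) < Bs.length := by exact_mod_cast h0
  refine ⟨Bs.toFinset.biUnion fun C => B.filter fun v => ((nb G v C).card : ℝ) < p / 2 * C.card,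
    ?_, ?_⟩
  · calc _ ≤ ∑ C ∈ Bs.toFinset,
          ((B.filter fun v => ((nb G v C).card : ℝ) < p / 2 * C.card).card : ℝ) := by
          exact_mod_cast Finset.card_biUnion_le
      _ ≤ ∑ C ∈ Bs.toFinset, η * B.card / Bs.length := Finset.sum_le_sum fun C hCm => by
          rw [List.mem_toFinset] at hCm
          have h1 := h.few_low (X := B.filter fun v => ((nb G v C).card : ℝ) < p / 2 * C.card)
            (Y := C) fun v hv => (Finset.mem_filter.1 hv).2.le
          have h2 := hB C hCm
          have h3 : (0 : ℝ) < C.card := by exact_mod_cast hC C hCm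
          rw [le_div_iff₀ hlen]
          refine le_of_mul_le_mul_right ?_ h3
          nlinarith
      _ ≤ Bs.length * (η * B.card / Bs.length) := by
          rw [Finset.sum_const, nsmul_eq_mul]
          have : (Bs.toFinset.card : ℝ) ≤ Bs.length := by exact_mod_cast Bs.toFinset_card_le
          gcongr
      _ = _ := by field_simp
  · intro v hv hvX C hC
    by_contra hcon
    exact hvX (Finset.mem_biUnion.2 ⟨C, List.mem_toFinset.2 hC,
      Finset.mem_filter.2 ⟨hv, not_le.1 hcon⟩⟩)

/-- A first vertex outside the bad quarter can also avoid a second quarter and so have typical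
degree into all later sets. Each step thus shrinks the remaining sets by at most `p/2`; when the
`i`th set comes first, it and the `j`th have lost at most `(p/2)^i` each, hence the factor
`(p/2)^(2i)`. -/
theorem Most.exists (m : ℕ) {η : ℝ} (hη : η ≤ 1 / 4) (h : Jumbled G p κ) :
    ∀ {Bs : List (Finset V)} {P : List V → Prop}, Bs.length ≤ m →
    (∀ i j (hij : i < j) (hj : j < Bs.length),
      (16 * m) * κ ≤ (p / 2) ^ (2 * i) * (Bs[i].card * Bs[j].card)) →
    (∀ B ∈ Bs, 0 < B.card) → Most G η Bs P → ∃ l, P l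
  | [], P, _, _, _, h => ⟨[], Most.nil.1 h⟩
  | B :: Bs, P, hm, hB, h0, hM => by
    classical
    have hp := h.pos
    have hκ := h.nonneg
    rw [Most.cons] at hM
    have hBpos : (0 : ℝ) < B.card := by exact_mod_cast h0 B (by simp)
    obtain ⟨X, hX, hXt⟩ := few_untypical h (η := 1 / 4) B Bs (by norm_num) (by
      intro C hC
      obtain ⟨j, hj, rfl⟩ := List.getElem_of_mem hC
      have := hB 0 (j + 1) (by omega) (by simpa using hj)
      simp only [mul_zero, pow_zero, one_mul, List.getElem_cons_zero,
        List.getElem_cons_succ] at this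
      have h1 : (Bs.length : ℝ) ≤ m := by
        have : Bs.length ≤ m := by simp at hm; omega
        exact_mod_cast this
      have h2 : 4 * (Bs.length : ℝ) * κ ≤ 4 * m * κ := by gcongr
      linarith) (fun C hC => h0 C (by simp [hC]))
    obtain ⟨v, hvB, hv⟩ : ∃ v ∈ B, v ∉ X ∧ Most G η (Bs.map (nb G v)) fun l => P (v :: l) := by
      by_contra hcon
      push Not at hcon
      have : B ⊆ X ∪ B.filter fun v => ¬ Most G η (Bs.map (nb G v)) fun l => P (v :: l) := by
        intro v hv
        by_cases hvX : v ∈ X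
        · exact Finset.mem_union_left _ hvX
        · exact Finset.mem_union_right _ (Finset.mem_filter.2 ⟨hv, hcon v hv hvX⟩)
      have h1 : (B.card : ℝ) ≤ X.card +
          (B.filter fun v => ¬ Most G η (Bs.map (nb G v)) fun l => P (v :: l)).card := by
        exact_mod_cast (Finset.card_le_card this).trans (Finset.card_union_le _ _)
      nlinarith
    obtain ⟨l, hl⟩ := Most.exists m hη h (Bs := Bs.map (nb G v)) (P := fun l => P (v :: l))
      (by simp at hm ⊢; omega) (by
        intro i j hij hj
        simp only [List.length_map] at hj
        simp only [List.getElem_map]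
        have h1 := hXt v hvB hv.1 Bs[i] (List.getElem_mem _)
        have h2 := hXt v hvB hv.1 Bs[j] (List.getElem_mem _)
        have h3 := hB (i + 1) (j + 1) (by omega) (by simpa using hj)
        simp only [List.getElem_cons_succ] at h3
        refine h3.trans ?_
        calc (p / 2) ^ (2 * (i + 1)) * ((Bs[i].card : ℝ) * Bs[j].card)
            = (p / 2) ^ (2 * i) * ((p / 2 * Bs[i].card) * (p / 2 * Bs[j].card)) := by ring
          _ ≤ _ := by gcongr) (by
        intro B' hB'
        obtain ⟨C, hC, rfl⟩ := List.mem_map.1 hB'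
        have h1 := hXt v hvB hv.1 C hC
        have h2 : (0 : ℝ) < C.card := by exact_mod_cast h0 C (by simp [hC])
        have : (0 : ℝ) < (nb G v C).card := lt_of_lt_of_le (by positivity) h1
        exact_mod_cast this) hv.2
    exact ⟨v :: l, hl⟩
termination_by Bs => Bs.length

-- A last vertex that violates `P` has no neighbour in the witness set `D`, and
-- `Jumbled.few_disconnected` leaves only few such vertices.
open scoped Classical in
theorem Most.append (h : Jumbled G p κ) {η : ℝ} {Bs : List (Finset V)}
    {C : Finset V} {P : List V → Prop}
    (hM : Most G η Bs fun l => ∃ D : Finset V, 0 < D.card ∧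
      4 * κ ≤ η * (D.card * (cnl G l C).card) ∧
      ∀ a ∈ D, ∀ v ∈ cnl G l C, G.Adj a v → P (l ++ [v])) :
    Most G η (Bs ++ [C]) P := by
  rw [Most.append_singleton]
  refine hM.mono le_rfl fun l ⟨D, hD0, hD, hP⟩ => ?_
  have h1 := h.few_disconnected (X := (cnl G l C).filter fun v => ¬ P (l ++ [v])) (Y := D) (by
    intro v hv u hu huv
    obtain ⟨hv, hvP⟩ := Finset.mem_filter.1 hv
    exact hvP (hP u hu v hv huv.symm))
  have h2 : (0 : ℝ) < D.card := by exact_mod_cast hD0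
  refine le_of_mul_le_mul_right ?_ h2
  linarith

end MostTuples

/-! ### Changing the order in which the vertices are chosen. -/

open scoped Classical in
/-- The first entry of the tuples may be chosen last. -/
theorem Most.rot (m : ℕ) : ∀ η : ℝ, 0 < η → η ≤ 1 → ∃ η₀ K : ℝ, 0 < η₀ ∧ η₀ ≤ η ∧ 0 < K ∧
    ∀ {V : Type u} {G : SimpleGraph V} {p κ : ℝ}, Jumbled G p κ →
    ∀ (A : Finset V) (Bs : List (Finset V)) (P : List V → Prop), Bs.length = m →
    (∀ j (hj : j < Bs.length), K * κ < (p / 2) ^ (2 * j) * (A.card * Bs[j].card)) →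
    (∀ i j (hij : i < j) (hj : j < Bs.length),
      K * κ < (p / 2) ^ (2 * i) * (Bs[i].card * Bs[j].card)) →
    Most G η₀ (A :: Bs) P →
    Most G η Bs fun l => (p / 2) ^ m * A.card ≤ ((cnl G l A).card : ℝ) ∧
      (((cnl G l A).filter fun a => ¬ P (a :: l)).card : ℝ) ≤ η * (cnl G l A).card := by
  induction m with
  | zero =>
    intro η hη _
    refine ⟨η, 1, hη, le_rfl, one_pos, ?_⟩
    intro V G p κ h A Bs P hl _ _ hM
    obtain rfl := List.length_eq_zero_iff.1 hl
    rw [Most.cons] at hM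
    simpa [Most.nil, cnl] using hM
  | succ m ih =>
    intro η hη hη1
    obtain ⟨η₁, K₁, hη₁, hη₁η, hK₁, H⟩ := ih (η / 2) (by positivity) (by linarith)
    have hη₁1 : η₁ ≤ 1 := by linarith
    -- `η₁²/32` is the loss in `Jumbled.swap`. The three summands serve the induction hypothesis,
    -- the swap, and the union bound over untypical degrees.
    refine ⟨η₁ ^ 2 / 32, K₁ + 1000 / η₁ ^ 3 + 8 * (m + 1) / η, by positivity, ?_, by positivity, ?_⟩
    · nlinarith
    intro V G p κ h A Bs P hl hA hBB hM
    have hp := h.pos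
    have hκ := h.nonneg
    obtain ⟨B, Bs, rfl⟩ : ∃ B Bs', Bs = B :: Bs' := List.exists_cons_of_length_eq_add_one hl
    simp only [List.length_cons, Nat.add_right_cancel_iff] at hl
    have hK₁' : K₁ * κ ≤ (K₁ + 1000 / η₁ ^ 3 + 8 * (m + 1) / η) * κ := by
      gcongr
      have : 0 ≤ 1000 / η₁ ^ 3 + 8 * (m + 1) / η := by positivity
      linarith
    have hK₂' : 1000 / η₁ ^ 3 * κ ≤ (K₁ + 1000 / η₁ ^ 3 + 8 * (m + 1) / η) * κ := by
      gcongr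
      have : 0 ≤ K₁ + 8 * (m + 1) / η := by positivity
      linarith
    have hK₃' : 8 * (m + 1) / η * κ ≤ (K₁ + 1000 / η₁ ^ 3 + 8 * (m + 1) / η) * κ := by
      gcongr
      have : 0 ≤ K₁ + 1000 / η₁ ^ 3 := by positivity
      linarith
    have hK0 : 0 < K₁ + 1000 / η₁ ^ 3 + 8 * (m + 1) / η := by positivity
    set K := K₁ + 1000 / η₁ ^ 3 + 8 * (m + 1) / η with hK
    have hAB := hA 0 (by simp)
    simp only [mul_zero, pow_zero, one_mul, List.getElem_cons_zero] at hAB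
    have hBj : ∀ j (hj : j < Bs.length), K * κ < B.card * Bs[j].card := by
      intro j hj
      have := hBB 0 (j + 1) (by omega) (by simpa using hj)
      simpa only [mul_zero, pow_zero, one_mul, List.getElem_cons_zero,
        List.getElem_cons_succ] using this
    -- `R a v` says that most continuations of `a, v` are good. Restricting to the neighbourhoods of
    -- `a` and of `v` commutes, so `R` can be read with either vertex first, and `Jumbled.swap`
    -- exchanges the first two quantifiers.
    set R : V → V → Prop := fun a v =>
      Most G (η₁ ^ 2 / 32) ((Bs.map (nb G a)).map (nb G v)) fun l => P (a :: v :: l) with hR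
    have hsw := h.swap hη₁ hη₁1 A B R (by
        have : 1000 / η₁ ^ 3 * κ < A.card * B.card := by linarith
        rw [div_mul_eq_mul_div, div_lt_iff₀ (by positivity)] at this
        linarith) (by
        rw [Most.cons] at hM
        refine le_trans (le_of_eq ?_) hM
        congr 2
        ext a
        simp only [Finset.mem_filter, List.map_cons, Most.cons, hR])
    obtain ⟨X, hX, hXt⟩ := few_untypical h (η := η / 2) B Bs (by positivity) (by
      intro C hC
      obtain ⟨j, hj, rfl⟩ := List.getElem_of_mem hC
      have h2 : 8 * (m + 1) / η * κ < B.card * Bs[j].card := hK₃'.trans_lt (hBj j hj)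
      rw [div_mul_eq_mul_div, div_lt_iff₀ hη] at h2
      rw [hl]
      nlinarith) (by
      intro C hC
      obtain ⟨j, hj, rfl⟩ := List.getElem_of_mem hC
      have h2 := hBj j hj
      by_contra hc
      have h0 : Bs[j].card = 0 := by omega
      rw [h0, Nat.cast_zero, mul_zero] at h2
      exact h2.not_ge (by positivity))
    rw [Most.cons]
    refine le_trans (b := (((B.filter fun b => ¬ (p / 2 * A.card ≤ ((nb G b A).card : ℝ) ∧
      (((nb G b A).filter fun a => ¬ R a b).card : ℝ) ≤ η₁ * (nb G b A).card)) ∪ X).card : ℝ))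
      ?_ ?_
    swap
    · have := Finset.card_union_le (B.filter fun b => ¬ (p / 2 * A.card ≤ ((nb G b A).card : ℝ) ∧
        (((nb G b A).filter fun a => ¬ R a b).card : ℝ) ≤ η₁ * (nb G b A).card)) X
      have h2 := (Nat.cast_le (α := ℝ)).2 this
      push_cast at h2
      have : η₁ * B.card ≤ η / 2 * B.card := by gcongr
      linarith
    refine Nat.cast_le.2 (Finset.card_le_card fun v hv => ?_)
    obtain ⟨hvB, hv⟩ := Finset.mem_filter.1 hv
    by_contra hcon
    rw [Finset.mem_union, not_or, Finset.mem_filter] at hcon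
    obtain ⟨h1, hvX⟩ := hcon
    have h1 : p / 2 * A.card ≤ ((nb G v A).card : ℝ) ∧
      (((nb G v A).filter fun a => ¬ R a v).card : ℝ) ≤ η₁ * (nb G v A).card := by
      by_contra h2; exact h1 ⟨hvB, h2⟩
    have hvt := hXt v hvB hvX
    refine hv ?_
    -- With `v` fixed, induction moves `a` past the remaining sets. The predicate reinserts `v` in
    -- second position; its value on the empty list is a dummy, since these tuples always begin with
    -- some `a`.
    have key := H h (nb G v A) (Bs.map (nb G v))
      (fun l => match l with | [] => True | a :: l => P (a :: v :: l)) (by simpa using hl) ?_ ?_ ?_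
    · refine key.mono (by linarith) fun l hl => ⟨?_, ?_⟩
      · refine le_trans ?_ hl.1
        calc (p / 2) ^ (m + 1) * (A.card : ℝ) = (p / 2) ^ m * (p / 2 * A.card) := by ring
          _ ≤ _ := by gcongr; exact h1.1
      · refine hl.2.trans ?_
        gcongr
        · linarith
        · exact le_rfl
    · intro j hj
      rw [List.length_map] at hj
      have h3 := hA (j + 1) (by simpa using hj)
      simp only [List.getElem_cons_succ] at h3
      have h4 := hvt Bs[j] (List.getElem_mem _)
      rw [List.getElem_map]
      refine lt_of_le_of_lt hK₁' (h3.trans_le ?_)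
      calc (p / 2) ^ (2 * (j + 1)) * ((A.card : ℝ) * Bs[j].card)
          = (p / 2) ^ (2 * j) * ((p / 2 * A.card) * (p / 2 * Bs[j].card)) := by ring
        _ ≤ _ := by gcongr; exact h1.1
    · intro i j hij hj
      rw [List.length_map] at hj
      have h3 := hBB (i + 1) (j + 1) (by omega) (by simpa using hj)
      simp only [List.getElem_cons_succ] at h3
      have h4 := hvt Bs[j] (List.getElem_mem _)
      have h5 := hvt Bs[i] (List.getElem_mem _)
      rw [List.getElem_map, List.getElem_map]
      refine lt_of_le_of_lt hK₁' (h3.trans_le ?_)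
      calc (p / 2) ^ (2 * (i + 1)) * ((Bs[i].card : ℝ) * Bs[j].card)
          = (p / 2) ^ (2 * i) * ((p / 2 * Bs[i].card) * (p / 2 * Bs[j].card)) := by ring
        _ ≤ _ := by gcongr
    · rw [Most.cons]
      refine le_trans (Nat.cast_le.2 (Finset.card_le_card fun a ha => ?_)) h1.2
      obtain ⟨ha, ha'⟩ := Finset.mem_filter.1 ha
      refine Finset.mem_filter.2 ⟨ha, fun hRav => ha' ?_⟩
      have e : (Bs.map (nb G v)).map (nb G a) = (Bs.map (nb G a)).map (nb G v) := by
        simp only [List.map_map]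
        refine List.map_congr_left fun S _ => ?_
        exact nb_comm a v S
      rw [e]
      exact hRav.mono (by nlinarith) fun l hl => hl

open scoped Classical in
/-- The order in which the entries of the tuples are chosen may be reversed. -/
theorem Most.reverse (m : ℕ) : ∀ η : ℝ, 0 < η → η ≤ 1 → ∃ η₀ K : ℝ, 0 < η₀ ∧ η₀ ≤ η ∧ 0 < K ∧
    ∀ {V : Type u} {G : SimpleGraph V} {p κ : ℝ}, Jumbled G p κ →
    ∀ (N : ℕ) (Bs : List (Finset V)) (P : List V → Prop), Bs.length = m → 2 * m ≤ N + 4 →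
    (∀ i j (hij : i < j) (hj : j < Bs.length),
      K * κ < (p / 2) ^ N * (Bs[i].card * Bs[j].card)) →
    Most G η₀ Bs P → Most G η Bs.reverse fun l => P l.reverse := by
  induction m with
  | zero =>
    intro η hη _
    refine ⟨η, 1, hη, le_rfl, one_pos, ?_⟩
    intro V G p κ h N Bs P hl _ _ hM
    obtain rfl := List.length_eq_zero_iff.1 hl
    rw [Most.nil] at hM
    simpa [Most.nil] using hM
  | succ m ih =>
    intro η hη hη1
    obtain ⟨η₁, K₁, hη₁, hη₁η, hK₁, H₁⟩ := ih η hη hη1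
    obtain ⟨η₂, K₂, hη₂, hη₂η, hK₂, H₂⟩ := Most.rot.{u} m η₁ hη₁ (hη₁η.trans hη1)
    refine ⟨η₂, K₁ + K₂, hη₂, hη₂η.trans hη₁η, by positivity, ?_⟩
    intro V G p κ h N Bs P hl hmN hB hM
    have hp := h.pos
    have hκ := h.nonneg
    have hp1 := h.le_one
    obtain ⟨B, Bs, rfl⟩ : ∃ B Bs', Bs = B :: Bs' := List.exists_cons_of_length_eq_add_one hl
    simp only [List.length_cons, Nat.add_right_cancel_iff] at hl
    have hpow : ∀ i, 2 * i ≤ N → (p / 2) ^ N ≤ (p / 2) ^ (2 * i) := fun i hi =>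
      pow_le_pow_of_le_one (by positivity) (by linarith) hi
    have hK₂' : K₂ * κ ≤ (K₁ + K₂) * κ := by gcongr; linarith
    have hK₁' : K₁ * κ ≤ (K₁ + K₂) * κ := by gcongr; linarith
    -- The first entry goes to the end by `Most.rot`, and the remaining `m` entries are reversed by
    -- induction.
    have h1 := H₂ h B Bs P hl (by
      intro j hj
      have := hB 0 (j + 1) (by omega) (by simpa using hj)
      simp only [List.getElem_cons_zero, List.getElem_cons_succ] at this
      refine lt_of_le_of_lt hK₂' (this.trans_le ?_)
      exact mul_le_mul_of_nonneg_right (hpow j (by omega)) (by positivity)) (by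
      intro i j hij hj
      have := hB (i + 1) (j + 1) (by omega) (by simpa using hj)
      simp only [List.getElem_cons_succ] at this
      refine lt_of_le_of_lt hK₂' (this.trans_le ?_)
      exact mul_le_mul_of_nonneg_right (hpow i (by omega)) (by positivity)) hM
    have h2 := H₁ h N Bs _ hl (by omega) (by
      intro i j hij hj
      have := hB (i + 1) (j + 1) (by omega) (by simpa using hj)
      simp only [List.getElem_cons_succ] at this
      exact lt_of_le_of_lt hK₁' this) h1
    rw [List.reverse_cons, Most.append_singleton]
    refine h2.mono le_rfl fun l hl => ?_
    have e : cnl G l.reverse B = cnl G l B := by ext; simp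
    have h3 := hl.2
    rw [e] at h3
    simp only [List.reverse_append, List.reverse_cons, List.reverse_nil, List.nil_append,
      List.singleton_append]
    refine h3.trans ?_
    gcongr

/-! ### The setting, and connections between cliques. -/

open Filter Topology

/-- The setting of the embedding lemmas: a `pn`-regular graph on `n` vertices whose edge
distribution deviates from `p` by little compared with `ε`. -/
structure Setup {V : Type*} [Fintype V] (G : SimpleGraph V) (s : ℕ) (ε p n : ℝ) : Prop where
  jumbled : Jumbled G p (ε * (p ^ s * n ^ 2))
  card : (Fintype.card V : ℝ) = n
  degree (v : V) : ((nb G v Finset.univ).card : ℝ) = p * n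
  large : 1 ≤ ε * (p ^ s * n)
  eps_pos : 0 < ε

/-- Any subset `W` of `e` has at least `c p^|W| n` common neighbours in `S`. -/
def Good {V : Type*} [DecidableEq V] (G : SimpleGraph V) (p n c : ℝ) (e : List V)
    (S : Finset V) : Prop :=
  ∀ W ⊆ e.toFinset, c * p ^ W.card * n ≤ ((cn G W S).card : ℝ)

/-- From any clique with many common neighbours in all sets, most cliques of the last `k` sets
are reached through the first `m` sets. -/
def LeftReach (k s m : ℕ) : Prop :=
  ∀ c : ℝ, 0 < c → ∀ η : ℝ, 0 < η → η ≤ 1 → ∀ᶠ ε in 𝓝[>] (0 : ℝ),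
    ∀ {V : Type u} [Fintype V] [DecidableEq V] {G : SimpleGraph V} {p n : ℝ},
    Setup G s ε p n → ∀ (e : List V) (As Fs : List (Finset V)), e.length = k →
    e.Pairwise G.Adj → As.length = m → Fs.length = k → (∀ T ∈ As ++ Fs, Good G p n c e T) →
    Most G η Fs fun l => ∃ z, List.Forall₂ (· ∈ ·) z As ∧ KPath G k (e ++ z ++ l)

/-- Cliques with many common neighbours in each of the `M` given sets are connected by a
`k`-path through these sets. -/
def Connects (k s M : ℕ) : Prop :=
  ∀ c : ℝ, 0 < c → ∀ᶠ ε in 𝓝[>] (0 : ℝ),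
    ∀ {V : Type u} [Fintype V] [DecidableEq V] {G : SimpleGraph V} {p n : ℝ},
    Setup G s ε p n → ∀ (e q : List V) (Ts : List (Finset V)), e.length = k → q.length = k →
    e.Pairwise G.Adj → q.Pairwise G.Adj → Ts.length = M →
    (∀ T ∈ Ts, Good G p n c e T) → (∀ T ∈ Ts, Good G p n c q T) →
    ∃ z, List.Forall₂ (· ∈ ·) z Ts ∧ KPath G k (e ++ z ++ q)

section Connecting

theorem eventually_mul_lt (K : ℝ) {A : ℝ} (hA : 0 < A) : ∀ᶠ ε in 𝓝[>] (0 : ℝ), K * ε < A := by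
  have h : Tendsto (fun ε : ℝ => K * ε) (𝓝[>] 0) (𝓝 (K * 0)) :=
    (continuous_const.mul continuous_id).continuousAt.mono_left nhdsWithin_le_nhds
  rw [mul_zero] at h
  exact h.eventually_lt_const hA

/-- The accounting of powers of `p`: two sets of order `p^α n` and `p^β n` that lose `t` further
factors `p/2` still have a product far above `p^s n²` when `t + α + β ≤ s` and `ε` is small. The
size requirements on pairs of sets are mostly reduced to this inequality of exponents. -/
theorem size_cond {p n c₁ c₂ ε K a b : ℝ} {s t α β : ℕ} (T : ℕ) (hp : 0 < p) (hp1 : p ≤ 1)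
    (hn : 0 < n) (hc₁ : 0 < c₁) (hc₂ : 0 < c₂) (ha : c₁ * p ^ α * n ≤ a)
    (hb : c₂ * p ^ β * n ≤ b) (hE : t + α + β ≤ s) (hT : t ≤ T)
    (hK : K * ε < c₁ * c₂ / 2 ^ T) : K * (ε * (p ^ s * n ^ 2)) < (p / 2) ^ t * (a * b) := by
  calc K * (ε * (p ^ s * n ^ 2)) = K * ε * (p ^ s * n ^ 2) := by ring
    _ < c₁ * c₂ / 2 ^ T * (p ^ s * n ^ 2) := mul_lt_mul_of_pos_right hK (by positivity)
    _ ≤ c₁ * c₂ / 2 ^ t * (p ^ (t + α + β) * n ^ 2) := by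
        have h1 : p ^ s ≤ p ^ (t + α + β) := pow_le_pow_of_le_one hp.le hp1 hE
        have h2 : (2 : ℝ) ^ t ≤ 2 ^ T := pow_le_pow_right₀ (by norm_num) hT
        gcongr
    _ = (p / 2) ^ t * ((c₁ * p ^ α * n) * (c₂ * p ^ β * n)) := by
        rw [pow_add, pow_add, div_pow]; ring
    _ ≤ _ := by
        have : 0 ≤ a := le_trans (by positivity) ha
        gcongr

theorem Most.with_mem {V : Type*} {G : SimpleGraph V} {η : ℝ} (hη : 0 ≤ η)
    {Bs : List (Finset V)} {P : List V → Prop} (h : Most G η Bs P) :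
    Most G η Bs fun l => P l ∧ List.Forall₂ (· ∈ ·) l Bs ∧ l.Pairwise G.Adj := by
  have := h.and hη le_rfl (Most.of_forall le_rfl fun l h1 h2 => And.intro h1 h2)
  rwa [add_zero] at this

open scoped Classical in
/-- The first entry of the tuples may be replaced by a new last one, provided that new tuples are
good whenever some old tuple that precedes them is. -/
theorem Most.shift (m : ℕ) (η : ℝ) (hη : 0 < η) (hη1 : η ≤ 1) : ∃ η₀ K : ℝ, 0 < η₀ ∧ η₀ ≤ η ∧
    0 < K ∧ ∀ {V : Type u} {G : SimpleGraph V} {p κ : ℝ}, Jumbled G p κ →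
    ∀ (A C : Finset V) (Bs : List (Finset V)) (P Q : List V → Prop), Bs.length = m →
    (∀ j (hj : j < Bs.length), K * κ < (p / 2) ^ (2 * j) * (A.card * Bs[j].card)) →
    (∀ j (hj : j < Bs.length), K * κ < (p / 2) ^ (2 * j) * (C.card * Bs[j].card)) →
    (∀ i j (hij : i < j) (hj : j < Bs.length),
      K * κ < (p / 2) ^ (2 * i) * (Bs[i].card * Bs[j].card)) →
    K * κ < (p / 2) ^ (2 * m) * (A.card * C.card) →
    (∀ l a v, l.length = m → a ∈ A → v ∈ C → P (a :: l) → G.Adj a v → (∀ u ∈ l, G.Adj u v) →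
      Q (l ++ [v])) →
    Most G η₀ (A :: Bs) P → Most G η (Bs ++ [C]) Q := by
  obtain ⟨η₀, K, hη₀, hη₀1, hK, H⟩ := Most.rot.{u} m (η / 2) (by positivity) (by linarith)
  refine ⟨η₀, K + 8 / η, hη₀, by linarith, by positivity, ?_⟩
  intro V G p κ hJ A C Bs P Q hl hA hC hB hAC hPQ hM
  have hp := hJ.pos
  have hκ := hJ.nonneg
  have hK1 : K * κ ≤ (K + 8 / η) * κ := by
    have : 0 ≤ 8 / η := by positivity
    gcongr; linarith
  have r1 := H hJ A Bs P hl (fun j hj => hK1.trans_lt (hA j hj))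
    (fun i j hij hj => hK1.trans_lt (hB i j hij hj)) hM
  -- Used with a trivial property, this only records that typical `l` have the expected number of
  -- common neighbours in `C`.
  have r2 := H hJ C Bs (fun _ => True) hl (fun j hj => hK1.trans_lt (hC j hj))
    (fun i j hij hj => hK1.trans_lt (hB i j hij hj))
    (Most.of_forall hη₀.le fun _ _ _ => trivial)
  have r3 := (r1.and (by positivity) (by positivity) r2).with_mem (by positivity)
  rw [add_halves] at r3
  refine Most.append hJ (r3.mono le_rfl fun l hl' => ?_)
  obtain ⟨⟨⟨hl1, hl2⟩, hl3, -⟩, hl4, -⟩ := hl'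
  have hAC0 : 0 < (A.card : ℝ) * C.card := by
    have : 0 < (p / 2) ^ (2 * m) * ((A.card : ℝ) * C.card) := lt_of_le_of_lt (by positivity) hAC
    exact (pos_iff_pos_of_mul_pos this).1 (by positivity)
  have hA0 : (0 : ℝ) < A.card :=
    lt_of_le_of_ne (by positivity) (by rintro h; rw [← h] at hAC0; simp at hAC0)
  have hX0 : 0 < ((cnl G l A).card : ℝ) := lt_of_lt_of_le (by positivity) hl1
  -- At least half of the common neighbours of `l` in `A` may precede `l`. They are the witness set
  -- for `Most.append`: a new last vertex needs only one neighbour among them.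
  have hDc : ((cnl G l A).card : ℝ) / 2 ≤ (((cnl G l A).filter fun a => P (a :: l)).card : ℝ) := by
    have h2 := Finset.card_filter_add_card_filter_not (s := cnl G l A) (fun a => P (a :: l))
    have h3 := (Nat.cast_inj (R := ℝ)).2 h2
    push_cast at h3
    have h4 : η / 2 * ((cnl G l A).card : ℝ) ≤ 1 / 2 * (cnl G l A).card := by gcongr
    linarith
  refine ⟨(cnl G l A).filter fun a => P (a :: l), ?_, ?_, ?_⟩
  · have : (0 : ℝ) < ((cnl G l A).filter fun a => P (a :: l)).card :=
      lt_of_lt_of_le (by positivity) hDc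
    exact_mod_cast this
  · have h5 : 8 / η * κ < (p / 2) ^ (2 * m) * (A.card * C.card) := by
      have : 0 ≤ K * κ := by positivity
      nlinarith
    rw [div_mul_eq_mul_div, div_lt_iff₀ hη] at h5
    have h6 : (p / 2) ^ (2 * m) * ((A.card : ℝ) * C.card) ≤
        2 * ((((cnl G l A).filter fun a => P (a :: l)).card : ℝ) * (cnl G l C).card) := by
      calc _ = ((p / 2) ^ m * A.card) * ((p / 2) ^ m * C.card) := by
            rw [two_mul, pow_add]; ring
        _ ≤ ((cnl G l A).card : ℝ) * (cnl G l C).card := by gcongr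
        _ ≤ _ := by
          have : 0 ≤ ((cnl G l C).card : ℝ) := by positivity
          nlinarith
    have h7 := mul_le_mul_of_nonneg_right h6 hη.le
    linarith
  · intro a ha v hv hav
    obtain ⟨haA, hP⟩ := Finset.mem_filter.1 ha
    exact hPQ l a v (hl4.length_eq.trans hl) (mem_cnl.1 haA).1 (mem_cnl.1 hv).1 hP hav
      (mem_cnl.1 hv).2

variable {V : Type*} [Fintype V] {G : SimpleGraph V} {s : ℕ} {ε p n : ℝ}

theorem Setup.n_pos (h : Setup G s ε p n) : 0 < n := by
  by_contra hcon
  have h1 := h.large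
  have h2 := h.jumbled.pos
  have h3 := h.eps_pos
  have : ε * (p ^ s * n) ≤ 0 :=
    mul_nonpos_of_nonneg_of_nonpos h3.le (mul_nonpos_of_nonneg_of_nonpos (by positivity)
      (not_lt.1 hcon))
  linarith

omit [Fintype V] in
theorem Good.reverse [DecidableEq V] {c : ℝ} {e : List V} {S : Finset V}
    (h : Good G p n c e S) : Good G p n c e.reverse S := by
  intro W hW
  exact h W (by rwa [List.toFinset_reverse] at hW)

omit [Fintype V] in
theorem Good.card [DecidableEq V] {c : ℝ} {e : List V} {S : Finset V} (h : Good G p n c e S)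
    (hp : 0 < p) (hp1 : p ≤ 1) (hn : 0 < n) (hc : 0 < c) {l : List V} {j : ℕ}
    (hl : l.toFinset ⊆ e.toFinset) (hj : l.length ≤ j) :
    c * p ^ j * n ≤ ((cn G l.toFinset S).card : ℝ) := by
  refine le_trans ?_ (h _ hl)
  have : p ^ j ≤ p ^ l.toFinset.card :=
    pow_le_pow_of_le_one hp.le hp1 ((List.toFinset_card_le l).trans hj)
  gcongr

theorem Cross.of_drop {V : Type*} {G : SimpleGraph V} : ∀ {l e : List V},
    (∀ (i : ℕ) (b : V), l[i]? = some b → ∀ u ∈ e.drop i, G.Adj u b) → Cross G e l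
  | [], _, _ => trivial
  | v :: l, e, h => ⟨fun u hu => h 0 v (by simp) u (by simpa using hu),
      Cross.of_drop fun i b hb u hu => h (i + 1) b (by simpa using hb) u (by
        rwa [List.drop_tail] at hu)⟩

/-- Meeting in the middle. From `e` most cliques in `Fs` are reached through the first `m` sets;
from `q`, read backwards, most cliques in the reversed `Fs` are reached through the last `m`.
`Most.reverse` brings the second statement into the order of the first, so some clique satisfies
both, and the two paths are glued along its `k` entries. -/
theorem LeftReach.connects {k m : ℕ} (hk : 1 ≤ k) (hs : 2 * k ≤ s + 4)
    (h : LeftReach.{u} k s m) : Connects.{u} k s (m + k + m) := by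
  intro c hc
  obtain ⟨η₀, K, hη₀, hη₀1, hK, H⟩ := Most.reverse.{u} k (1 / 8) (by norm_num) (by norm_num)
  filter_upwards [h c hc (1 / 8) (by norm_num) (by norm_num), h c hc η₀ hη₀ (by linarith),
    eventually_mul_lt K (A := c * c / 2 ^ (2 * k)) (by positivity),
    eventually_mul_lt (16 * k) (A := c * c / 2 ^ (2 * k)) (by positivity)] with ε h1 h2 hε1 hε2
  intro V _ _ G p n hS e q Ts he hq hea hqa hTs hge hgq
  have hn := hS.n_pos
  have hp := hS.jumbled.pos
  have hp1 := hS.jumbled.le_one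
  obtain ⟨As, Fs, Bs, rfl, hAs, hFs, hBs⟩ : ∃ As Fs Bs, Ts = As ++ (Fs ++ Bs) ∧ As.length = m ∧
      Fs.length = k ∧ Bs.length = m :=
    ⟨Ts.take m, (Ts.drop m).take k, (Ts.drop m).drop k, by simp,
      by simp; omega, by simp; omega, by simp; omega⟩
  have hcard : ∀ T ∈ Fs, c * p ^ 0 * n ≤ (T.card : ℝ) := by
    intro T hT
    have := hge T (by simp [hT]) ∅ (by simp)
    simpa using this
  have hL := h1 hS e As Fs he hea hAs hFs fun T hT => hge T (by simp at hT ⊢; tauto)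
  have hR := h2 hS q.reverse Bs.reverse Fs.reverse (by simpa) (List.pairwise_reverse.2
    (hqa.imp fun hab => hab.symm)) (by simp [hBs]) (by simp [hFs])
    fun T hT => (hgq T (by simp at hT ⊢; tauto)).reverse
  have hR' := H hS.jumbled (2 * (k - 2)) _ _ (by simp [hFs]) (by omega) (by
    intro i j hij hj
    simp only [List.length_reverse] at hj
    refine size_cond (2 * k) hp hp1 hn hc hc (hcard _ ?_) (hcard _ ?_) (by omega) (by omega) hε1
    · exact List.mem_reverse.1 (List.getElem_mem _)
    · exact List.mem_reverse.1 (List.getElem_mem _)) hR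
  rw [List.reverse_reverse] at hR'
  obtain ⟨l, ⟨⟨z, hz, hzP⟩, z', hz', hzP'⟩, hlF, -⟩ := Most.exists k (η := 1 / 8 + 1 / 8)
    (by norm_num) hS.jumbled hFs.le (by
      intro i j hij hj
      exact (size_cond (2 * k) hp hp1 hn hc hc (hcard _ (List.getElem_mem _))
        (hcard _ (List.getElem_mem _)) (by omega) (by omega) hε2).le) (by
      intro B hB
      have : (0 : ℝ) < B.card := lt_of_lt_of_le (by positivity) (hcard B hB)
      exact_mod_cast this)
    ((hL.and (by norm_num) (by norm_num) hR').with_mem (by norm_num))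
  refine ⟨z ++ (l ++ z'.reverse), List.rel_append hz (List.rel_append hlF ?_), ?_⟩
  · have := List.rel_reverse hz'
    rwa [List.reverse_reverse] at this
  · have hl : l.length = k := hlF.length_eq.trans hFs
    have := KPath.glue (A := e ++ z) (m := l) (B := z'.reverse ++ q) hzP (by
      have := hzP'.reverse
      simpa using this) hl.ge
    simpa using this

/-- A window of `k` consecutive sets slides over `C 0, C 1, …` one set at a time by `Most.shift`.
For `i < k` the set `C i` is the common neighbourhood in `As[i]` of the last `k - i` entries of `e`,
of order `p^(k-i) n`, so that every clique in the first window continues `e`; then come the sets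
`Fs`. The tight case is the first shift, which exchanges `C 0` for `C k` across `k - 1` other
entries: `2(k-1) + k + 0 = 3k - 2 = s`. -/
theorem leftReach_general {k : ℕ} (hk : 2 ≤ k) (hs : 3 * k = s + 2) : LeftReach.{u} k s k := by
  intro c hc
  -- reaching the window that starts at position `j`
  have key : ∀ j ≤ k, ∀ η : ℝ, 0 < η → η ≤ 1 → ∀ᶠ ε in 𝓝[>] (0 : ℝ),
      ∀ {V : Type u} [Fintype V] [DecidableEq V] {G : SimpleGraph V} {p n : ℝ},
      Setup G s ε p n → ∀ (e : List V) (C : ℕ → Finset V), e.length = k → e.Pairwise G.Adj →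
      (∀ i < k, ∀ v ∈ C i, ∀ u ∈ e.drop i, G.Adj u v) →
      (∀ i < 2 * k, c * p ^ (k - i) * n ≤ ((C i).card : ℝ)) →
      Most G η ((List.range' j k).map C) fun l =>
        ∃ z, List.Forall₂ (· ∈ ·) z ((List.range' 0 j).map C) ∧ KPath G k (e ++ z ++ l) := by
    intro j
    induction j with
    | zero =>
      intro _ η hη _
      refine Eventually.of_forall fun ε => ?_
      intro V _ _ G p n hS e C he hea hC hCc
      refine Most.of_forall hη.le fun l hl hla => ⟨[], by simp, ?_⟩
      rw [List.append_nil]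
      refine KPath.of_cross hea hla (Cross.of_drop fun i b hb u hu => ?_) (.inl he)
      have hlen : l.length = k := by simpa using hl.length_eq
      obtain ⟨hi, rfl⟩ := List.getElem?_eq_some_iff.1 hb
      refine hC i (by omega) _ ?_ u hu
      have := (List.forall₂_iff_get.1 hl).2 i hi (by simpa [hlen] using hi)
      simpa using this
    | succ j ih =>
      intro hj η hη hη1
      obtain ⟨η₀, K, hη₀, hη₀1, hK, H⟩ := Most.shift.{u} (k - 1) η hη hη1
      filter_upwards [ih (by omega) η₀ hη₀ (by linarith),
        eventually_mul_lt K (A := c * c / 2 ^ (2 * k)) (by positivity)] with ε h1 hε1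
      intro V _ _ G p n hS e C he hea hC hCc
      have hn := hS.n_pos
      have hp := hS.jumbled.pos
      have hp1 := hS.jumbled.le_one
      have hM := h1 hS e C he hea hC hCc
      obtain ⟨k', rfl⟩ : ∃ k', k = k' + 1 := ⟨k - 1, by omega⟩
      simp only [Nat.add_sub_cancel] at H
      rw [List.range'_succ, List.map_cons] at hM
      rw [List.range'_concat, List.map_append, one_mul]
      refine H hS.jumbled (C j) (C (j + 1 + k')) ((List.range' (j + 1) k').map C) _ _ (by simp)
        ?_ ?_ ?_ ?_ ?_ hM
      · intro i hi
        simp only [List.length_map, List.length_range'] at hi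
        simp only [List.getElem_map, List.getElem_range', one_mul]
        exact size_cond _ hp hp1 hn hc hc (hCc _ (by omega)) (hCc _ (by omega)) (by omega)
          (by omega) hε1
      · intro i hi
        simp only [List.length_map, List.length_range'] at hi
        simp only [List.getElem_map, List.getElem_range', one_mul]
        exact size_cond _ hp hp1 hn hc hc (hCc _ (by omega)) (hCc _ (by omega)) (by omega)
          (by omega) hε1
      · intro i i' hi hi'
        simp only [List.length_map, List.length_range'] at hi'
        simp only [List.getElem_map, List.getElem_range', one_mul]
        exact size_cond _ hp hp1 hn hc hc (hCc _ (by omega)) (hCc _ (by omega)) (by omega)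
          (by omega) hε1
      · exact size_cond _ hp hp1 hn hc hc (hCc _ (by omega)) (hCc _ (by omega)) (by omega)
          (by omega) hε1
      · rintro l a v hlen haC - ⟨z, hz, hzP⟩ hav hv
        refine ⟨z ++ [a], ?_, ?_⟩
        · rw [List.range'_concat, List.map_append]
          exact List.rel_append hz (by simpa using haC)
        · have := KPath.snoc (m := a :: l) (v := v) hzP (by simp [hlen]) (by
            intro u hu
            rcases List.mem_cons.1 hu with rfl | hu
            · exact hav
            · exact hv u hu)
          simpa using this
  intro η hη hη1
  filter_upwards [key k le_rfl η hη hη1] with ε hε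
  intro V _ _ G p n hS e As Fs he hea hAs hFs hg
  have hn := hS.n_pos
  have hp := hS.jumbled.pos
  have hp1 := hS.jumbled.le_one
  set C : ℕ → Finset V := fun i =>
    if h : i < k then cn G (e.drop i).toFinset (As[i]'(by omega)) else
      if h' : i - k < Fs.length then Fs[i - k] else ∅ with hC
  have hdrop : ∀ i, (e.drop i).toFinset ⊆ e.toFinset := by
    intro i u hu
    rw [List.mem_toFinset] at hu ⊢
    exact List.mem_of_mem_drop hu
  have hM := hε hS e C he hea (by
    intro i hi v hv u hu
    simp only [hC, dif_pos hi, mem_cn] at hv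
    exact hv.2 u (by simpa using hu)) (by
    intro i hi
    by_cases hik : i < k
    · simp only [hC, dif_pos hik]
      exact (hg _ (List.mem_append_left _ (List.getElem_mem _))).card hp hp1 hn hc (hdrop i)
        (by simp [he])
    · have h' : i - k < Fs.length := by omega
      simp only [hC, dif_neg hik, dif_pos h']
      have := (hg _ (List.mem_append_right _ (List.getElem_mem h'))) ∅ (by simp)
      simpa [show k - i = 0 by omega] using this)
  have e1 : (List.range' k k).map C = Fs := by
    apply List.ext_getElem
    · simp [hFs]
    · intro i h1 h2
      simp [hC, h2]
  rw [e1] at hM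
  refine hM.mono le_rfl fun l ⟨z, hz, hzP⟩ => ⟨z, ?_, hzP⟩
  have hzl : z.length = k := by simpa using hz.length_eq
  refine List.forall₂_iff_get.2 ⟨by omega, fun i h1 h2 => ?_⟩
  have := (List.forall₂_iff_get.1 hz).2 i h1 (by simp; omega)
  simp only [List.get_eq_getElem, List.getElem_map, List.getElem_range', zero_add, one_mul, hC,
    dif_pos (show i < k by omega)] at this
  exact cn_subset _ _ this

end Connecting

/-! ### Connections for the square with `s = 3`. -/

section SquareConnecting

theorem KPath.snoc_two {V : Type*} {G : SimpleGraph V} {l : List V} {a b c : V}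
    (h : KPath G 2 (l ++ [a, b])) (hac : G.Adj a c) (hbc : G.Adj b c) :
    KPath G 2 (l ++ [a, b, c]) :=
  h.snoc rfl (by simp [hac, hbc])

theorem sum_card_filter_comm {V : Type*} (X Y : Finset V) (R : V → V → Prop)
    [∀ x, DecidablePred (R x)] [∀ y, DecidablePred fun x => R x y] :
    ∑ x ∈ X, ((Y.filter fun y => R x y).card : ℝ) =
      ∑ y ∈ Y, ((X.filter fun x => R x y).card : ℝ) := by
  have h := Finset.sum_card_bipartiteAbove_eq_sum_card_bipartiteBelow (s := X) (t := Y)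
    (fun a b => R a b)
  simp only [Finset.bipartiteAbove, Finset.bipartiteBelow] at h
  exact_mod_cast h

/-- If each vertex of `D` has many neighbours in `X`, then `X` is much larger than `D`. -/
theorem Jumbled.expand {V : Type*} {G : SimpleGraph V} {p ε n c : ℝ}
    (h : Jumbled G p (ε * (p ^ 3 * n ^ 2))) (hc : 0 < c) (hn : 0 < n) (hε : 4 * ε < c)
    {D X : Finset V} (hD : (D.card : ℝ) ≤ 2 * p ^ 2 * n)
    (hX : ∀ v ∈ D, c / 4 * p ^ 2 * n ≤ ((nb G v X).card : ℝ)) :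
    c / 16 * D.card ≤ p * X.card := by
  have hp := h.pos
  -- Otherwise `D` sends at least `cp²n|D|/4` edges to `X`, while the main term `p|D||X|` is at most
  -- half of that and the deviation is less than half.
  by_contra hcon
  push Not at hcon
  set d : ℝ := (D.card : ℝ) with hd
  set x : ℝ := (X.card : ℝ) with hx
  have hx0 : 0 ≤ x := by positivity
  have hd0 : 0 < d := by
    by_contra h0
    have : 0 ≤ p * x := by positivity
    nlinarith
  have h1 : c / 4 * p ^ 2 * n * d ≤ ∑ v ∈ D, ((nb G v X).card : ℝ) := by
    calc _ = ∑ v ∈ D, c / 4 * p ^ 2 * n := by rw [Finset.sum_const, nsmul_eq_mul]; ring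
      _ ≤ _ := Finset.sum_le_sum hX
  have h2 := h.sum_le D X
  have h3 : p * d * x ≤ c / 8 * (p ^ 2 * n * d) := by
    calc p * d * x = d * (p * x) := by ring
      _ ≤ d * (c / 16 * d) := by gcongr
      _ ≤ d * (c / 16 * (2 * p ^ 2 * n)) := by gcongr
      _ = _ := by ring
  have hκ := h.nonneg
  have hε0 : 0 ≤ ε := by
    by_contra h0
    have : ε * (p ^ 3 * n ^ 2) < 0 := mul_neg_of_neg_of_pos (not_le.1 h0) (by positivity)
    linarith
  have h4 : √(ε * (p ^ 3 * n ^ 2) * d * x) < c / 8 * (p * n * d) := by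
    refine (Real.sqrt_lt' (by positivity)).2 ?_
    calc ε * (p ^ 3 * n ^ 2) * d * x = ε * (p ^ 2 * n ^ 2) * d * (p * x) := by ring
      _ ≤ ε * (p ^ 2 * n ^ 2) * d * (c / 16 * d) := by gcongr
      _ = ε * (c / 16 * (p ^ 2 * n ^ 2 * d ^ 2)) := by ring
      _ < c / 4 * (c / 16 * (p ^ 2 * n ^ 2 * d ^ 2)) :=
          mul_lt_mul_of_pos_right (by linarith) (by positivity)
      _ = _ := by ring
  have h5 : p * √(ε * (p ^ 3 * n ^ 2) * d * x) < p * (c / 8 * (p * n * d)) :=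
    mul_lt_mul_of_pos_left h4 hp
  have h6 : p * (c / 8 * (p * n * d)) = c / 8 * (p ^ 2 * n * d) := by ring
  have h7 : c / 4 * p ^ 2 * n * d = c / 8 * (p ^ 2 * n * d) + c / 8 * (p ^ 2 * n * d) := by ring
  linarith

theorem exists_of_few {α : Type*} {s : Finset α} {P : α → Prop} [DecidablePred fun a => ¬ P a]
    {η : ℝ} (hη : η < 1) (h0 : 0 < (s.card : ℝ))
    (h : ((s.filter fun a => ¬ P a).card : ℝ) ≤ η * s.card) : ∃ a ∈ s, P a := by
  by_contra hcon
  push Not at hcon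
  rw [Finset.filter_true_of_mem hcon] at h
  nlinarith

theorem Most.exists_few {V : Type*} {G : SimpleGraph V} {η : ℝ} {B : Finset V}
    {P : List V → Prop} (h : Most G η [B] P) :
    ∃ X : Finset V, (X.card : ℝ) ≤ η * B.card ∧ ∀ v ∈ B, v ∉ X → P [v] := by
  classical
  rw [Most.cons] at h
  simp only [List.map_nil, Most.nil] at h
  refine ⟨_, h, fun v hv hvX => ?_⟩
  by_contra hcon
  exact hvX (Finset.mem_filter.2 ⟨hv, hcon⟩)

/-- Many common second vertices of edges reachable from the edge `x₁x₂`. -/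
theorem square_second {c : ℝ} (hc : 0 < c) : ∀ᶠ ε in 𝓝[>] (0 : ℝ),
    ∀ {V : Type u} [Fintype V] [DecidableEq V] {G : SimpleGraph V} {p n : ℝ},
    Setup G 3 ε p n → ∀ Z₁ Z₂ S₃ S₄ : Finset V, c * p ^ 2 * n ≤ Z₁.card → c * p ^ 1 * n ≤ Z₂.card →
    c * p ^ 0 * n ≤ S₃.card → c * p ^ 0 * n ≤ S₄.card →
    ∃ A ⊆ Z₂, (Z₂.card : ℝ) / 2 ≤ A.card ∧ ∀ z₂ ∈ A, c / 2 * p * n ≤ ((nb G z₂ S₄).card : ℝ) ∧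
      ∃ z₁ ∈ Z₁, G.Adj z₁ z₂ ∧ c / 4 * p ^ 2 * n ≤ ((nb G z₂ (nb G z₁ S₃)).card : ℝ) := by
  obtain ⟨η₁, K₁, hη₁, hη₁1, hK₁, H₁⟩ := Most.rot.{u} 1 (1 / 4) (by norm_num) (by norm_num)
  obtain ⟨η₂, K₂, hη₂, hη₂1, hK₂, H₂⟩ := Most.rot.{u} 2 η₁ hη₁ (by linarith)
  filter_upwards [eventually_mul_lt K₁ (A := c * c / 2 ^ 2) (by positivity),
    eventually_mul_lt K₂ (A := c * c / 2 ^ 2) (by positivity),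
    eventually_mul_lt 16 (A := c * c / 2 ^ 2) (by positivity)] with ε h1 h2 h3
  intro V _ _ G p n hS Z₁ Z₂ S₃ S₄ hZ₁ hZ₂ hS₃ hS₄
  classical
  have hn := hS.n_pos
  have hp := hS.jumbled.pos
  have hp1 := hS.jumbled.le_one
  -- Moving `S₃` to the end with a trivial property shows that most edges `z₁z₂` have at least
  -- `(p/2)²|S₃|` common neighbours in `S₃`.
  have m1 := H₂ hS.jumbled S₃ [Z₁, Z₂] (fun _ => True) rfl (by
    intro j hj
    simp only [List.length_cons, List.length_nil] at hj
    interval_cases j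
    · exact size_cond 2 hp hp1 hn hc hc hS₃ hZ₁ (by omega) (by omega) h2
    · exact size_cond 2 hp hp1 hn hc hc hS₃ hZ₂ (by omega) (by omega) h2) (by
    intro i j hij hj
    simp only [List.length_cons, List.length_nil] at hj
    obtain ⟨rfl, rfl⟩ : i = 0 ∧ j = 1 := by omega
    exact size_cond 2 hp hp1 hn hc hc hZ₁ hZ₂ (by omega) (by omega) h2)
    (Most.of_forall hη₂.le fun _ _ _ => trivial)
  replace m1 := m1.mono le_rfl fun l hl => hl.1
  -- A second rotation puts `z₂` first: for most `z₂`, most of the admissible `z₁` work.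
  have m2 := H₁ hS.jumbled Z₁ [Z₂] _ rfl (by
    intro j hj
    obtain rfl : j = 0 := by simpa using hj
    exact size_cond 2 hp hp1 hn hc hc hZ₁ hZ₂ (by omega) (by omega) h1) (by
    intro i j hij hj
    simp at hj; omega) m1
  have hZ₁0 : (0 : ℝ) < Z₁.card := lt_of_lt_of_le (by positivity) hZ₁
  have hS₄0 : (0 : ℝ) < S₄.card := lt_of_lt_of_le (by positivity) hS₄
  obtain ⟨X, hX, hXt⟩ := few_untypical hS.jumbled (η := 1 / 4) Z₂ [S₄] (by norm_num) (by
    have := size_cond (s := 3) (t := 0) 2 hp hp1 hn hc hc hZ₂ hS₄ (by omega) (by omega) h3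
    simp only [pow_zero, one_mul] at this
    simp only [List.mem_singleton, forall_eq, List.length_singleton, Nat.cast_one]
    linarith) (by simpa using hS₄0)
  obtain ⟨Y, hYc, hY⟩ := m2.exists_few
  refine ⟨Z₂ \ (Y ∪ X), Finset.sdiff_subset, ?_, fun z hz => ?_⟩
  · have e1 := Finset.card_le_card (show Z₂ ⊆ (Z₂ \ (Y ∪ X)) ∪ (Y ∪ X) by
      intro v hv; simp only [Finset.mem_union, Finset.mem_sdiff]; tauto)
    have e2 := (e1.trans (Finset.card_union_le _ _)).trans
      (Nat.add_le_add_left (Finset.card_union_le Y X) _)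
    have e3 : (Z₂.card : ℝ) ≤ (Z₂ \ (Y ∪ X)).card + (Y.card + X.card) := by exact_mod_cast e2
    linarith
  · simp only [Finset.mem_sdiff, Finset.mem_union, not_or] at hz
    obtain ⟨hzZ, hzY, hzX⟩ := hz
    have hzY' := hY z hzZ hzY
    simp only [cnl] at hzY'
    refine ⟨?_, ?_⟩
    · refine le_trans ?_ (hXt z hzZ hzX S₄ (by simp))
      calc c / 2 * p * n = p / 2 * (c * p ^ 0 * n) := by ring
        _ ≤ _ := by gcongr
    · have h0 : (0 : ℝ) < (nb G z Z₁).card := lt_of_lt_of_le (by positivity) hzY'.1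
      obtain ⟨z₁, hz₁, hle⟩ := exists_of_few (by norm_num) h0 hzY'.2
      refine ⟨z₁, (mem_nb.1 hz₁).1, (mem_nb.1 hz₁).2.symm, le_trans ?_ hle⟩
      calc c / 4 * p ^ 2 * n = (p / 2) ^ 2 * (c * p ^ 0 * n) := by ring
        _ ≤ _ := by gcongr

/-- Many vertices are reached in four steps along many edges. -/
theorem square_base {c : ℝ} (hc : 0 < c) : ∀ᶠ ε in 𝓝[>] (0 : ℝ),
    ∀ {V : Type u} [Fintype V] [DecidableEq V] {G : SimpleGraph V} {p n : ℝ},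
    Setup G 3 ε p n → ∀ (x₁ x₂ : V) (S₁ S₂ S₃ S₄ : Finset V), G.Adj x₁ x₂ →
    (∀ S ∈ [S₁, S₂, S₃, S₄], Good G p n c [x₁, x₂] S) →
    ∃ A ⊆ S₄, c ^ 3 / 1024 * p ^ 1 * n ≤ (A.card : ℝ) ∧
      ∀ z₄ ∈ A, ∃ D ⊆ S₃, c ^ 3 / 1024 * p ^ 2 * n ≤ (D.card : ℝ) ∧
        ∀ z₃ ∈ D, ∃ z₁ ∈ S₁, ∃ z₂ ∈ S₂, KPath G 2 [x₁, x₂, z₁, z₂, z₃, z₄] := by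
  filter_upwards [square_second.{u} hc, eventually_mul_lt 4 hc,
    eventually_mul_lt (9 / c) (A := c / 8) (by positivity)] with ε h1 hε1 hε2
  intro V _ _ G p n hS x₁ x₂ S₁ S₂ S₃ S₄ hx hg
  classical
  have hn := hS.n_pos
  have hp := hS.jumbled.pos
  have hp1 := hS.jumbled.le_one
  have hκ := hS.jumbled.nonneg
  have hε0 := hS.eps_pos
  have hsize : ∀ S ∈ [S₁, S₂, S₃, S₄], c * p ^ 0 * n ≤ (S.card : ℝ) := fun S h => by
    simpa using hg S h ∅ (by simp)
  set Z₁ := cn G {x₁, x₂} S₁ with hZ₁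
  set Z₂ := nb G x₂ S₂ with hZ₂
  have hne : x₁ ≠ x₂ := hx.ne
  have hZ₁c : c * p ^ 2 * n ≤ (Z₁.card : ℝ) := by
    have := hg S₁ (by simp) {x₁, x₂} (by intro; simp)
    rwa [Finset.card_pair hne] at this
  have hZ₂c : c * p ^ 1 * n ≤ (Z₂.card : ℝ) := by
    have := hg S₂ (by simp) {x₂} (by intro; simp +contextual)
    rwa [Finset.card_singleton, cn_singleton] at this
  have hZ₂u : (Z₂.card : ℝ) ≤ p * n := by
    rw [← hS.degree x₂]
    exact_mod_cast Finset.card_le_card (nb_mono _ (Finset.subset_univ _))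
  obtain ⟨A₂, hA₂, hA₂c, hA₂P⟩ := h1 hS Z₁ Z₂ S₃ S₄ hZ₁c hZ₂c (hsize _ (by simp))
    (hsize _ (by simp))
  -- `F z₂ z₃` admits `z₃` after `z₂`. The last two conditions prepare `Jumbled.expand`: the sets of
  -- `z₂` belonging to one `z₃` have at most `2p²n` elements, and each such `z₂` has enough common
  -- neighbours with `z₃` in `S₄`.
  set F : V → V → Prop := fun z₂ z₃ => G.Adj z₂ z₃ ∧ (∃ z₁ ∈ Z₁, G.Adj z₁ z₂ ∧ G.Adj z₁ z₃) ∧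
    c / 4 * p ^ 2 * n ≤ ((nb G z₃ (nb G z₂ S₄)).card : ℝ) ∧
    ((nb G z₃ Z₂).card : ℝ) ≤ 2 * p * Z₂.card with hF
  have hF2 : ∀ z₂ ∈ A₂, c / 8 * p ^ 2 * n ≤ ((S₃.filter fun z₃ => F z₂ z₃).card : ℝ) := by
    intro z₂ hz₂
    obtain ⟨h4, z₁, hz₁, hadj, hcod⟩ := hA₂P z₂ hz₂
    set N := nb G z₂ (nb G z₁ S₃) with hN
    set B₁ := N.filter fun z => ((nb G z (nb G z₂ S₄)).card : ℝ) < p / 2 * (nb G z₂ S₄).card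
    set B₂ := N.filter fun z => 2 * p * Z₂.card < ((nb G z Z₂).card : ℝ)
    have hB₁ : (B₁.card : ℝ) ≤ 8 * ε / c * p ^ 2 * n := by
      have := hS.jumbled.few_low (X := B₁) (Y := nb G z₂ S₄)
        fun v hv => (Finset.mem_filter.1 hv).2.le
      have h5 : (B₁.card : ℝ) * (c / 2 * p * n) ≤ 4 * (ε * (p ^ 3 * n ^ 2)) :=
        le_trans (by gcongr) this
      refine le_of_mul_le_mul_right (h5.trans (le_of_eq ?_)) (by positivity : 0 < c / 2 * p * n)
      field_simp; ring
    have hB₂ : (B₂.card : ℝ) ≤ ε / c * p ^ 2 * n := by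
      have := hS.jumbled.few_high (X := B₂) (Y := Z₂)
        fun v hv => (Finset.mem_filter.1 hv).2.le
      have h5 : (B₂.card : ℝ) * (c * p ^ 1 * n) ≤ ε * (p ^ 3 * n ^ 2) :=
        le_trans (by gcongr) this
      refine le_of_mul_le_mul_right (h5.trans (le_of_eq ?_)) (by positivity : 0 < c * p ^ 1 * n)
      field_simp
    have hsub : N ⊆ (S₃.filter fun z₃ => F z₂ z₃) ∪ (B₁ ∪ B₂) := by
      intro z hz
      by_cases hz1 : z ∈ B₁
      · simp [hz1]
      by_cases hz2 : z ∈ B₂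
      · simp [hz2]
      refine Finset.mem_union_left _ (Finset.mem_filter.2 ?_)
      simp only [B₁, B₂, Finset.mem_filter, hz, true_and, not_lt] at hz1 hz2
      simp only [hN, mem_nb] at hz
      refine ⟨hz.1.1, hz.2, ⟨z₁, hz₁, hadj, hz.1.2⟩, le_trans ?_ hz1, hz2⟩
      calc c / 4 * p ^ 2 * n = p / 2 * (c / 2 * p * n) := by ring
        _ ≤ _ := by gcongr
    have e2 := ((Finset.card_le_card hsub).trans (Finset.card_union_le _ _)).trans
      (Nat.add_le_add_left (Finset.card_union_le B₁ B₂) _)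
    have e3 : (N.card : ℝ) ≤ (S₃.filter fun z₃ => F z₂ z₃).card + (B₁.card + B₂.card) := by
      exact_mod_cast e2
    have e4 : 8 * ε / c * p ^ 2 * n + ε / c * p ^ 2 * n = 9 / c * ε * (p ^ 2 * n) := by ring
    have e5 : 9 / c * ε * (p ^ 2 * n) ≤ c / 8 * (p ^ 2 * n) := by gcongr
    have e6 : c / 4 * p ^ 2 * n = c / 8 * p ^ 2 * n + c / 8 * (p ^ 2 * n) := by ring
    linarith
  set D : V → Finset V := fun z₃ => A₂.filter fun z₂ => F z₂ z₃ with hD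
  have hDsum : c ^ 2 / 32 * p ^ 3 * n ^ 2 ≤ ∑ z₃ ∈ S₃, ((D z₃).card : ℝ) := by
    rw [← sum_card_filter_comm A₂ S₃ F]
    calc c ^ 2 / 32 * p ^ 3 * n ^ 2 ≤ c ^ 2 / 16 * p ^ 3 * n ^ 2 := by gcongr; norm_num
      _ = (c * p ^ 1 * n) / 2 * (c / 8 * p ^ 2 * n) := by ring
      _ ≤ A₂.card * (c / 8 * p ^ 2 * n) := by
          refine mul_le_mul_of_nonneg_right ?_ (by positivity)
          linarith
      _ = ∑ z ∈ A₂, c / 8 * p ^ 2 * n := by rw [Finset.sum_const, nsmul_eq_mul]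
      _ ≤ _ := Finset.sum_le_sum hF2
  set R : V → V → Prop := fun z₃ z₄ => G.Adj z₃ z₄ ∧ ∃ z₂ ∈ D z₃, G.Adj z₂ z₄ with hR
  -- The second vertices admissible for one `z₃` together see many fourth vertices. The gain of a
  -- factor `1/p` turns order `p³n²` pairs `(z₂, z₃)` into order `p²n²` pairs `(z₃, z₄)`.
  have hX : ∀ z₃ ∈ S₃, c / 16 * (D z₃).card ≤ p * (S₄.filter fun z₄ => R z₃ z₄).card := by
    intro z₃ _
    rcases (D z₃).eq_empty_or_nonempty with h0 | ⟨z, hz⟩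
    · have : ((D z₃).card : ℝ) = 0 := by simp [h0]
      rw [this, mul_zero]; positivity
    refine hS.jumbled.expand hc hn hε1 ?_ ?_
    · have h5 := (Finset.mem_filter.1 hz).2.2.2.2
      have h6 : ((D z₃).card : ℝ) ≤ (nb G z₃ Z₂).card := by
        refine Nat.cast_le.2 (Finset.card_le_card fun y hy => ?_)
        have := Finset.mem_filter.1 hy
        exact mem_nb.2 ⟨hA₂ this.1, this.2.1.symm⟩
      calc ((D z₃).card : ℝ) ≤ 2 * p * Z₂.card := h6.trans h5
        _ ≤ 2 * p * (p * n) := by gcongr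
        _ = _ := by ring
    · intro z₂ hz₂
      have h5 := Finset.mem_filter.1 hz₂
      refine h5.2.2.2.1.trans (Nat.cast_le.2 (Finset.card_le_card fun y hy => ?_))
      simp only [mem_nb] at hy
      exact mem_nb.2 ⟨Finset.mem_filter.2 ⟨hy.1.1, hy.2, z₂, hz₂, hy.1.2⟩, hy.1.2⟩
  set D₄ : V → Finset V := fun z₄ => S₃.filter fun z₃ => R z₃ z₄ with hD₄
  have hD₄sum : c ^ 3 / 512 * p ^ 2 * n ^ 2 ≤ ∑ z₄ ∈ S₄, ((D₄ z₄).card : ℝ) := by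
    rw [← sum_card_filter_comm S₃ S₄ R]
    refine le_of_mul_le_mul_left ?_ hp
    rw [Finset.mul_sum]
    calc p * (c ^ 3 / 512 * p ^ 2 * n ^ 2) = c / 16 * (c ^ 2 / 32 * p ^ 3 * n ^ 2) := by ring
      _ ≤ c / 16 * ∑ z₃ ∈ S₃, ((D z₃).card : ℝ) := by gcongr
      _ = ∑ z₃ ∈ S₃, c / 16 * ((D z₃).card : ℝ) := by rw [Finset.mul_sum]
      _ ≤ _ := Finset.sum_le_sum hX
  refine ⟨S₄.filter fun z => c ^ 3 / 1024 * p ^ 2 * n ≤ ((D₄ z).card : ℝ),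
    Finset.filter_subset _ _, ?_, ?_⟩
  · set A := S₄.filter fun z => c ^ 3 / 1024 * p ^ 2 * n ≤ ((D₄ z).card : ℝ)
    -- Averaging: no `z₄` has more than `pn` admissible `z₃`, so order `pn` many `z₄` must have
    -- order `p²n` of them.
    have h5 : ∑ z₄ ∈ S₄, ((D₄ z₄).card : ℝ) ≤
        ∑ z₄ ∈ S₄, (c ^ 3 / 1024 * p ^ 2 * n + if z₄ ∈ A then p * n else 0) := by
      refine Finset.sum_le_sum fun z hz => ?_
      split_ifs with hzA
      · have : ((D₄ z).card : ℝ) ≤ p * n := by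
          rw [← hS.degree z]
          refine Nat.cast_le.2 (Finset.card_le_card fun y hy => ?_)
          exact mem_nb.2 ⟨Finset.mem_univ _, (Finset.mem_filter.1 hy).2.1.symm⟩
        have : 0 ≤ c ^ 3 / 1024 * p ^ 2 * n := by positivity
        linarith
      · have : ¬ c ^ 3 / 1024 * p ^ 2 * n ≤ ((D₄ z).card : ℝ) := fun h =>
          hzA (Finset.mem_filter.2 ⟨hz, h⟩)
        linarith
    have h6 : (S₄.card : ℝ) ≤ n := by rw [← hS.card]; exact_mod_cast Finset.card_le_univ _
    rw [Finset.sum_add_distrib, Finset.sum_const, nsmul_eq_mul, ← Finset.sum_filter,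
      Finset.sum_const, nsmul_eq_mul] at h5
    have h7 : ((S₄.filter fun z => z ∈ A).card : ℝ) ≤ A.card :=
      Nat.cast_le.2 (Finset.card_le_card fun y hy => (Finset.mem_filter.1 hy).2)
    have h8 : (S₄.card : ℝ) * (c ^ 3 / 1024 * p ^ 2 * n) ≤ n * (c ^ 3 / 1024 * p ^ 2 * n) := by
      gcongr
    have h9 : ((S₄.filter fun z => z ∈ A).card : ℝ) * (p * n) ≤ A.card * (p * n) := by gcongr
    refine le_of_mul_le_mul_right ?_ (show 0 < p * n by positivity)
    nlinarith
  · intro z₄ hz₄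
    refine ⟨D₄ z₄, Finset.filter_subset _ _, (Finset.mem_filter.1 hz₄).2, fun z₃ hz₃ => ?_⟩
    obtain ⟨h34, z₂, hz₂, h24⟩ := (Finset.mem_filter.1 hz₃).2
    obtain ⟨hz₂A, h23, ⟨z₁, hz₁, h12, h13⟩, -⟩ := Finset.mem_filter.1 hz₂
    have hz₁' := mem_cn.1 hz₁
    have hz₂' := mem_nb.1 (hA₂ hz₂A)
    refine ⟨z₁, hz₁'.1, z₂, hz₂'.1, ?_⟩
    have k0 : KPath G 2 [x₁, x₂] := .of_pairwise (by simpa using hx)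
    have k1 := KPath.snoc_two (l := []) k0 (hz₁'.2 x₁ (by simp)) (hz₁'.2 x₂ (by simp))
    have k2 := KPath.snoc_two (l := [x₁]) k1 hz₂'.2 h12
    have k3 := KPath.snoc_two (l := [x₁, x₂]) k2 h13 h23
    exact KPath.snoc_two (l := [x₁, x₂, z₁]) k3 h24 h34

/-- Sliding a window would need `s = 4`. Instead `square_base` supplies order `pn` vertices `z₄`,
each with a set `D` of order `p²n` possible predecessors `z₃`. These are too few edges to be "most",
but almost all `z₅` in the neighbourhood of `z₄`, a set of order `pn`, have a neighbour in `D`: the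
product is of order `p³n²`, just enough. Then `Most.shift` drops `z₄` in favour of `z₆`. -/
theorem leftReach_square : LeftReach.{u} 2 3 4 := by
  intro c hc η hη hη1
  obtain ⟨η₁, K₁, hη₁, hη₁1, hK₁, H₁⟩ := Most.shift.{u} 1 η hη hη1
  obtain ⟨η₂, K₂, hη₂, hη₂1, hK₂, H₂⟩ := Most.rot.{u} 1 η₁ hη₁ (by linarith)
  set c' := c ^ 3 / 1024 with hc'
  have hc'0 : 0 < c' := by positivity
  filter_upwards [square_base.{u} hc, eventually_mul_lt K₁ (A := c' * c / 2 ^ 2) (by positivity),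
    eventually_mul_lt K₁ (A := c * c / 2 ^ 2) (by positivity),
    eventually_mul_lt K₂ (A := c * c' / 2 ^ 2) (by positivity),
    eventually_mul_lt (4 / η₁) (A := c' * (c / 2) / 2 ^ 2) (by positivity)] with ε h1 hε1 hε1' hε2 hε3
  intro V _ _ G p n hS e As Fs he hea hAs hFs hg
  have hn := hS.n_pos
  have hp := hS.jumbled.pos
  have hp1 := hS.jumbled.le_one
  obtain ⟨x₁, x₂, rfl⟩ := List.length_eq_two.1 he
  obtain ⟨S₅, S₆, rfl⟩ := List.length_eq_two.1 hFs
  obtain ⟨S₁, S₂, S₃, S₄, rfl⟩ : ∃ a b c d, As = [a, b, c, d] := by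
    match As, hAs with
    | [a, b, c, d], _ => exact ⟨a, b, c, d, rfl⟩
  have hsize : ∀ S ∈ [S₁, S₂, S₃, S₄] ++ [S₅, S₆], c * p ^ 0 * n ≤ (S.card : ℝ) := fun S h => by
    simpa using hg S h ∅ (by simp)
  obtain ⟨A, hAS, hAc, hA⟩ := h1 hS x₁ x₂ S₁ S₂ S₃ S₄ (by simpa using hea)
    fun S hS' => hg S (List.mem_append_left _ hS')
  have h5 := hsize S₅ (by simp)
  have h6 := hsize S₆ (by simp)
  have m1 := H₂ hS.jumbled S₅ [A] (fun _ => True) rfl (by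
    intro j hj
    obtain rfl : j = 0 := by simpa using hj
    exact size_cond 2 hp hp1 hn hc hc'0 h5 hAc (by omega) (by omega) hε2) (by
    intro i j hij hj
    simp at hj; omega) (Most.of_forall hη₂.le fun _ _ _ => trivial)
  have m2 : Most G η₁ ([A] ++ [S₅]) fun l => ∃ z, List.Forall₂ (· ∈ ·) z [S₁, S₂, S₃] ∧
      KPath G 2 ([x₁, x₂] ++ z ++ l) := by
    refine Most.append hS.jumbled ((m1.with_mem hη₁.le).mono le_rfl fun l hl => ?_)
    obtain ⟨⟨hl1, -⟩, hl2, -⟩ := hl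
    obtain ⟨z₄, _, hz₄, h0, rfl⟩ := List.forall₂_cons_right_iff.1 hl2
    obtain rfl := List.forall₂_nil_right_iff.1 h0
    obtain ⟨D, hDS, hDc, hD⟩ := hA z₄ hz₄
    refine ⟨D, ?_, ?_, ?_⟩
    · have : (0 : ℝ) < D.card := lt_of_lt_of_le (by positivity) hDc
      exact_mod_cast this
    · have h7 : c / 2 * p ^ 1 * n ≤ ((cnl G [z₄] S₅).card : ℝ) := by
        refine le_trans ?_ hl1
        calc c / 2 * p ^ 1 * n = (p / 2) ^ 1 * (c * p ^ 0 * n) := by ring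
          _ ≤ _ := by gcongr
      have := size_cond (s := 3) (t := 0) 2 hp hp1 hn hc'0 (half_pos hc) hDc h7 (by omega)
        (by omega) hε3
      rw [pow_zero, one_mul, div_mul_eq_mul_div, div_lt_iff₀ hη₁] at this
      linarith
    · intro z₃ hz₃ z₅ hz₅ h35
      obtain ⟨z₁, hz₁, z₂, hz₂, hP⟩ := hD z₃ hz₃
      refine ⟨[z₁, z₂, z₃], by simp [hz₁, hz₂, hDS hz₃], ?_⟩
      exact KPath.snoc_two (l := [x₁, x₂, z₁, z₂]) hP h35 ((mem_cnl.1 hz₅).2 z₄ (by simp))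
  refine H₁ hS.jumbled A S₆ [S₅] _ _ rfl ?_ ?_ ?_ ?_ ?_ m2
  · intro j hj
    obtain rfl : j = 0 := by simpa using hj
    exact size_cond 2 hp hp1 hn hc'0 hc hAc h5 (by omega) (by omega) hε1
  · intro j hj
    obtain rfl : j = 0 := by simpa using hj
    exact size_cond 2 hp hp1 hn hc hc h6 h5 (by omega) (by omega) hε1'
  · intro i j hij hj
    simp at hj; omega
  · exact size_cond 2 hp hp1 hn hc'0 hc hAc h6 (by omega) (by omega) hε1
  · rintro l z₄ z₆ hl hz₄ - ⟨z, hz, hP⟩ h46 hadj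
    obtain ⟨z₅, rfl⟩ := List.length_eq_one_iff.1 hl
    refine ⟨z ++ [z₄], List.rel_append hz (by simpa using hAS hz₄), ?_⟩
    have := KPath.snoc_two (l := [x₁, x₂] ++ z) hP h46 (hadj z₅ (by simp))
    simpa using this

end SquareConnecting

/-! ### Absorbers for `k ≥ 3`. -/

/-- For every vertex `r` with many neighbours in each of the `M` given sets there are two
`k`-paths with the same ends through these sets, whose vertex sets differ exactly in `r`. -/
def HasAbsorbers (k s M : ℕ) : Prop :=
  ∀ c : ℝ, 0 < c → c ≤ 1 → ∀ Q : ℕ, ∃ c' : ℝ, 0 < c' ∧ ∀ᶠ ε in 𝓝[>] (0 : ℝ),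
    ∀ {V : Type u} [Fintype V] [DecidableEq V] {G : SimpleGraph V} {p n : ℝ},
    Setup G s ε p n → ∀ (r : V) (Ts : List (Finset V)) (Z : Finset (Finset V)),
    Ts.length = M → Ts.Pairwise Disjoint → (∀ T ∈ Ts, r ∉ T) →
    (∀ T ∈ Ts, c * p * n ≤ ((nb G r T).card : ℝ)) →
    (∀ T ∈ Ts, T ∈ Z) → (∀ S ∈ Z, c * n ≤ (S.card : ℝ)) → Z.card ≤ Q →
    ∃ (q f : List V) (U : Finset V), q.length = k ∧ f.length = k ∧ q.Pairwise G.Adj ∧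
      f.Pairwise G.Adj ∧ PathOn G k q f (insert r U) ∧ PathOn G k q f U ∧
      (∀ u ∈ U, ∃ T ∈ Ts, u ∈ T) ∧ U.card ≤ M ∧
      ∀ S ∈ Z, Good G p n c' q S ∧ Good G p n c' f S

section Absorbers

theorem forall₂_mem_exists {V : Type*} {l : List V} {Ts : List (Finset V)}
    (h : List.Forall₂ (· ∈ ·) l Ts) {a : V} (ha : a ∈ l) : ∃ T ∈ Ts, a ∈ T := by
  obtain ⟨i, hi, rfl⟩ := List.getElem_of_mem ha
  exact ⟨Ts[i]'(h.length_eq ▸ hi), List.getElem_mem _, (List.forall₂_iff_get.1 h).2 i hi _⟩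

theorem nodup_of_forall₂_mem {V : Type*} : ∀ {l : List V} {Ts : List (Finset V)},
    List.Forall₂ (· ∈ ·) l Ts → Ts.Pairwise Disjoint → l.Nodup
  | [], _, _, _ => List.nodup_nil
  | a :: l, _, .cons (b := T) (l₂ := Ts) ha h, hT => by
    rw [List.pairwise_cons] at hT
    refine List.nodup_cons.2 ⟨fun hal => ?_, nodup_of_forall₂_mem h hT.2⟩
    obtain ⟨T', hT', haT'⟩ := forall₂_mem_exists h hal
    exact Finset.disjoint_left.1 (hT.1 T' hT') ha haT'

theorem good_of_half {V : Type*} [DecidableEq V] {G : SimpleGraph V} {p n c : ℝ} {k : ℕ}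
    {e : List V} {S : Finset V} (hp : 0 < p) (hc : 0 < c) (hn : 0 < n) (he : e.length ≤ k)
    (hS : c * n ≤ (S.card : ℝ))
    (h : ∀ W ⊆ e.toFinset, (p / 2) ^ W.card * S.card ≤ ((cn G W S).card : ℝ)) :
    Good G p n (c / 2 ^ k) e S := by
  intro W hW
  refine le_trans ?_ (h W hW)
  have hWk : W.card ≤ k := (Finset.card_le_card hW).trans ((List.toFinset_card_le e).trans he)
  have h2 : (2 : ℝ) ^ W.card ≤ 2 ^ k := pow_le_pow_right₀ (by norm_num) hWk
  calc c / 2 ^ k * p ^ W.card * n ≤ c / 2 ^ W.card * p ^ W.card * n := by gcongr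
    _ = (p / 2) ^ W.card * (c * n) := by rw [div_pow]; ring
    _ ≤ _ := by gcongr

/-- A `k`-path `xs ++ ys` on `2k` vertices is chosen greedily inside the neighbourhood of `r`, and
`r` fits between its halves. The greedy choice costs `p^(2k-1)` in sets of order `pn`, altogether
`p^(2k+1)`; the inequality `2k + 1 ≤ 3k - 2` is where `k ≥ 3` enters. -/
theorem absorbs_general {k s : ℕ} (hk : 3 ≤ k) (hs : 3 * k = s + 2) :
    HasAbsorbers.{u} k s (k + k) := by
  intro c hc hc1 Q
  refine ⟨c / 2 ^ k, by positivity, ?_⟩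
  have hck : 0 < c / 2 ^ k := by positivity
  filter_upwards [eventually_mul_lt (4 * ((Q + 2 * k : ℕ) * 2 ^ k * 2 ^ k))
      (A := c * c / 2 ^ (2 * k)) (by positivity),
    eventually_mul_lt (4 * ((Q + 2 * k : ℕ) * 2 ^ k * 2 ^ k))
      (A := c / 2 ^ k * (c / 2 ^ k) / 2 ^ (2 * k)) (by positivity)] with ε hε1 hε2
  intro V _ _ G p n hS r Ts Z hTs hdisj hr hrT hTZ hZ hQ
  have hn := hS.n_pos
  have hp := hS.jumbled.pos
  have hp1 := hS.jumbled.le_one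
  have hκ := hS.jumbled.nonneg
  set Z' := Z ∪ (Ts.map (nb G r)).toFinset with hZ'
  have hZ'c : Z'.card ≤ Q + 2 * k := by
    refine (Finset.card_union_le _ _).trans (Nat.add_le_add hQ ?_)
    refine (List.toFinset_card_le _).trans ?_
    simp [hTs]; omega
  have hZ'cR : (Z'.card : ℝ) ≤ (Q + 2 * k : ℕ) := by exact_mod_cast hZ'c
  have hZ's : ∀ Y ∈ Z', c * p * n ≤ (Y.card : ℝ) := by
    intro Y hY
    rcases Finset.mem_union.1 hY with hY | hY
    · refine le_trans ?_ (hZ Y hY)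
      have : c * p * n ≤ c * 1 * n := by gcongr
      linarith
    · obtain ⟨T, hT, rfl⟩ := List.mem_map.1 (List.mem_toFinset.1 hY)
      exact hrT T hT
  have hBZ : ∀ B ∈ Ts.map (nb G r), B ∈ Z' := fun B hB =>
    Finset.mem_union_right _ (List.mem_toFinset.2 hB)
  obtain ⟨xs, hxs1, hxs2, -, hxs4⟩ := hS.jumbled.greedy ((Ts.map (nb G r)).take k) [] Z'
    (c * p * n) (2 * k - 2) (fun B hB => hBZ B (List.mem_of_mem_take hB)) (by positivity) (by
      intro W hW Y hY
      obtain rfl : W = ∅ := by simpa using hW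
      simpa using hZ's Y hY) (by simp) (by simp; omega) (by
      intro _
      have h1 := size_cond (s := s) (t := 2 * k - 2) (α := 1) (β := 1) (a := c * p * n)
        (b := c * p * n) (2 * k) hp hp1 hn hc hc (by rw [pow_one]) (by rw [pow_one])
        (by omega) (by omega) hε1
      refine lt_of_le_of_lt ?_ (h1.trans_eq (by ring))
      have : ((2 : ℝ) ^ ((Ts.map (nb G r)).take k).length) ≤ 2 ^ k :=
        pow_le_pow_right₀ (by norm_num) (by simp)
      have h3 : (2 : ℝ) ^ ([] : List V).length ≤ 2 ^ k :=
        pow_le_pow_right₀ (by norm_num) (by simp)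
      gcongr)
  have hxl : xs.length = k := by have := hxs1.length_eq; simp [hTs] at this; omega
  obtain ⟨ys, hys1, hys2, hys3, hys4⟩ := hS.jumbled.greedy ((Ts.map (nb G r)).drop k) xs Z'
    (c / 2 ^ k * p * n) (2 * k - 1) (fun B hB => hBZ B (List.mem_of_mem_drop hB)) (by positivity) (by
      intro W hW Y hY
      refine le_trans ?_ (hxs4 W hW Y hY)
      have h2 : (2 : ℝ) ^ W.card ≤ 2 ^ k := pow_le_pow_right₀ (by norm_num)
        ((Finset.card_le_card hW).trans ((List.toFinset_card_le _).trans hxl.le))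
      calc c / 2 ^ k * p * n * p ^ W.card ≤ c / 2 ^ W.card * p * n * p ^ W.card := by gcongr
        _ = (p / 2) ^ W.card * (c * p * n) := by rw [div_pow]; ring
        _ ≤ _ := by have := hZ's Y hY; gcongr) (by omega) (by simp [hTs]; omega) (by
      intro _
      have h1 := size_cond (s := s) (t := 2 * k - 1) (α := 1) (β := 1) (a := c / 2 ^ k * p * n)
        (b := c / 2 ^ k * p * n) (2 * k) hp hp1 hn hck hck (by rw [pow_one]) (by rw [pow_one])
        (by omega) (by omega) hε2
      refine lt_of_le_of_lt ?_ (h1.trans_eq (by ring))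
      have : ((2 : ℝ) ^ ((Ts.map (nb G r)).drop k).length) ≤ 2 ^ k :=
        pow_le_pow_right₀ (by norm_num) (by simp [hTs])
      rw [hxl]
      gcongr)
  have hyl : ys.length = k := by have := hys1.length_eq; simp [hTs] at this; omega
  have hall : List.Forall₂ (· ∈ ·) (xs ++ ys) (Ts.map (nb G r)) := by
    have := List.rel_append hxs1 hys1
    simpa only [List.take_append_drop] using this
  have hradj : ∀ u ∈ xs ++ ys, G.Adj u r := by
    intro u hu
    obtain ⟨T, hT, huT⟩ := forall₂_mem_exists hall hu
    obtain ⟨T', -, rfl⟩ := List.mem_map.1 hT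
    exact (mem_nb.1 huT).2.symm
  rw [List.forall₂_map_right_iff] at hall
  have hall' : List.Forall₂ (· ∈ ·) (xs ++ ys) Ts := hall.imp fun a b h => nb_subset _ _ h
  have hnod := nodup_of_forall₂_mem hall' hdisj
  have hP : KPath G k (xs ++ ys) := .of_cross hxs2 hys2 hys3 (.inl hxl)
  refine ⟨xs, ys, (xs ++ ys).toFinset, hxl, hyl, hxs2, hys2, ?_, ?_, ?_, ?_, ?_⟩
  · refine ⟨xs ++ r :: ys, hP.insert_middle hradj, ?_, ?_, ⟨_, rfl⟩, ⟨xs ++ [r], by simp⟩⟩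
    · rw [List.nodup_middle]
      refine List.nodup_cons.2 ⟨fun h => (hradj r h).ne rfl, hnod⟩
    · ext; simp
  · exact ⟨xs ++ ys, hP, hnod, rfl, ⟨_, rfl⟩, ⟨_, rfl⟩⟩
  · intro u hu
    exact forall₂_mem_exists hall' (List.mem_toFinset.1 hu)
  · refine (List.toFinset_card_le _).trans ?_
    simp [hxl, hyl]
  · intro S hSZ
    have hS' : S ∈ Z' := Finset.mem_union_left _ hSZ
    exact ⟨good_of_half hp hc hn hxl.le (hZ S hSZ) fun W hW => hxs4 W hW S hS',
      good_of_half hp hc hn hyl.le (hZ S hSZ) fun W hW => hys4 W hW S hS'⟩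

end Absorbers

/-! ### Absorbers for the square. -/

/-- Adjacent vertices with many neighbours, and many common neighbours, in each set of `Z`. -/
structure NicePair {V : Type*} (G : SimpleGraph V) (p n c : ℝ) (Z : Finset (Finset V))
    (u v : V) : Prop where
  adj : G.Adj u v
  left : ∀ S ∈ Z, c * p * n ≤ ((nb G u S).card : ℝ)
  right : ∀ S ∈ Z, c * p * n ≤ ((nb G v S).card : ℝ)
  both : ∀ S ∈ Z, c * p ^ 2 * n ≤ ((nb G u (nb G v S)).card : ℝ)

section SquareAbsorbers

theorem NicePair.symm {V : Type*} {G : SimpleGraph V} {p n c : ℝ} {Z : Finset (Finset V)}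
    {u v : V} (h : NicePair G p n c Z u v) : NicePair G p n c Z v u :=
  ⟨h.adj.symm, h.right, h.left, fun S hS => by rw [nb_comm]; exact h.both S hS⟩

theorem NicePair.mono {V : Type*} {G : SimpleGraph V} {p n c c' : ℝ} {Z : Finset (Finset V)}
    {u v : V} (hp : 0 < p) (hn : 0 < n) (hc : c' ≤ c) (h : NicePair G p n c Z u v) :
    NicePair G p n c' Z u v :=
  ⟨h.adj, fun S hS => le_trans (by gcongr) (h.left S hS),
    fun S hS => le_trans (by gcongr) (h.right S hS),
    fun S hS => le_trans (by gcongr) (h.both S hS)⟩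

theorem NicePair.good {V : Type*} [DecidableEq V] {G : SimpleGraph V} {p n c : ℝ}
    {Z : Finset (Finset V)} {u v : V} (h : NicePair G p n c Z u v) {S : Finset V} (hS : S ∈ Z)
    (hc : c * n ≤ (S.card : ℝ)) : Good G p n c [u, v] S := by
  intro W hW
  have huv : u ≠ v := h.adj.ne
  have hW' : W ⊆ {u, v} := fun x hx => by simpa using hW hx
  have h0 : ∀ w, cn G {w} S = nb G w S := fun w => cn_singleton w S
  have hW'' : W = ∅ ∨ W = {u} ∨ W = {v} ∨ W = {u, v} := by
    by_cases hu : u ∈ W <;> by_cases hv : v ∈ W <;> grind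
  rcases hW'' with rfl | rfl | rfl | rfl
  · simpa using hc
  · rw [h0, Finset.card_singleton, pow_one]; exact h.left S hS
  · rw [h0, Finset.card_singleton, pow_one]; exact h.right S hS
  · rw [Finset.card_pair huv, cn_insert, h0]; exact h.both S hS

open scoped Classical in
theorem exists_cons_of_few {V : Type*} {A : Finset V} {P : List V → Prop} {l : List V} {η : ℝ}
    (hη : η < 1) (h0 : 0 < (A.card : ℝ))
    (h : ((A.filter fun a => ¬ P (a :: l)).card : ℝ) ≤ η * A.card) : ∃ a ∈ A, P (a :: l) :=
  exists_of_few hη h0 h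

theorem Most.of_few {V : Type*} {G : SimpleGraph V} {η : ℝ} {B : Finset V}
    {Bs : List (Finset V)} {P : List V → Prop} {X : Finset V} (hX : (X.card : ℝ) ≤ η * B.card)
    (h : ∀ v ∈ B, v ∉ X → Most G η (Bs.map (nb G v)) fun l => P (v :: l)) :
    Most G η (B :: Bs) P := by
  classical
  rw [Most.cons]
  refine le_trans (Nat.cast_le.2 (Finset.card_le_card fun v hv => ?_)) hX
  rw [Finset.mem_filter] at hv
  by_contra hvX
  exact hv.2 (h v hv.1 hvX)

theorem Most.of_few_singleton {V : Type*} {G : SimpleGraph V} {η : ℝ} {B : Finset V}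
    {P : List V → Prop} {X : Finset V} (hX : (X.card : ℝ) ≤ η * B.card)
    (h : ∀ v ∈ B, v ∉ X → P [v]) : Most G η [B] P :=
  Most.of_few hX fun v hv hvX => by simpa [Most.nil] using h v hv hvX

/-- A vertex of a set of size at least `c p² n` has the right degree into given sets. -/
theorem Setup.pick {c : ℝ} (hc : 0 < c) (K : ℕ) : ∀ᶠ ε in 𝓝[>] (0 : ℝ),
    ∀ {V : Type u} [Fintype V] [DecidableEq V] {G : SimpleGraph V} {p n : ℝ},
    Setup G 3 ε p n → ∀ (B : Finset V) (L : List (Finset V)), L.length ≤ K →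
    c * p ^ 2 * n ≤ B.card → (∀ Y ∈ L, c * p * n ≤ Y.card) →
    ∃ v ∈ B, ∀ Y ∈ L, p / 2 * Y.card ≤ ((nb G v Y).card : ℝ) := by
  filter_upwards [eventually_mul_lt (4 * K) (A := c * c / 2 ^ 2) (by positivity)] with ε hε
  intro V _ _ G p n hS B L hL hB hY
  have hn := hS.n_pos
  have hp := hS.jumbled.pos
  have hp1 := hS.jumbled.le_one
  have hκ := hS.jumbled.nonneg
  have h1 : ∀ Y ∈ L.toFinset, c * c * (p ^ 3 * n ^ 2) ≤ B.card * (Y.card : ℝ) := by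
    intro Y hYL
    have := hY Y (List.mem_toFinset.1 hYL)
    calc c * c * (p ^ 3 * n ^ 2) = (c * p ^ 2 * n) * (c * p * n) := by ring
      _ ≤ _ := by gcongr
  obtain ⟨v, hv, h⟩ := hS.jumbled.pick B L.toFinset (by positivity) h1 (by
    have : (0 : ℝ) < B.card := lt_of_lt_of_le (by positivity) hB
    exact_mod_cast this) (by
    have h2 : (L.toFinset.card : ℝ) ≤ K := by
      exact_mod_cast (List.toFinset_card_le L).trans hL
    calc 4 * (L.toFinset.card : ℝ) * (ε * (p ^ 3 * n ^ 2)) ≤ 4 * K * (ε * (p ^ 3 * n ^ 2)) := by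
          gcongr
      _ = 4 * K * ε * (p ^ 3 * n ^ 2) := by ring
      _ < c * c * (p ^ 3 * n ^ 2) := by
          refine mul_lt_mul_of_pos_right (hε.trans_le ?_) (by positivity)
          have : 0 < c * c := by positivity
          linarith)
  exact ⟨v, hv, fun Y hY => h Y (List.mem_toFinset.2 hY)⟩

/-- Most neighbours `w` of `v` in `C` form nice pairs with `v` and have a common neighbour with
`u` and `v` in `D` that forms a nice pair with `v`. -/
theorem square_fold_step {c η : ℝ} (hc : 0 < c) (hη : 0 < η) (Q : ℕ) :
    ∀ᶠ ε in 𝓝[>] (0 : ℝ),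
    ∀ {V : Type u} [Fintype V] [DecidableEq V] {G : SimpleGraph V} {p n : ℝ},
    Setup G 3 ε p n → ∀ (Z : Finset (Finset V)) (u v : V) (C D : Finset V), Z.card ≤ Q →
    (∀ S ∈ Z, c * n ≤ S.card) → C ∈ Z → (∀ S ∈ Z, c * p * n ≤ ((nb G v S).card : ℝ)) →
    c * p ^ 2 * n ≤ ((nb G u (nb G v D)).card : ℝ) →
    ∃ X : Finset V, (X.card : ℝ) ≤ η * (nb G v C).card ∧ ∀ w ∈ nb G v C, w ∉ X →
      NicePair G p n (c / 2) Z v w ∧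
      ∃ x ∈ D, G.Adj u x ∧ G.Adj x w ∧ NicePair G p n (c / 2) Z v x := by
  filter_upwards [eventually_mul_lt (4 * (2 * Q : ℕ) * 2) (A := c * c / 2 ^ 0) (by positivity),
    eventually_mul_lt (4 * (2 * Q : ℕ) * (2 / η)) (A := c * c / 2 ^ 0) (by positivity),
    eventually_mul_lt (16 / η) (A := c * c / 2 ^ 0) (by positivity)]
    with ε hε1 hε2 hε3
  intro V _ _ G p n hS Z u v C D hQ hZ hCZ hvZ hD
  classical
  have hn := hS.n_pos
  have hp := hS.jumbled.pos
  have hp1 := hS.jumbled.le_one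
  have hκ := hS.jumbled.nonneg
  set L : List (Finset V) := Z.toList ++ Z.toList.map (nb G v) with hL
  have hLlen : (L.length : ℝ) ≤ (2 * Q : ℕ) := by
    have : L.length ≤ 2 * Q := by simp [hL]; omega
    exact_mod_cast this
  have hLc : ∀ Y ∈ L, c * p ^ 1 * n ≤ (Y.card : ℝ) := by
    intro Y hY
    rw [pow_one]
    rcases List.mem_append.1 hY with hY | hY
    · have : c * p * n ≤ c * 1 * n := by gcongr
      linarith [hZ Y (Finset.mem_toList.1 hY)]
    · obtain ⟨S, hS', rfl⟩ := List.mem_map.1 hY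
      exact hvZ S (Finset.mem_toList.1 hS')
  have hL0 : ∀ Y ∈ L, 0 < Y.card := fun Y hY => by
    have : (0 : ℝ) < Y.card := lt_of_lt_of_le (by positivity) (hLc Y hY)
    exact_mod_cast this
  have hnice : ∀ w, G.Adj v w → (∀ Y ∈ L, p / 2 * Y.card ≤ ((nb G w Y).card : ℝ)) →
      NicePair G p n (c / 2) Z v w := by
    intro w hvw hw
    refine ⟨hvw, fun S hS' => le_trans ?_ (hvZ S hS'), fun S hS' => ?_, fun S hS' => ?_⟩
    · gcongr; linarith
    · refine le_trans ?_ (hw S (by simp [hL, hS']))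
      calc c / 2 * p * n = p / 2 * (c * n) := by ring
        _ ≤ _ := by have := hZ S hS'; gcongr
    · rw [nb_comm]
      refine le_trans ?_ (hw (nb G v S) (by
        refine List.mem_append_right _ (List.mem_map.2 ⟨S, ?_, rfl⟩); simpa using hS'))
      calc c / 2 * p ^ 2 * n = p / 2 * (c * p * n) := by ring
        _ ≤ _ := by have := hvZ S hS'; gcongr
  obtain ⟨X₀, hX₀, hX₀t⟩ := few_untypical hS.jumbled (η := 1 / 2) (nb G u (nb G v D)) L
    (by norm_num) (by
      intro Y hY
      have := size_cond (s := 3) (t := 0) (α := 2) (β := 1) 0 hp hp1 hn hc hc hD (hLc Y hY)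
        (by norm_num) le_rfl hε1
      rw [pow_zero, one_mul] at this
      have h3 : 4 * (L.length : ℝ) * (ε * (p ^ 3 * n ^ 2)) ≤
        4 * (2 * Q : ℕ) * (ε * (p ^ 3 * n ^ 2)) := by gcongr
      linarith) hL0
  set D' := nb G u (nb G v D) \ X₀ with hD'
  have hD'c : c / 2 * p ^ 2 * n ≤ (D'.card : ℝ) := by
    have h1 : (nb G u (nb G v D)).card ≤ D'.card + X₀.card := by
      refine (Finset.card_le_card (t := D' ∪ X₀) ?_).trans (Finset.card_union_le _ _)
      intro x hx; simp only [hD', Finset.mem_union, Finset.mem_sdiff]; tauto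
    have h2 : ((nb G u (nb G v D)).card : ℝ) ≤ D'.card + X₀.card := by exact_mod_cast h1
    linarith
  have hC := hvZ C hCZ
  rw [show c * p * n = c * p ^ 1 * n by ring] at hC
  obtain ⟨X₁, hX₁, hX₁t⟩ := few_untypical hS.jumbled (η := η / 2) (nb G v C) L
    (by positivity) (by
      intro Y hY
      have := size_cond (s := 3) (t := 0) (α := 1) (β := 1) 0 hp hp1 hn hc hc hC (hLc Y hY)
        (by norm_num) le_rfl hε2
      rw [pow_zero, one_mul] at this
      have h3 : 4 * (L.length : ℝ) * (ε * (p ^ 3 * n ^ 2)) ≤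
        4 * (2 * Q : ℕ) * (ε * (p ^ 3 * n ^ 2)) := by gcongr
      have h4 : η / 2 * (4 * (2 * Q : ℕ) * (2 / η) * (ε * (p ^ 3 * n ^ 2))) =
        4 * (2 * Q : ℕ) * (ε * (p ^ 3 * n ^ 2)) := by field_simp
      have h5 := mul_le_mul_of_nonneg_left this.le (half_pos hη).le
      rw [h4] at h5
      linarith) hL0
  -- Each vertex of `D'` is a common neighbour of `u` and `v` forming a nice pair with `v`. So `w`
  -- lacks the required `x` only if it has no neighbour in `D'`; as `D'` has order `p²n` and `w`
  -- ranges over a set of order at least `pn`, this is rare.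
  set X₂ := (nb G v C).filter fun w => ∀ x ∈ D', ¬ G.Adj w x with hX₂
  have hX₂c : (X₂.card : ℝ) ≤ η / 2 * (nb G v C).card := by
    have h1 := hS.jumbled.few_disconnected (X := X₂) (Y := D')
      fun w hw x hx => (Finset.mem_filter.1 hw).2 x hx
    have h2 : (X₂.card : ℝ) * (c / 2 * p ^ 2 * n) ≤ 4 * (ε * (p ^ 3 * n ^ 2)) :=
      le_trans (by gcongr) h1
    refine le_of_mul_le_mul_right (h2.trans ?_) (show 0 < c / 2 * p ^ 2 * n by positivity)
    calc 4 * (ε * (p ^ 3 * n ^ 2)) = η / 4 * (16 / η * ε) * (p ^ 3 * n ^ 2) := by field_simp; ring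
      _ ≤ η / 4 * (c * c / 2 ^ 0) * (p ^ 3 * n ^ 2) := by gcongr
      _ = η / 2 * (c * p ^ 1 * n) * (c / 2 * p ^ 2 * n) := by ring
      _ ≤ _ := by gcongr
  refine ⟨X₁ ∪ X₂, ?_, fun w hw hwX => ?_⟩
  · have : ((X₁ ∪ X₂).card : ℝ) ≤ X₁.card + X₂.card := by exact_mod_cast Finset.card_union_le _ _
    linarith
  · rw [Finset.mem_union, not_or] at hwX
    refine ⟨hnice w (mem_nb.1 hw).2 (hX₁t w hw hwX.1), ?_⟩
    have h1 : ∃ x ∈ D', G.Adj w x := by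
      by_contra hcon
      push Not at hcon
      exact hwX.2 (Finset.mem_filter.2 ⟨hw, hcon⟩)
    obtain ⟨x, hx, hwx⟩ := h1
    obtain ⟨hx1, hx2⟩ := Finset.mem_sdiff.1 hx
    have hx3 := mem_nb.1 hx1
    have hx4 := mem_nb.1 hx3.1
    exact ⟨x, hx4.1, hx3.2, hwx.symm, hnice x hx4.2 (hX₀t x hx1 hx2)⟩

/-- From `a` and `b`, most edges between `H` and `H'` are reached. -/
theorem square_half {c η : ℝ} (hc : 0 < c) (hη : 0 < η) (hη1 : η ≤ 1) (Q : ℕ) :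
    ∀ᶠ ε in 𝓝[>] (0 : ℝ),
    ∀ {V : Type u} [Fintype V] [DecidableEq V] {G : SimpleGraph V} {p n : ℝ},
    Setup G 3 ε p n → ∀ (Z : Finset (Finset V)) (a b : V) (B₂ E E₂ H H₂ H' : Finset V),
    Z.card ≤ Q → (∀ S ∈ Z, c * n ≤ S.card) → (∀ S ∈ [E, E₂, H, H₂, H'], S ∈ Z) →
    (∀ S ∈ Z, c * p * n ≤ ((nb G b S).card : ℝ)) →
    c * p ^ 2 * n ≤ ((nb G a (nb G b B₂)).card : ℝ) →
    Most G η [H, H'] fun l => ∃ h ∈ H, ∃ h' ∈ H', l = [h, h'] ∧ G.Adj h h' ∧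
      ∃ e ∈ E, ∃ b₂ ∈ B₂, ∃ e₂ ∈ E₂, ∃ h₂ ∈ H₂,
        G.Adj b e ∧ G.Adj e h ∧ G.Adj a b₂ ∧ G.Adj b₂ e ∧ G.Adj b e₂ ∧ G.Adj e₂ h ∧
        G.Adj e h₂ ∧ G.Adj h₂ h' ∧ NicePair G p n (c / 8) Z b b₂ ∧
        NicePair G p n (c / 8) Z e e₂ ∧ NicePair G p n (c / 8) Z h h₂ := by
  obtain ⟨η₀, K, hη₀, hη₀1, hK, H₁⟩ := Most.rot.{u} 1 (η / 2) (by positivity) (by linarith)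
  filter_upwards [square_fold_step.{u} hc hη₀ Q, square_fold_step.{u} (half_pos hc) hη₀ Q,
    square_fold_step.{u} (half_pos (half_pos hc)) hη Q,
    eventually_mul_lt K (A := c * c / 2 ^ 0) (by positivity)] with ε h1 h2 h3 hε1
  intro V _ _ G p n hS Z a b B₂ E E₂ H H₂ H' hQ hZ hmem hb hab
  have hn := hS.n_pos
  have hp := hS.jumbled.pos
  have hp1 := hS.jumbled.le_one
  have hZ2 : ∀ S ∈ Z, c / 2 * n ≤ (S.card : ℝ) := fun S hS' =>
    le_trans (by gcongr; linarith) (hZ S hS')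
  have hZ4 : ∀ S ∈ Z, c / 2 / 2 * n ≤ (S.card : ℝ) := fun S hS' =>
    le_trans (by gcongr; linarith) (hZ2 S hS')
  have hE := hmem E (by simp)
  have hE₂ := hmem E₂ (by simp)
  have hH := hmem H (by simp)
  have hH₂ := hmem H₂ (by simp)
  have hH' := hmem H' (by simp)
  obtain ⟨X, hX, hXt⟩ := h1 hS Z a b E B₂ hQ hZ hE hb hab
  obtain ⟨R, hR⟩ : ∃ R : V → V → Prop, ∀ e h, R e h ↔ h ∈ H ∧ (NicePair G p n (c / 2) Z b e ∧
      ∃ x ∈ B₂, G.Adj a x ∧ G.Adj x e ∧ NicePair G p n (c / 2) Z b x) ∧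
      NicePair G p n (c / 2 / 2) Z e h ∧
        ∃ x ∈ E₂, G.Adj b x ∧ G.Adj x h ∧ NicePair G p n (c / 2 / 2) Z e x :=
    ⟨_, fun _ _ => Iff.rfl⟩
  have m1 : Most G η₀ [nb G b E, H] fun l => ∃ e h, l = [e, h] ∧ R e h := by
    refine Most.of_few hX fun e he heX => ?_
    have hbe := hXt e he heX
    obtain ⟨Y, hY, hYt⟩ := h2 hS Z b e H E₂ hQ hZ2 hH hbe.1.right (hbe.1.both _ hE₂)
    exact Most.of_few_singleton hY fun h hh hhY =>
      ⟨e, h, rfl, (hR e h).2 ⟨(mem_nb.1 hh).1, hbe, hYt h hh hhY⟩⟩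
  have hnbE : c * p ^ 1 * n ≤ ((nb G b E).card : ℝ) := by rw [pow_one]; exact hb E hE
  have hHc : c * p ^ 0 * n ≤ (H.card : ℝ) := by simpa using hZ H hH
  -- The two fold steps recorded in `R` choose `e` before `h`. After rotation most `h` come with a
  -- suitable `e`; one such `e` is fixed, and a third fold step from `e, h` handles `h'`.
  have m2 := (H₁ hS.jumbled (nb G b E) [H] _ rfl (by
    intro j hj
    obtain rfl : j = 0 := by simpa using hj
    exact size_cond 0 hp hp1 hn hc hc hnbE hHc (by omega) (by omega) hε1) (by
    intro i j hij hj
    simp at hj; omega) m1).with_mem (by positivity)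
  obtain ⟨Y, hY, hYt⟩ := m2.exists_few
  have hY' : (Y.card : ℝ) ≤ η * H.card := by
    have : η / 2 * (H.card : ℝ) ≤ η * H.card := by gcongr; linarith only [hη]
    exact hY.trans this
  refine Most.of_few (X := Y) hY' fun h hh hhY => ?_
  obtain ⟨⟨hl1, hl2⟩, -⟩ := hYt h hh hhY
  have h0 : (0 : ℝ) < (cnl G [h] (nb G b E)).card := by
    have : (0 : ℝ) < (nb G b E).card := lt_of_lt_of_le (by positivity) hnbE
    exact lt_of_lt_of_le (by positivity) hl1
  obtain ⟨e, he, e₀, h₀, heq, hReh⟩ := exists_cons_of_few (P := fun l => ∃ e h, l = [e, h] ∧ R e h)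
    (by linarith only [hη1]) h0 hl2
  obtain ⟨rfl, rfl⟩ : e = e₀ ∧ h = h₀ := by simpa using heq
  obtain ⟨-, ⟨hbe, b₂, hb₂, hab₂, hb₂e, hbb₂⟩, heh, e₂, he₂, hbe₂, he₂h, hee₂⟩ := (hR e h).1 hReh
  replace he := (mem_cnl.1 he).1
  obtain ⟨W, hW, hWt⟩ := h3 hS Z e h H' H₂ hQ hZ4 hH' heh.right (heh.both _ hH₂)
  refine Most.of_few_singleton hW fun h' hh' hh'W => ?_
  obtain ⟨-, h₂, hh₂, heh₂, hh₂h', hhh₂⟩ := hWt h' hh' hh'W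
  refine ⟨h, hh, h', (mem_nb.1 hh').1, rfl, (mem_nb.1 hh').2, e, (mem_nb.1 he).1, b₂, hb₂, e₂,
    he₂, h₂, hh₂, hbe.adj, heh.adj, hab₂, hb₂e, hbe₂, he₂h, heh₂, hh₂h', ?_, ?_, ?_⟩
  · exact hbb₂.mono hp hn (by linarith)
  · exact hee₂.mono hp hn (by linarith)
  · exact hhh₂.mono hp hn (by linarith)

end SquareAbsorbers

section SquareAbsorbers

/-- Two vertices with many neighbours are joined through `H` and `H'` as required for an
absorber. -/
theorem square_middle {c : ℝ} (hc : 0 < c) (Q : ℕ) : ∀ᶠ ε in 𝓝[>] (0 : ℝ),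
    ∀ {V : Type u} [Fintype V] [DecidableEq V] {G : SimpleGraph V} {p n : ℝ},
    Setup G 3 ε p n → ∀ (Z : Finset (Finset V)) (a b a' b' : V)
      (B₂ E E₂ H H₂ B₂' E' E₂' H' H₂' : Finset V),
    Z.card ≤ Q → (∀ S ∈ Z, c * n ≤ S.card) →
    (∀ S ∈ [E, E₂, H, H₂, E', E₂', H', H₂'], S ∈ Z) →
    (∀ S ∈ Z, c * p * n ≤ ((nb G b S).card : ℝ)) →
    c * p ^ 2 * n ≤ ((nb G a (nb G b B₂)).card : ℝ) →
    (∀ S ∈ Z, c * p * n ≤ ((nb G b' S).card : ℝ)) →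
    c * p ^ 2 * n ≤ ((nb G a' (nb G b' B₂')).card : ℝ) →
    ∃ h ∈ H, ∃ h' ∈ H', G.Adj h h' ∧
      (∃ e ∈ E, ∃ b₂ ∈ B₂, ∃ e₂ ∈ E₂, ∃ h₂ ∈ H₂,
        G.Adj b e ∧ G.Adj e h ∧ G.Adj a b₂ ∧ G.Adj b₂ e ∧ G.Adj b e₂ ∧ G.Adj e₂ h ∧
        G.Adj e h₂ ∧ G.Adj h₂ h' ∧ NicePair G p n (c / 8) Z b b₂ ∧
        NicePair G p n (c / 8) Z e e₂ ∧ NicePair G p n (c / 8) Z h h₂) ∧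
      ∃ e ∈ E', ∃ b₂ ∈ B₂', ∃ e₂ ∈ E₂', ∃ h₂ ∈ H₂',
        G.Adj b' e ∧ G.Adj e h' ∧ G.Adj a' b₂ ∧ G.Adj b₂ e ∧ G.Adj b' e₂ ∧ G.Adj e₂ h' ∧
        G.Adj e h₂ ∧ G.Adj h₂ h ∧ NicePair G p n (c / 8) Z b' b₂ ∧
        NicePair G p n (c / 8) Z e e₂ ∧ NicePair G p n (c / 8) Z h' h₂ := by
  obtain ⟨η₀, K, hη₀, hη₀1, hK, H₁⟩ := Most.reverse.{u} 2 (1 / 8) (by norm_num) (by norm_num)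
  filter_upwards [square_half.{u} hc (η := 1 / 8) (by norm_num) (by norm_num) Q,
    square_half.{u} hc hη₀ (by linarith) Q,
    eventually_mul_lt K (A := c * c / 2 ^ 0) (by positivity),
    eventually_mul_lt (16 * (2 : ℕ)) (A := c * c / 2 ^ 0) (by positivity)] with ε h1 h2 hε1 hε2
  intro V _ _ G p n hS Z a b a' b' B₂ E E₂ H H₂ B₂' E' E₂' H' H₂' hQ hZ hmem hb hab hb' hab'
  have hn := hS.n_pos
  have hp := hS.jumbled.pos
  have hp1 := hS.jumbled.le_one
  have hHc : c * p ^ 0 * n ≤ (H.card : ℝ) := by simpa using hZ H (hmem H (by simp))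
  have hHc' : c * p ^ 0 * n ≤ (H'.card : ℝ) := by simpa using hZ H' (hmem H' (by simp))
  have m1 := h1 hS Z a b B₂ E E₂ H H₂ H' hQ hZ
    (fun S hS' => hmem S (by simp at hS' ⊢; tauto)) hb hab
  have m2 := h2 hS Z a' b' B₂' E' E₂' H' H₂' H hQ hZ
    (fun S hS' => hmem S (by simp at hS' ⊢; tauto)) hb' hab'
  -- The half starting at `a', b'` covers most pairs in the order `h', h`; reversed, it can be
  -- intersected with the other half.
  have m3 := H₁ hS.jumbled 0 [H', H] _ rfl (by norm_num) (by
    intro i j hij hj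
    simp only [List.length_cons, List.length_nil] at hj
    obtain ⟨rfl, rfl⟩ : i = 0 ∧ j = 1 := by omega
    exact size_cond 0 hp hp1 hn hc hc hHc' hHc (by omega) (by omega) hε1) m2
  have m4 := m1.and (by norm_num) (by norm_num) m3
  obtain ⟨l, ⟨h, hh, h', hh', rfl, hadj, hl⟩, g', hg', g, hg, heq, hadj', hr⟩ :=
    Most.exists 2 (by norm_num) hS.jumbled (Bs := [H, H']) le_rfl (by
      intro i j hij hj
      simp only [List.length_cons, List.length_nil] at hj
      obtain ⟨rfl, rfl⟩ : i = 0 ∧ j = 1 := by omega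
      exact (size_cond 0 hp hp1 hn hc hc hHc hHc' (by omega) (by omega) hε2).le) (by
      have e1 : (0 : ℝ) < H.card := lt_of_lt_of_le (by positivity) hHc
      have e2 : (0 : ℝ) < H'.card := lt_of_lt_of_le (by positivity) hHc'
      simp only [List.mem_cons, List.not_mem_nil, or_false, forall_eq_or_imp, forall_eq]
      exact ⟨by exact_mod_cast e1, by exact_mod_cast e2⟩) m4
  obtain ⟨rfl, rfl⟩ : h' = g' ∧ h = g := by simpa using heq
  exact ⟨h, hh, h', hh', hadj, hl, hr⟩

/-- The start of an absorber: two nice pairs in the neighbourhood of `r`, extended by one vertex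
each. -/
theorem square_start {c : ℝ} (hc : 0 < c) (Q : ℕ) : ∀ᶠ ε in 𝓝[>] (0 : ℝ),
    ∀ {V : Type u} [Fintype V] [DecidableEq V] {G : SimpleGraph V} {p n : ℝ},
    Setup G 3 ε p n → ∀ (Z : Finset (Finset V)) (r : V) (A A₂ F F₂ B B₂ B' B₂' : Finset V),
    Z.card ≤ Q → (∀ S ∈ Z, c * n ≤ S.card) → (∀ S ∈ [B, B₂, B', B₂'], S ∈ Z) →
    (∀ S ∈ [A, A₂, F, F₂], c * p * n ≤ ((nb G r S).card : ℝ)) →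
    ∃ a ∈ A, ∃ a₂ ∈ A₂, ∃ g ∈ F, ∃ g₂ ∈ F₂, ∃ b ∈ B, ∃ b' ∈ B',
      G.Adj r a ∧ G.Adj r a₂ ∧ G.Adj r g ∧ G.Adj r g₂ ∧ G.Adj a g ∧
      NicePair G p n (c / 4) Z a a₂ ∧ NicePair G p n (c / 4) Z g g₂ ∧
      G.Adj a b ∧ G.Adj a₂ b ∧ G.Adj g b' ∧ G.Adj g₂ b' ∧
      (∀ S ∈ Z, c / 4 * p * n ≤ ((nb G b S).card : ℝ)) ∧
      c / 4 * p ^ 2 * n ≤ ((nb G a (nb G b B₂)).card : ℝ) ∧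
      (∀ S ∈ Z, c / 4 * p * n ≤ ((nb G b' S).card : ℝ)) ∧
      c / 4 * p ^ 2 * n ≤ ((nb G g (nb G b' B₂')).card : ℝ) := by
  filter_upwards [Setup.pick.{u} (show 0 < c / 4 by positivity) (2 * Q + 2)] with ε h1
  intro V _ _ G p n hS Z r A A₂ F F₂ B B₂ B' B₂' hQ hZ hmem hr
  have hn := hS.n_pos
  have hp := hS.jumbled.pos
  have hp1 := hS.jumbled.le_one
  have hpp : c * p ^ 2 * n ≤ c * p * n := by
    have : p ^ 2 ≤ p := by nlinarith
    gcongr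
  have hquart : c / 4 * p * n ≤ c * p * n := by gcongr; linarith
  have hquart2 : c / 4 * p ^ 2 * n ≤ c * p ^ 2 * n := by gcongr; linarith
  have hZ' : ∀ S ∈ Z, c / 4 * p * n ≤ (S.card : ℝ) := fun S hS' => by
    have : c / 4 * p * n ≤ c * 1 * n := by gcongr; linarith
    linarith [hZ S hS']
  have half : ∀ (v : V) (Y : Finset V), c * p * n ≤ (Y.card : ℝ) →
      p / 2 * Y.card ≤ ((nb G v Y).card : ℝ) → c / 2 * p ^ 2 * n ≤ ((nb G v Y).card : ℝ) := by
    intro v Y hY h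
    refine le_trans ?_ h
    calc c / 2 * p ^ 2 * n = p / 2 * (c * p * n) := by ring
      _ ≤ _ := by gcongr
  have halfZ : ∀ (v : V) (Y : Finset V), Y ∈ Z →
      p / 2 * Y.card ≤ ((nb G v Y).card : ℝ) → c / 2 * p * n ≤ ((nb G v Y).card : ℝ) := by
    intro v Y hY h
    refine le_trans ?_ h
    calc c / 2 * p * n = p / 2 * (c * n) := by ring
      _ ≤ _ := by have := hZ Y hY; gcongr
  have quart : ∀ (v : V) (Y : Finset V), c / 2 * p * n ≤ (Y.card : ℝ) →
      p / 2 * Y.card ≤ ((nb G v Y).card : ℝ) → c / 4 * p ^ 2 * n ≤ ((nb G v Y).card : ℝ) := by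
    intro v Y hY h
    refine le_trans ?_ h
    calc c / 4 * p ^ 2 * n = p / 2 * (c / 2 * p * n) := by ring
      _ ≤ _ := by gcongr
  have hZlen : Z.toList.length ≤ Q := by simpa using hQ
  have h42 : c / 4 * p * n ≤ c / 2 * p * n := by gcongr; linarith
  have h42' : c / 4 * p ^ 2 * n ≤ c / 2 * p ^ 2 * n := by gcongr; linarith
  -- a vertex that extends `v, w` towards a nice pair
  have pair : ∀ (v : V) (Y : Finset V), c / 2 * p ^ 2 * n ≤ ((nb G v Y).card : ℝ) →
      (∀ S ∈ Z, c / 2 * p * n ≤ ((nb G v S).card : ℝ)) →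
      ∃ w ∈ nb G v Y, NicePair G p n (c / 4) Z v w := by
    intro v Y hY hv
    obtain ⟨w, hw, hwt⟩ := h1 hS (nb G v Y) (Z.toList ++ Z.toList.map (nb G v))
      (by simp; omega) (h42'.trans hY) (by
        intro T hT
        rcases List.mem_append.1 hT with hT | hT
        · exact hZ' T (Finset.mem_toList.1 hT)
        · obtain ⟨S, hS', rfl⟩ := List.mem_map.1 hT
          exact h42.trans (hv S (Finset.mem_toList.1 hS')))
    refine ⟨w, hw, (mem_nb.1 hw).2, fun S hS' => h42.trans (hv S hS'), fun S hS' => ?_,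
      fun S hS' => ?_⟩
    · exact h42.trans (halfZ w S hS' (hwt S (by simp [hS'])))
    · rw [nb_comm]
      exact quart w _ (hv S hS') (hwt _ (List.mem_append_right _
        (List.mem_map.2 ⟨S, by simpa using hS', rfl⟩)))
  have next : ∀ (v w : V) (Y Y₂ : Finset V), Y ∈ Z → Y₂ ∈ Z →
      (∀ S ∈ Z, c / 2 * p * n ≤ ((nb G v S).card : ℝ)) → NicePair G p n (c / 4) Z v w →
      ∃ x ∈ Y, G.Adj v x ∧ G.Adj w x ∧ (∀ S ∈ Z, c / 4 * p * n ≤ ((nb G x S).card : ℝ)) ∧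
        c / 4 * p ^ 2 * n ≤ ((nb G v (nb G x Y₂)).card : ℝ) := by
    intro v w Y Y₂ hY hY₂ hv hvw
    obtain ⟨x, hx, hxt⟩ := h1 hS (nb G v (nb G w Y)) (nb G v Y₂ :: Z.toList)
      (by simp; omega) (hvw.both Y hY) (by
        intro T hT
        rcases List.mem_cons.1 hT with rfl | hT
        · exact h42.trans (hv Y₂ hY₂)
        · exact hZ' T (Finset.mem_toList.1 hT))
    have hx' := mem_nb.1 hx
    have hx'' := mem_nb.1 hx'.1
    refine ⟨x, hx''.1, hx'.2, hx''.2, fun S hS' => ?_, ?_⟩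
    · exact h42.trans (halfZ x S hS' (hxt S (by simp [hS'])))
    · rw [nb_comm]
      exact quart x _ (hv Y₂ hY₂) (hxt _ (by simp))
  have hA := hr A (by simp)
  have hA₂ := hr A₂ (by simp)
  have hF := hr F (by simp)
  have hF₂ := hr F₂ (by simp)
  -- Every vertex is picked from a set of order at least `p²n`, with its degree controlled into the
  -- sets of order at least `pn` that are still needed: just what `s = 3` permits. Inside the
  -- neighbourhood of `r` only the edge `ag` and the pairs `aa₂`, `gg₂` are required.
  obtain ⟨g, hg, hgt⟩ := h1 hS (nb G r F) (nb G r A :: nb G r F₂ :: Z.toList) (by simp; omega)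
    (by linarith) (by
      intro T hT
      simp only [List.mem_cons, Finset.mem_toList] at hT
      rcases hT with rfl | rfl | hT
      · linarith
      · linarith
      · exact hZ' T hT)
  have hgS : ∀ S ∈ Z, c / 2 * p * n ≤ ((nb G g S).card : ℝ) := fun S hS' =>
    halfZ g S hS' (hgt S (by simp [hS']))
  obtain ⟨a, ha, hat⟩ := h1 hS (nb G g (nb G r A)) (nb G r A₂ :: Z.toList) (by simp; omega)
    (h42'.trans (half g _ hA (hgt _ (by simp)))) (by
      intro T hT
      simp only [List.mem_cons, Finset.mem_toList] at hT
      rcases hT with rfl | hT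
      · linarith
      · exact hZ' T hT)
  have haS : ∀ S ∈ Z, c / 2 * p * n ≤ ((nb G a S).card : ℝ) := fun S hS' =>
    halfZ a S hS' (hat S (by simp [hS']))
  obtain ⟨a₂, ha₂, haa⟩ := pair a (nb G r A₂) (half a _ hA₂ (hat _ (by simp))) haS
  obtain ⟨g₂, hg₂, hgg⟩ := pair g (nb G r F₂) (half g _ hF₂ (hgt _ (by simp))) hgS
  obtain ⟨b, hb, hab, ha₂b, hbS, hbB⟩ := next a a₂ B B₂ (hmem _ (by simp)) (hmem _ (by simp))
    haS haa
  obtain ⟨b', hb', hgb, hg₂b, hbS', hbB'⟩ := next g g₂ B' B₂' (hmem _ (by simp))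
    (hmem _ (by simp)) hgS hgg
  simp only [mem_nb] at ha ha₂ hg hg₂
  exact ⟨a, ha.1.1, a₂, ha₂.1.1, g, hg.1, g₂, hg₂.1.1, b, hb, b', hb', ha.1.2, ha₂.1.2, hg.2,
    hg₂.1.2, ha.2.symm, haa, hgg, hab, ha₂b, hgb, hg₂b, hbS, hbB, hbS', hbB'⟩

theorem KPath.glue_pair {V : Type*} {G : SimpleGraph V} {A B : List V} {a b : V}
    (h₁ : KPath G 2 (A ++ [a, b])) (h₂ : KPath G 2 ([a, b] ++ B)) :
    KPath G 2 (A ++ [a, b] ++ B) := h₁.glue h₂ le_rfl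

/-- `a₂, a, b, b₂` is a square path. -/
theorem KPath.half_joined {V : Type*} {G : SimpleGraph V} {a a₂ b b₂ : V} (h1 : G.Adj a a₂)
    (h2 : G.Adj b b₂) (h3 : G.Adj a b) (h4 : G.Adj a₂ b) (h5 : G.Adj a b₂) :
    KPath G 2 ([a₂, a] ++ [b, b₂]) :=
  KPath.snoc_two (l := [a₂]) (KPath.snoc_two (l := [])
    (.of_pairwise (by simpa using h1.symm)) h4 h3) h5 h2

/-- The vertex `r` can be inserted into or removed from a square path: the combinatorial part of
the construction. -/
theorem square_switch {V : Type*} {G : SimpleGraph V}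
    {r a a₂ g g₂ b b₂ e e₂ h h₂ b' b₂' e' e₂' h' h₂' : V} {x y z : List V}
    (hx : KPath G 2 ([g, g₂] ++ x ++ [e₂, e])) (hy : KPath G 2 ([b, b₂] ++ y ++ [b₂', b']))
    (hz : KPath G 2 ([e', e₂'] ++ z ++ [h₂, h]))
    (hra : G.Adj r a) (hra₂ : G.Adj r a₂) (hrg : G.Adj r g) (hrg₂ : G.Adj r g₂)
    (hag : G.Adj a g)
    (jab : KPath G 2 ([a₂, a] ++ [b, b₂])) (jbe : KPath G 2 ([b₂, b] ++ [e, e₂]))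
    (jeh : KPath G 2 ([e₂, e] ++ [h, h₂])) (jhh : KPath G 2 ([h₂, h] ++ [h', h₂']))
    (jgb' : KPath G 2 ([g₂, g] ++ [b', b₂'])) (jbe' : KPath G 2 ([b₂', b'] ++ [e', e₂']))
    (jeh' : KPath G 2 ([e₂', e'] ++ [h', h₂'])) :
    KPath G 2 ([a₂, a] ++ [r] ++ [g, g₂] ++ x ++ [e₂, e] ++ [b, b₂] ++ y ++ [b₂', b'] ++
      [e', e₂'] ++ z ++ [h₂, h] ++ [h', h₂']) ∧
    KPath G 2 ([a₂, a] ++ [b, b₂] ++ y ++ [b₂', b'] ++ [g, g₂] ++ x ++ [e₂, e] ++ [h, h₂] ++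
      z.reverse ++ [e₂', e'] ++ [h', h₂']) := by
  have jr : KPath G 2 ([a₂, a] ++ [r] ++ [g, g₂]) := by
    have haa : G.Adj a₂ a := jab.left.pairwise (by simp) |> fun h => by simpa using h
    have hgg : G.Adj g g₂ := hx.left.left.pairwise (by simp) |> fun h => by simpa using h
    have k1 := KPath.snoc_two (l := []) (.of_pairwise (by simpa using haa)) hra₂.symm hra.symm
    have k2 := KPath.snoc_two (l := [a₂]) k1 hag hrg
    exact KPath.snoc_two (l := [a₂, a]) k2 hrg₂ hgg
  have jeb : KPath G 2 ([e₂, e] ++ [b, b₂]) := by simpa using jbe.reverse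
  have jbg : KPath G 2 ([b₂', b'] ++ [g, g₂]) := by simpa using jgb'.reverse
  have hz' : KPath G 2 ([h, h₂] ++ z.reverse ++ [e₂', e']) := by simpa using hz.reverse
  have app : ∀ {A B : List V} {a b : V}, KPath G 2 (A ++ [a, b]) → KPath G 2 ([a, b] ++ B) →
    KPath G 2 (A ++ [a, b] ++ B) := fun h1 h2 => h1.glue_pair h2
  constructor
  · have := jr
    replace this := app (A := [a₂, a] ++ [r]) (a := g) (b := g₂) (B := x ++ [e₂, e])
      (by simpa using this) (by simpa using hx)
    replace this := app (A := [a₂, a] ++ [r] ++ [g, g₂] ++ x) (a := e₂) (b := e) (B := [b, b₂])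
      (by simpa using this) (by simpa using jeb)
    replace this := app (A := [a₂, a] ++ [r] ++ [g, g₂] ++ x ++ [e₂, e]) (a := b) (b := b₂) (B := y ++ [b₂', b'])
      (by simpa using this) (by simpa using hy)
    replace this := app (A := [a₂, a] ++ [r] ++ [g, g₂] ++ x ++ [e₂, e] ++ [b, b₂] ++ y) (a := b₂') (b := b') (B := [e', e₂'])
      (by simpa using this) (by simpa using jbe')
    replace this := app (A := [a₂, a] ++ [r] ++ [g, g₂] ++ x ++ [e₂, e] ++ [b, b₂] ++ y ++ [b₂', b']) (a := e') (b := e₂') (B := z ++ [h₂, h])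
      (by simpa using this) (by simpa using hz)
    replace this := app (A := [a₂, a] ++ [r] ++ [g, g₂] ++ x ++ [e₂, e] ++ [b, b₂] ++ y ++ [b₂', b'] ++ [e', e₂'] ++ z) (a := h₂) (b := h) (B := [h', h₂'])
      (by simpa using this) (by simpa using jhh)
    simpa using this
  · have := jab
    replace this := app (A := [a₂, a]) (a := b) (b := b₂) (B := y ++ [b₂', b'])
      (by simpa using this) (by simpa using hy)
    replace this := app (A := [a₂, a] ++ [b, b₂] ++ y) (a := b₂') (b := b') (B := [g, g₂])
      (by simpa using this) (by simpa using jbg)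
    replace this := app (A := [a₂, a] ++ [b, b₂] ++ y ++ [b₂', b']) (a := g) (b := g₂) (B := x ++ [e₂, e])
      (by simpa using this) (by simpa using hx)
    replace this := app (A := [a₂, a] ++ [b, b₂] ++ y ++ [b₂', b'] ++ [g, g₂] ++ x) (a := e₂) (b := e) (B := [h, h₂])
      (by simpa using this) (by simpa using jeh)
    replace this := app (A := [a₂, a] ++ [b, b₂] ++ y ++ [b₂', b'] ++ [g, g₂] ++ x ++ [e₂, e]) (a := h) (b := h₂) (B := z.reverse ++ [e₂', e'])
      (by simpa using this) (by simpa using hz')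
    replace this := app (A := [a₂, a] ++ [b, b₂] ++ y ++ [b₂', b'] ++ [g, g₂] ++ x ++ [e₂, e] ++ [h, h₂] ++ z.reverse) (a := e₂') (b := e') (B := [h', h₂'])
      (by simpa using this) (by simpa using jeh')
    simpa using this

-- A four-vertex square path inside the neighbourhood of `r` would need `s = 5`. Here `r` sits
-- between `a₂, a` and `g, g₂`, which requires, besides the two pairs, only the edge `ag`. Without
-- `r` the two pairs need not be close, so the remaining blocks are rearranged. Naming a pair by its
-- main vertex, with connecting paths `x` from `g` to `e`, `y` from `b` to `b'` and `z` from `e'` to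
-- `h`, the two paths run `a, r, g, x, e, b, y, b', e', z, h, h'` and `a, b, y, b', g, x, e, h`,
-- reversed `z`, `e', h'`. All joints are between pairs provided by `square_start` and
-- `square_middle`.
set_option maxHeartbeats 1000000 in
theorem absorbs_square {m : ℕ} (hcon : Connects.{u} 2 3 m) :
    HasAbsorbers.{u} 2 3 (16 + (m + m + m)) := by
  intro c hc hc1 Q
  refine ⟨c / 4 / 8, by positivity, ?_⟩
  filter_upwards [square_start.{u} hc Q, square_middle.{u} (show 0 < c / 4 by positivity) Q,
    hcon (c / 4 / 8) (by positivity)] with ε h1 h2 h3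
  intro V _ _ G p n hS r Ts Z hTs hdisj hr hrT hTZ hZ hQ
  have hn := hS.n_pos
  have hp := hS.jumbled.pos
  have hp1 := hS.jumbled.le_one
  obtain ⟨T₀, TX, TY, TW, rfl, hT₀, hTX, hTY, hTW⟩ : ∃ T₀ TX TY TW, Ts = T₀ ++ (TX ++ TY ++ TW) ∧
      T₀.length = 16 ∧ TX.length = m ∧ TY.length = m ∧ TW.length = m :=
    ⟨Ts.take 16, (Ts.drop 16).take m, ((Ts.drop 16).drop m).take m, ((Ts.drop 16).drop m).drop m,
      by rw [List.append_assoc]; simp only [List.take_append_drop], by simp; omega,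
      by simp; omega, by simp; omega, by simp; omega⟩
  obtain ⟨A, A₂, F, F₂, B, B₂, E, E₂, H, H₂, B', B₂', E', E₂', H', H₂', rfl⟩ :
      ∃ a b c d e f g h i j k l m n o p, T₀ = [a, b, c, d, e, f, g, h, i, j, k, l, m, n, o, p] := by
    match T₀, hT₀ with
    | [a, b, c, d, e, f, g, h, i, j, k, l, m, n, o, p], _ =>
      exact ⟨a, b, c, d, e, f, g, h, i, j, k, l, m, n, o, p, rfl⟩
  have hT₀Z : ∀ T ∈ [A, A₂, F, F₂, B, B₂, E, E₂, H, H₂, B', B₂', E', E₂', H', H₂'], T ∈ Z :=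
    fun T hT => hTZ T (List.mem_append_left _ hT)
  have hc4 : ∀ S ∈ Z, c / 4 * n ≤ (S.card : ℝ) := fun S hS' =>
    le_trans (by gcongr; linarith) (hZ S hS')
  have hc48 : ∀ S ∈ Z, c / 4 / 8 * n ≤ (S.card : ℝ) := fun S hS' =>
    le_trans (mul_le_mul_of_nonneg_right (by linarith) hn.le) (hc4 S hS')
  obtain ⟨a, ha, a₂, ha₂, g, hg, g₂, hg₂, b, hb, b', hb', hra, hra₂, hrg, hrg₂, hag, naa, ngg,
    hab, ha₂b, hgb', hg₂b', hbZ, hbB, hbZ', hbB'⟩ := h1 hS Z r A A₂ F F₂ B B₂ B' B₂' hQ hZ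
    (fun S hS' => hT₀Z S (by simp at hS' ⊢; tauto))
    (fun S hS' => hrT S (List.mem_append_left _ (by simp at hS' ⊢; tauto)))
  obtain ⟨h, hh, h', hh', hhh', ⟨e, he, b₂, hb₂, e₂, he₂, h₂, hh₂, hbe, heh, hab₂, hb₂e, hbe₂,
    he₂h, heh₂, hh₂h', nbb, nee, nhh⟩, e', he', b₂', hb₂', e₂', he₂', h₂', hh₂', hbe', heh',
    hgb₂', hb₂e', hbe₂', he₂h', heh₂', hh₂h, nbb', nee', nhh'⟩ :=
    h2 hS Z a b g b' B₂ E E₂ H H₂ B₂' E' E₂' H' H₂' hQ hc4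
    (fun S hS' => hT₀Z S (by simp at hS' ⊢; tauto)) hbZ hbB hbZ' hbB'
  have good : ∀ {u v : V}, NicePair G p n (c / 4 / 8) Z u v → ∀ T ∈ Z,
      Good G p n (c / 4 / 8) [u, v] T := fun huv T hT => huv.good hT (hc48 T hT)
  have naa' := naa.mono hp hn (show c / 4 / 8 ≤ c / 4 by linarith)
  have ngg' := ngg.mono hp hn (show c / 4 / 8 ≤ c / 4 by linarith)
  have hXZ : ∀ T ∈ TX, T ∈ Z := fun T hT => hTZ T (by simp [hT])
  have hYZ : ∀ T ∈ TY, T ∈ Z := fun T hT => hTZ T (by simp [hT])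
  have hWZ : ∀ T ∈ TW, T ∈ Z := fun T hT => hTZ T (by simp [hT])
  obtain ⟨x, hx, hxP⟩ := h3 hS [g, g₂] [e₂, e] TX rfl rfl (by simpa using ngg.adj)
    (by simpa using nee.adj.symm) hTX (fun T hT => good ngg' T (hXZ T hT))
    (fun T hT => good nee.symm T (hXZ T hT))
  obtain ⟨y, hy, hyP⟩ := h3 hS [b, b₂] [b₂', b'] TY rfl rfl (by simpa using nbb.adj)
    (by simpa using nbb'.adj.symm) hTY (fun T hT => good nbb T (hYZ T hT))
    (fun T hT => good nbb'.symm T (hYZ T hT))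
  obtain ⟨z, hz, hzP⟩ := h3 hS [e', e₂'] [h₂, h] TW rfl rfl (by simpa using nee'.adj)
    (by simpa using nhh.adj.symm) hTW (fun T hT => good nee' T (hWZ T hT))
    (fun T hT => good nhh.symm T (hWZ T hT))
  set L : List V := [a, a₂, g, g₂, b, b₂, e, e₂, h, h₂, b', b₂', e', e₂', h', h₂'] ++
    (x ++ y ++ z) with hL
  have hLT : List.Forall₂ (· ∈ ·) L ([A, A₂, F, F₂, B, B₂, E, E₂, H, H₂, B', B₂', E', E₂', H',
      H₂'] ++ (TX ++ TY ++ TW)) := by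
    refine List.rel_append ?_ (List.rel_append (List.rel_append hx hy) hz)
    simp only [List.forall₂_cons, List.Forall₂.nil, and_true]
    exact ⟨ha, ha₂, hg, hg₂, hb, hb₂, he, he₂, hh, hh₂, hb', hb₂', he', he₂', hh', hh₂'⟩
  have hLn := nodup_of_forall₂_mem hLT hdisj
  have hrL : r ∉ L := fun hrL => by
    obtain ⟨T, hT, hrT'⟩ := forall₂_mem_exists hLT hrL
    exact hr T hT hrT'
  obtain ⟨P₁, P₂⟩ := square_switch hxP hyP hzP hra hra₂ hrg hrg₂ hag
    (.half_joined naa.adj nbb.adj hab ha₂b hab₂) (.half_joined nbb.adj nee.adj hbe hb₂e hbe₂)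
    (.half_joined nee.adj nhh.adj heh he₂h heh₂) (.half_joined nhh.adj nhh'.adj hhh' hh₂h' hh₂h.symm)
    (.half_joined ngg.adj nbb'.adj hgb' hg₂b' hgb₂')
    (.half_joined nbb'.adj nee'.adj hbe' hb₂e' hbe₂')
    (.half_joined nee'.adj nhh'.adj heh' he₂h' heh₂')
  refine ⟨[a₂, a], [h', h₂'], L.toFinset, rfl, rfl, by simpa using naa.adj.symm,
    by simpa using nhh'.adj, ?_, ?_, ?_, ?_, ?_⟩
  · have hperm : List.Perm ([a₂, a] ++ [r] ++ [g, g₂] ++ x ++ [e₂, e] ++ [b, b₂] ++ y ++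
      [b₂', b'] ++ [e', e₂'] ++ z ++ [h₂, h] ++ [h', h₂']) (r :: L) := by
      rw [List.perm_iff_count]
      intro w
      simp only [hL, List.count_append, List.count_cons, List.count_nil]
      omega
    refine ⟨_, P₁, hperm.nodup_iff.2 (List.nodup_cons.2 ⟨hrL, hLn⟩), ?_, by simp, ?_⟩
    · rw [List.toFinset_eq_of_perm _ _ hperm, List.toFinset_cons]
    · exact ⟨_, rfl⟩
  · have hperm : List.Perm ([a₂, a] ++ [b, b₂] ++ y ++ [b₂', b'] ++ [g, g₂] ++ x ++ [e₂, e] ++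
      [h, h₂] ++ z.reverse ++ [e₂', e'] ++ [h', h₂']) L := by
      rw [List.perm_iff_count]
      intro w
      simp only [hL, List.count_append, List.count_cons, List.count_nil, List.count_reverse]
      omega
    refine ⟨_, P₂, hperm.nodup_iff.2 hLn, ?_, by simp, ⟨_, rfl⟩⟩
    rw [List.toFinset_eq_of_perm _ _ hperm]
  · intro u hu
    exact forall₂_mem_exists hLT (List.mem_toFinset.1 hu)
  · refine (List.toFinset_card_le _).trans ?_
    rw [hLT.length_eq]
    simp only [List.length_append, hTX, hTY, hTW, List.length_cons, List.length_nil]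
    omega
  · intro S hSZ
    exact ⟨good naa'.symm S hSZ, good nhh' S hSZ⟩

end SquareAbsorbers

/-! ### Flexible paths and the absorption of a whole set. -/

/-- A `k`-path from `x` to `e` with vertex set `U` that stays one after removing any subset
of `D`; the end `e` has many common neighbours outside `U` in the sets of `Ts`, and in the sets
of `Ws`. -/
structure Flexible {V : Type*} [DecidableEq V] (G : SimpleGraph V) (k : ℕ) (p n c : ℝ)
    (x : List V) (Ts : List (Finset V)) (Ws : Finset (Finset V)) (D U : Finset V)
    (e : List V) : Prop where
  subset : D ⊆ U
  path (W : Finset V) : W ⊆ D → PathOn G k x e (U \ W)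
  length : e.length = k
  adj : e.Pairwise G.Adj
  good (T : Finset V) : T ∈ Ts → Good G p n c e (T \ U)
  watch (S : Finset V) : S ∈ Ws → Good G p n c e S

section Flexible

/-- The field `large` gives `p^k n ≥ 1/ε` for `k ≤ s`, so deleting boundedly many vertices is
negligible even in common neighbourhoods of `k` vertices. -/
theorem Setup.large_of_lt {V : Type*} [Fintype V] {G : SimpleGraph V} {s k : ℕ} {ε p n C c : ℝ}
    (h : Setup G s ε p n) (hk : k ≤ s) (hc : 0 < c)
    (hC : C * ε < c) : C ≤ c * p ^ k * n := by
  have hp := h.jumbled.pos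
  have hn := h.n_pos
  have hε := h.eps_pos
  have h1 : ε * (p ^ s * n) ≤ ε * (p ^ k * n) := by
    have := pow_le_pow_of_le_one hp.le h.jumbled.le_one hk
    gcongr
  have h2 := h.large.trans h1
  by_contra hcon
  push Not at hcon
  have h3 : c * p ^ k * n * ε < c := (mul_lt_mul_of_pos_right hcon hε).trans hC
  have h4 : 0 < p ^ k * n := by positivity
  have h5 : c * (ε * (p ^ k * n)) < c := by linarith
  nlinarith

theorem Good.mono {V : Type*} [DecidableEq V] {G : SimpleGraph V} {p n c c' : ℝ} {e : List V}
    {S S' : Finset V} (h : Good G p n c e S) (hp : 0 < p) (hn : 0 < n) (hc : c' ≤ c)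
    (hS : S ⊆ S') : Good G p n c' e S' := by
  intro W hW
  refine le_trans ?_ ((h W hW).trans (Nat.cast_le.2 (Finset.card_le_card (cn_mono W hS))))
  gcongr

/-- Removing few vertices from a set preserves goodness. -/
theorem Good.sdiff {V : Type*} [DecidableEq V] {G : SimpleGraph V} {p n c : ℝ} {e : List V}
    {S X : Finset V} {k : ℕ} (h : Good G p n c e S) (hp : 0 < p) (hp1 : p ≤ 1) (hn : 0 < n)
    (hc : 0 < c) (he : e.length ≤ k) (hX : (X.card : ℝ) ≤ c / 2 * p ^ k * n) :
    Good G p n (c / 2) e (S \ X) := by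
  intro W hW
  have hWk : W.card ≤ k := (Finset.card_le_card hW).trans ((List.toFinset_card_le e).trans he)
  have h1 : (cn G W S).card ≤ (cn G W (S \ X)).card + X.card := by
    refine (Finset.card_le_card (t := cn G W (S \ X) ∪ X) ?_).trans (Finset.card_union_le _ _)
    intro v hv
    simp only [Finset.mem_union, mem_cn, Finset.mem_sdiff] at hv ⊢
    tauto
  have h2 : ((cn G W S).card : ℝ) ≤ (cn G W (S \ X)).card + X.card := by exact_mod_cast h1
  have h3 := h W hW
  have h4 : c / 2 * p ^ k * n ≤ c / 2 * p ^ W.card * n := by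
    have := pow_le_pow_of_le_one hp.le hp1 hWk
    gcongr
  have h5 : c * p ^ W.card * n = c / 2 * p ^ W.card * n + c / 2 * p ^ W.card * n := by ring
  linarith

/-- Prolonging flexible paths by a connecting path and an absorber. -/
theorem path_sdiff_step {V : Type*} [DecidableEq V] {G : SimpleGraph V} {k : ℕ}
    {x e z q f : List V} {r : V} {D U Y : Finset V} (hDU : D ⊆ U)
    (hpath : ∀ W ⊆ D, PathOn G k x e (U \ W)) (he : e.length = k) (hq : q.length = k)
    (hz : KPath G k (e ++ z ++ q)) (hzn : z.Nodup) (hP₁ : PathOn G k q f (insert r Y))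
    (hP₂ : PathOn G k q f Y) (hrU : r ∉ U) (hrz : r ∉ z.toFinset) (hrY : r ∉ Y)
    (hzY : Disjoint z.toFinset Y) (hzU : Disjoint U z.toFinset) (hUY : Disjoint U Y)
    {W : Finset V} (hW : W ⊆ insert r D) :
    PathOn G k x f ((U ∪ z.toFinset ∪ insert r Y) \ W) := by
  have hWD : W.erase r ⊆ D := fun u hu =>
    (Finset.mem_insert.1 (hW (Finset.mem_of_mem_erase hu))).resolve_left (Finset.ne_of_mem_erase hu)
  have hb := hpath _ hWD
  have hd1 : Disjoint (U \ W.erase r) z.toFinset := hzU.mono_left Finset.sdiff_subset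
  have hzW : ∀ u ∈ z.toFinset, u ∉ W := fun u hu huW => by
    rcases Finset.mem_insert.1 (hW huW) with rfl | h
    · exact hrz hu
    · exact Finset.disjoint_left.1 hzU (hDU h) hu
  have hYW : ∀ u ∈ Y, u ∉ W := fun u hu huW => by
    rcases Finset.mem_insert.1 (hW huW) with rfl | h
    · exact hrY hu
    · exact Finset.disjoint_left.1 hUY (hDU h) hu
  have e1 : z.toFinset \ W = z.toFinset := Finset.sdiff_eq_self_of_disjoint
    (Finset.disjoint_left.2 hzW)
  have e2 : Y \ W = Y := Finset.sdiff_eq_self_of_disjoint (Finset.disjoint_left.2 hYW)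
  rw [Finset.union_sdiff_distrib, Finset.union_sdiff_distrib, e1]
  by_cases hrW : r ∈ W
  · have := hb.glue hz hzn hP₂ he hq hd1 (hUY.mono_left Finset.sdiff_subset) hzY
    rw [Finset.insert_sdiff_of_mem _ hrW, e2]
    convert this using 3
    ext u
    simp only [Finset.mem_sdiff, Finset.mem_erase]
    exact and_congr_right fun hu =>
      ⟨fun h h' => h h'.2, fun h h' => h ⟨fun h0 => hrU (h0 ▸ hu), h'⟩⟩
  · have := hb.glue hz hzn hP₁ he hq hd1 (by
      rw [Finset.disjoint_insert_right]
      exact ⟨fun h => hrU (Finset.mem_sdiff.1 h).1, hUY.mono_left Finset.sdiff_subset⟩) (by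
      rw [Finset.disjoint_insert_right]
      exact ⟨hrz, hzY⟩)
    rw [Finset.insert_sdiff_of_notMem _ hrW, e2]
    rwa [Finset.erase_eq_of_notMem hrW] at this

/-- An absorber of `r` is found in `As` outside `U`, and its start is connected to the end `e`
through `Cs`. The new end is good because of the absorber, with a constant depending only on `c` and
`Q` and not on how good `e` was; halving it pays for the boundedly many new vertices. Hence `c'`
does not deteriorate and the step can be iterated without limit. -/
theorem Flexible.step {k s M m : ℕ} (hks : k ≤ s) (habs : HasAbsorbers.{u} k s M)
    (hcon : Connects.{u} k s m) {c : ℝ} (hc : 0 < c) (hc1 : c ≤ 1) (Q : ℕ) :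
    ∃ c₁ : ℝ, 0 < c₁ ∧ ∀ c' : ℝ, 0 < c' → c' ≤ c₁ → ∀ᶠ ε in 𝓝[>] (0 : ℝ),
    ∀ {V : Type u} [Fintype V] [DecidableEq V] {G : SimpleGraph V} {p n : ℝ},
    Setup G s ε p n → ∀ (x : List V) (Ts : List (Finset V)) (Ws : Finset (Finset V))
      (D U : Finset V) (e : List V) (r : V) (As Cs : List (Finset V)),
    Flexible G k p n c' x Ts Ws D U e → r ∉ U → (∀ T ∈ Ts, r ∉ T) →
    As.length = M → Cs.length = m → (As ++ Cs).Pairwise Disjoint →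
    (∀ T ∈ As ++ Cs, T ∈ Ts) → (∀ T ∈ Ts, c * n ≤ ((T \ U).card : ℝ)) →
    (∀ T ∈ As, c * p * n ≤ ((nb G r (T \ U)).card : ℝ)) → (∀ S ∈ Ws, c * n ≤ (S.card : ℝ)) →
    Ts.length + Ws.card ≤ Q →
    ∃ (U' : Finset V) (e' : List V), Flexible G k p n c' x Ts Ws (insert r D) U' e' ∧
      U ⊆ U' ∧ (U' \ U).card ≤ M + m + 1 ∧
      ∀ u ∈ U', u ∈ U ∨ u = r ∨ ∃ T ∈ As ++ Cs, u ∈ T := by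
  obtain ⟨c₀, hc₀, H⟩ := habs c hc hc1 Q
  refine ⟨c₀ / 2, by positivity, fun c' hc' hc'1 => ?_⟩
  filter_upwards [H, hcon c' hc', eventually_mul_lt ((M + m + 1 : ℕ) : ℝ) (half_pos hc₀)] with ε h1 h2 h3
  intro V _ _ G p n hS x Ts Ws D U e r As Cs hF hrU hrT hAs hCs hdisj hTs hTU hrA hWs hQ
  have hn := hS.n_pos
  have hp := hS.jumbled.pos
  have hp1 := hS.jumbled.le_one
  set Z : Finset (Finset V) := (Ts.map (· \ U)).toFinset ∪ Ws with hZ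
  have hTZ : ∀ T ∈ Ts, T \ U ∈ Z := fun T hT =>
    Finset.mem_union_left _ (List.mem_toFinset.2 (List.mem_map.2 ⟨T, hT, rfl⟩))
  obtain ⟨q, f, Y, hq, hf, hqa, hfa, hP₁, hP₂, hY, hYc, hgood⟩ := h1 hS r (As.map (· \ U)) Z
    (by simpa using hAs) (by
      rw [List.pairwise_map]
      exact (List.pairwise_append.1 hdisj).1.imp fun hab =>
        hab.mono Finset.sdiff_subset Finset.sdiff_subset) (by
      intro T hT
      obtain ⟨T', hT', rfl⟩ := List.mem_map.1 hT
      exact fun h => hrT T' (hTs T' (List.mem_append_left _ hT')) (Finset.mem_sdiff.1 h).1) (by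
      intro T hT
      obtain ⟨T', hT', rfl⟩ := List.mem_map.1 hT
      exact hrA T' hT') (by
      intro T hT
      obtain ⟨T', hT', rfl⟩ := List.mem_map.1 hT
      exact hTZ T' (hTs T' (List.mem_append_left _ hT'))) (by
      intro S hS'
      rcases Finset.mem_union.1 hS' with hS' | hS'
      · obtain ⟨T', hT', rfl⟩ := List.mem_map.1 (List.mem_toFinset.1 hS')
        exact hTU T' hT'
      · exact hWs S hS') (by
      refine (Finset.card_union_le _ _).trans (le_trans ?_ hQ)
      refine Nat.add_le_add_right ((List.toFinset_card_le _).trans ?_) _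
      simp)
  obtain ⟨z, hz, hzP⟩ := h2 hS e q (Cs.map (· \ U)) hF.length hq hF.adj hqa (by simpa using hCs)
    (by
      intro T hT
      obtain ⟨T', hT', rfl⟩ := List.mem_map.1 hT
      exact hF.good T' (hTs T' (List.mem_append_right _ hT')))
    (by
      intro T hT
      obtain ⟨T', hT', rfl⟩ := List.mem_map.1 hT
      exact (hgood _ (hTZ T' (hTs T' (List.mem_append_right _ hT')))).1.mono hp hn
        (by linarith) subset_rfl)
  have hzn : z.Nodup := by
    refine nodup_of_forall₂_mem hz ?_
    rw [List.pairwise_map]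
    exact (List.pairwise_append.1 hdisj).2.1.imp fun hab =>
        hab.mono Finset.sdiff_subset Finset.sdiff_subset
  have hzC : ∀ u ∈ z, u ∉ U ∧ ∃ T ∈ Cs, u ∈ T := by
    intro u hu
    obtain ⟨T, hT, huT⟩ := forall₂_mem_exists hz hu
    obtain ⟨T', hT', rfl⟩ := List.mem_map.1 hT
    rw [Finset.mem_sdiff] at huT
    exact ⟨huT.2, T', hT', huT.1⟩
  have hYA : ∀ u ∈ Y, u ∉ U ∧ ∃ T ∈ As, u ∈ T := by
    intro u hu
    obtain ⟨T, hT, huT⟩ := hY u hu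
    obtain ⟨T', hT', rfl⟩ := List.mem_map.1 hT
    rw [Finset.mem_sdiff] at huT
    exact ⟨huT.2, T', hT', huT.1⟩
  have hrz : r ∉ z := fun h => by
    obtain ⟨-, T, hT, hrT'⟩ := hzC r h
    exact hrT T (hTs T (List.mem_append_right _ hT)) hrT'
  have hrY : r ∉ Y := fun h => by
    obtain ⟨-, T, hT, hrT'⟩ := hYA r h
    exact hrT T (hTs T (List.mem_append_left _ hT)) hrT'
  have hzY : Disjoint z.toFinset Y := by
    rw [Finset.disjoint_left]
    intro u hu huY
    obtain ⟨-, T, hT, huT⟩ := hzC u (List.mem_toFinset.1 hu)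
    obtain ⟨-, T', hT', huT'⟩ := hYA u huY
    exact Finset.disjoint_left.1 ((List.pairwise_append.1 hdisj).2.2 T' hT' T hT) huT' huT
  have hzU : Disjoint U z.toFinset := by
    rw [Finset.disjoint_right]
    exact fun u hu => (hzC u (List.mem_toFinset.1 hu)).1
  have hUY : Disjoint U Y := by
    rw [Finset.disjoint_right]
    exact fun u hu => (hYA u hu).1
  have hcard : ((U ∪ z.toFinset ∪ insert r Y) \ U).card ≤ M + m + 1 := by
    refine (Finset.card_le_card (t := z.toFinset ∪ insert r Y) ?_).trans ?_
    · intro u hu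
      simp only [Finset.mem_sdiff, Finset.mem_union] at hu ⊢
      tauto
    · refine (Finset.card_union_le _ _).trans ?_
      have e1 := List.toFinset_card_le z
      have e2 := hz.length_eq
      have e3 := Finset.card_insert_le r Y
      simp only [List.length_map] at e2
      omega
  refine ⟨U ∪ z.toFinset ∪ insert r Y, f, ⟨?_, ?_, hf, hfa, ?_, ?_⟩, ?_, hcard, ?_⟩
  · intro u hu
    have := hF.subset
    simp only [Finset.mem_insert, Finset.mem_union] at hu ⊢
    rcases hu with rfl | hu
    · tauto
    · exact .inl (.inl (this hu))
  · exact fun W hW => path_sdiff_step hF.subset hF.path hF.length hq hzP hzn hP₁ hP₂ hrU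
      (fun h => hrz (List.mem_toFinset.1 h)) hrY hzY hzU hUY hW
  · intro T hT
    have h5 := ((hgood _ (hTZ T hT)).2.sdiff (X := (U ∪ z.toFinset ∪ insert r Y) \ U) (k := k) hp hp1 hn
      hc₀ hf.le (by
        refine le_trans ?_ (hS.large_of_lt hks (half_pos hc₀) h3)
        exact_mod_cast hcard)).mono hp hn hc'1 subset_rfl
    convert h5 using 1
    ext u
    simp only [Finset.mem_sdiff, Finset.mem_union]
    tauto
  · intro S hSW
    exact ((hgood S (Finset.mem_union_right _ hSW)).2).mono hp hn (by linarith) subset_rfl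
  · intro u hu; simp [hu]
  · intro u hu
    simp only [Finset.mem_union, Finset.mem_insert, List.mem_toFinset] at hu
    rcases hu with (hu | hu) | rfl | hu
    · exact .inl hu
    · obtain ⟨-, T, hT, huT⟩ := hzC u hu
      exact .inr (.inr ⟨T, List.mem_append_right _ hT, huT⟩)
    · exact .inr (.inl rfl)
    · obtain ⟨-, T, hT, huT⟩ := hYA u hu
      exact .inr (.inr ⟨T, List.mem_append_left _ hT, huT⟩)

end Flexible

section Flexible

theorem exists_maximal_subset {V : Type*} {L D₀ : Finset V} {P : Finset V → Prop}
    (h₀ : D₀ ⊆ L) (hP : P D₀) : ∃ D ⊆ L, P D ∧ ∀ D' ⊆ L, P D' → D'.card ≤ D.card := by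
  classical
  obtain ⟨D, hD, hmax⟩ := Finset.exists_max_image (L.powerset.filter P) Finset.card
    ⟨D₀, by simp [h₀, hP]⟩
  simp only [Finset.mem_filter, Finset.mem_powerset] at hD hmax
  exact ⟨D, hD.1, hD.2, fun D' h1 h2 => hmax D' ⟨h1, h2⟩⟩

theorem card_le_sdiff_add {V : Type*} [DecidableEq V] (A B : Finset V) :
    A.card ≤ (A \ B).card + B.card := by
  refine (Finset.card_le_card (t := A \ B ∪ B) ?_).trans (Finset.card_union_le _ _)
  intro v hv
  simp only [Finset.mem_union, Finset.mem_sdiff]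
  tauto

theorem PathOn.self {V : Type*} [DecidableEq V] {G : SimpleGraph V} {k : ℕ} {x : List V}
    (h : x.Pairwise G.Adj) : PathOn G k x x x.toFinset :=
  .of_kpath (.of_pairwise h) (h.imp fun hab => hab.ne) rfl

/-- The vertices of `L` with few neighbours in one of the sets of `As` are few. -/
theorem Setup.few_bad {V : Type*} [Fintype V] {G : SimpleGraph V} {s : ℕ} {ε p n c : ℝ}
    (hS : Setup G s ε p n) (hs : 1 ≤ s) (hc : 0 < c) (As : List (Finset V)) (X : Finset V)
    (hAs : ∀ T ∈ As, c * n ≤ (T.card : ℝ))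
    (hX : ∀ v ∈ X, ∃ T ∈ As, ((nb G v T).card : ℝ) ≤ p / 2 * T.card) :
    c * X.card ≤ As.length * (4 * ε) * (p * n) := by
  classical
  have hn := hS.n_pos
  have hp := hS.jumbled.pos
  have hp1 := hS.jumbled.le_one
  have hε := hS.eps_pos
  have h1 : X ⊆ As.toFinset.biUnion fun T =>
      X.filter fun v => ((nb G v T).card : ℝ) ≤ p / 2 * T.card := by
    intro v hv
    obtain ⟨T, hT, h⟩ := hX v hv
    exact Finset.mem_biUnion.2 ⟨T, List.mem_toFinset.2 hT, Finset.mem_filter.2 ⟨hv, h⟩⟩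
  have h2 : (X.card : ℝ) ≤ ∑ T ∈ As.toFinset,
      ((X.filter fun v => ((nb G v T).card : ℝ) ≤ p / 2 * T.card).card : ℝ) := by
    exact_mod_cast (Finset.card_le_card h1).trans Finset.card_biUnion_le
  have h3 : ∀ T ∈ As.toFinset,
      ((X.filter fun v => ((nb G v T).card : ℝ) ≤ p / 2 * T.card).card : ℝ) ≤
        4 * ε * (p * n) / c := by
    intro T hT
    have h4 := hS.jumbled.few_low (Y := T)
      (X := X.filter fun v => ((nb G v T).card : ℝ) ≤ p / 2 * T.card)
      fun v hv => (Finset.mem_filter.1 hv).2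
    have h5 := hAs T (List.mem_toFinset.1 hT)
    rw [le_div_iff₀ hc]
    refine le_of_mul_le_mul_right ?_ hn
    have hps : p ^ s ≤ p := by
      calc p ^ s ≤ p ^ 1 := pow_le_pow_of_le_one hp.le hp1 hs
        _ = p := pow_one p
    calc _ = ((X.filter fun v => ((nb G v T).card : ℝ) ≤ p / 2 * T.card).card : ℝ) *
          (c * n) := by ring
      _ ≤ _ := by gcongr
      _ ≤ _ := h4
      _ ≤ 4 * (ε * (p * n ^ 2)) := by gcongr
      _ = _ := by ring
  have h4 := h2.trans (Finset.sum_le_sum h3)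
  rw [Finset.sum_const, nsmul_eq_mul] at h4
  have h5 : (As.toFinset.card : ℝ) ≤ As.length := by exact_mod_cast List.toFinset_card_le As
  calc c * (X.card : ℝ) ≤ c * (As.length * (4 * ε * (p * n) / c)) := by
        refine mul_le_mul_of_nonneg_left (h4.trans ?_) hc.le
        gcongr
    _ = _ := by field_simp

/-- All vertices of a small set can be absorbed. -/
theorem Flexible.absorb {k s M m : ℕ} (hks : k ≤ s) (hs : 1 ≤ s)
    (habs : HasAbsorbers.{u} k s M) (hcon : Connects.{u} k s m) {c : ℝ} (hc : 0 < c)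
    (hc1 : c ≤ 1) (Q : ℕ) :
    ∃ c₁ : ℝ, 0 < c₁ ∧ ∀ c' : ℝ, 0 < c' → c' ≤ c₁ → ∀ᶠ ε in 𝓝[>] (0 : ℝ),
    ∀ {V : Type u} [Fintype V] [DecidableEq V] {G : SimpleGraph V} {p n : ℝ},
    Setup G s ε p n → ∀ (x : List V) (As Cs As' Cs' : List (Finset V)) (Ws : Finset (Finset V))
      (L : Finset V), x.length = k → x.Pairwise G.Adj → As.length = M → Cs.length = m →
    As'.length = M → Cs'.length = m → (As ++ Cs ++ (As' ++ Cs')).Pairwise Disjoint →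
    (∀ T ∈ As ++ Cs ++ (As' ++ Cs'), Disjoint T x.toFinset ∧ Disjoint T L ∧
      k + (M + m + 1 : ℕ) * (L.card : ℝ) + 2 * c * n ≤ (T.card : ℝ) ∧ Good G p n c' x T) → Disjoint L x.toFinset →
    (∀ S ∈ Ws, c * n ≤ (S.card : ℝ) ∧ Good G p n c' x S) →
    (∀ r ∈ L, ∀ T ∈ As', 2 * c * p * n ≤ ((nb G r T).card : ℝ)) →
    (As ++ Cs ++ (As' ++ Cs')).length + Ws.card ≤ Q →
    ∃ (U : Finset V) (e : List V),
      Flexible G k p n c' x (As ++ Cs ++ (As' ++ Cs')) Ws L U e ∧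
      ∀ u ∈ U, u ∈ x ∨ u ∈ L ∨ ∃ T ∈ As ++ Cs ++ (As' ++ Cs'), u ∈ T := by
  obtain ⟨c₁, hc₁, H⟩ := Flexible.step hks habs hcon hc hc1 Q
  refine ⟨c₁, hc₁, fun c' hc' hcc' => ?_⟩
  filter_upwards [H c' hc' hcc', eventually_mul_lt ((M + m + 1 : ℕ) * (M * 4))
    (A := c * c) (by positivity)] with ε h1 h2
  intro V _ _ G p n hS x As Cs As' Cs' Ws L hx hxa hAs hCs hAs' hCs' hdisj hTs hLx hWs hrA hQ
  have hn := hS.n_pos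
  have hp := hS.jumbled.pos
  have hp1 := hS.jumbled.le_one
  set Ts := As ++ Cs ++ (As' ++ Cs') with hTs_def
  set C₁ := M + m + 1 with hC₁
  obtain ⟨hd1, hd2, hd3⟩ := List.pairwise_append.1 hdisj
  have hbig : ∀ (D U : Finset V), D ⊆ L → U.card ≤ k + C₁ * D.card → ∀ T ∈ Ts,
      2 * c * n ≤ ((T \ U).card : ℝ) := by
    intro D U hD hU T hT
    have e1 : (T.card : ℝ) ≤ (T \ U).card + U.card := by exact_mod_cast card_le_sdiff_add T U
    have e2 : (U.card : ℝ) ≤ k + C₁ * D.card := by exact_mod_cast hU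
    have e3 : (C₁ : ℝ) * D.card ≤ C₁ * L.card := by
      have : (D.card : ℝ) ≤ L.card := Nat.cast_le.2 (Finset.card_le_card hD)
      gcongr
    have := (hTs T hT).2.2.1
    linarith
  have hcbig : c * n ≤ 2 * c * n := by have : 0 < c * n := by positivity
                                       linarith
  -- absorption through the first two families of sets
  set P₁ : Finset V → Prop := fun D => ∃ (U : Finset V) (e : List V),
    Flexible G k p n c' x Ts Ws D U e ∧ U.card ≤ k + C₁ * D.card ∧
    ∀ u ∈ U, u ∈ x ∨ u ∈ D ∨ ∃ T ∈ As ++ Cs, u ∈ T with hP₁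
  obtain ⟨D₁, hD₁L, ⟨U₁, e₁, hF₁, hU₁c, hU₁⟩, hmax₁⟩ :=
    exists_maximal_subset (L := L) (D₀ := ∅) (P := P₁) (by simp)
      ⟨x.toFinset, x, ⟨by simp, by
        intro W hW
        rw [Finset.subset_empty.1 hW, Finset.sdiff_empty]
        exact .self hxa, hx, hxa, by
        intro T hT
        rw [Finset.sdiff_eq_self_of_disjoint (hTs T hT).1]
        exact (hTs T hT).2.2.2, fun S hS' => (hWs S hS').2⟩, by
        have := List.toFinset_card_le x
        simp; omega, fun u hu => .inl (List.mem_toFinset.1 hu)⟩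
  have hnot : ∀ (D U : Finset V), (∀ u ∈ U, u ∈ x ∨ u ∈ D ∨ ∃ T ∈ Ts, u ∈ T) →
      ∀ r ∈ L, r ∉ D → r ∉ U ∧ ∀ T ∈ Ts, r ∉ T := by
    intro D U hU r hr hrD
    have e1 : ∀ T ∈ Ts, r ∉ T := fun T hT hrT =>
      Finset.disjoint_left.1 (hTs T hT).2.1 hrT hr
    refine ⟨fun hrU => ?_, e1⟩
    rcases hU r hrU with h | h | ⟨T, hT, h⟩
    · exact Finset.disjoint_left.1 hLx hr (List.mem_toFinset.2 h)
    · exact hrD h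
    · exact e1 T hT h
  have hU₁' : ∀ u ∈ U₁, u ∈ x ∨ u ∈ D₁ ∨ ∃ T ∈ Ts, u ∈ T := by
    intro u hu
    rcases hU₁ u hu with h | h | ⟨T, hT, h⟩
    · exact .inl h
    · exact .inr (.inl h)
    · exact .inr (.inr ⟨T, List.mem_append_left _ hT, h⟩)
  -- By maximality a vertex that was not absorbed must have low degree into what is left of some set
  -- of `As`, as otherwise `Flexible.step` would apply. By `Setup.few_bad` there are few such
  -- vertices.
  have hbad : ∀ r ∈ L \ D₁, ∃ T ∈ As.map (· \ U₁), ((nb G r T).card : ℝ) ≤ p / 2 * T.card := by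
    intro r hr
    obtain ⟨hrL, hrD⟩ := Finset.mem_sdiff.1 hr
    by_contra hcon
    push Not at hcon
    obtain ⟨hrU, hrT⟩ := hnot D₁ U₁ hU₁' r hrL hrD
    obtain ⟨U', e', hF', hUU', hc'', hU'⟩ := h1 hS x Ts Ws D₁ U₁ e₁ r As Cs hF₁ hrU hrT hAs hCs hd1
      (fun T hT => List.mem_append_left _ hT)
      (fun T hT => hcbig.trans (hbig D₁ U₁ hD₁L hU₁c T hT)) (by
        intro T hT
        have e1 := hcon (T \ U₁) (List.mem_map.2 ⟨T, hT, rfl⟩)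
        have e2 := hbig D₁ U₁ hD₁L hU₁c T (List.mem_append_left _ (List.mem_append_left _ hT))
        refine le_trans ?_ e1.le
        calc c * p * n = p / 2 * (2 * c * n) := by ring
          _ ≤ _ := by gcongr) (fun S hS' => (hWs S hS').1) hQ
    have := hmax₁ (insert r D₁) (Finset.insert_subset hrL hD₁L) ⟨U', e', hF', by
      rw [Finset.card_insert_of_notMem hrD, mul_add]
      have := card_le_sdiff_add U' U₁
      omega, fun u hu => by
      rcases hU' u hu with h | rfl | h
      · rcases hU₁ u h with h | h | h
        · exact .inl h
        · exact .inr (.inl (Finset.mem_insert_of_mem h))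
        · exact .inr (.inr h)
      · exact .inr (.inl (Finset.mem_insert_self _ _))
      · exact .inr (.inr h)⟩
    rw [Finset.card_insert_of_notMem hrD] at this
    omega
  have hfew := hS.few_bad hs hc (As.map (· \ U₁)) (L \ D₁) (by
    intro T hT
    obtain ⟨T', hT', rfl⟩ := List.mem_map.1 hT
    exact hcbig.trans (hbig D₁ U₁ hD₁L hU₁c T' (List.mem_append_left _
      (List.mem_append_left _ hT')))) hbad
  rw [List.length_map, hAs] at hfew
  have hfew' : (C₁ : ℝ) * (L \ D₁).card ≤ c * p * n := by
    refine le_of_mul_le_mul_left ?_ hc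
    calc c * ((C₁ : ℝ) * (L \ D₁).card) = C₁ * (c * (L \ D₁).card) := by ring
      _ ≤ C₁ * (M * (4 * ε) * (p * n)) := by gcongr
      _ = C₁ * (M * 4) * ε * (p * n) := by ring
      _ ≤ c * c * (p * n) := by gcongr
      _ = _ := by ring
  -- absorption through the last two families of sets
  set P₂ : Finset V → Prop := fun D => D₁ ⊆ D ∧ ∃ (U : Finset V) (e : List V),
    Flexible G k p n c' x Ts Ws D U e ∧ U.card ≤ k + C₁ * D.card ∧
    (U \ U₁).card + C₁ * D₁.card ≤ C₁ * D.card ∧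
    ∀ u ∈ U, u ∈ x ∨ u ∈ D ∨ ∃ T ∈ Ts, u ∈ T with hP₂
  obtain ⟨D, hDL, ⟨hD₁D, U, e, hF, hUc, hUU₁, hU⟩, hmax⟩ :=
    exists_maximal_subset (L := L) (D₀ := D₁) (P := P₂) hD₁L
      ⟨subset_rfl, U₁, e₁, hF₁, hU₁c, by simp, hU₁'⟩
  -- The second round never gets stuck. The sets of `As'` are disjoint from `U₁`, and absorbing the
  -- remaining vertices uses at most `C₁|L \ D₁| ≤ cpn` vertices, so at least half of the `2cpn`
  -- neighbours of `r` in each set of `As'` stay free.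
  have hDeq : D = L := by
    refine subset_antisymm hDL fun r hrL => ?_
    by_contra hrD
    obtain ⟨hrU, hrT⟩ := hnot D U hU r hrL hrD
    obtain ⟨U', e', hF', hUU', hc'', hU'⟩ := h1 hS x Ts Ws D U e r As' Cs' hF hrU hrT hAs' hCs' hd2
      (fun T hT => List.mem_append_right _ hT)
      (fun T hT => hcbig.trans (hbig D U hDL hUc T hT)) (by
        intro T hT
        have hTd : ∀ u ∈ T, u ∉ U₁ := by
          intro u hu huU
          have hTT : T ∈ Ts := List.mem_append_right _ (List.mem_append_left _ hT)
          rcases hU₁ u huU with h | h | ⟨T', hT', h⟩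
          · exact Finset.disjoint_left.1 (hTs T hTT).1 hu (List.mem_toFinset.2 h)
          · exact Finset.disjoint_left.1 (hTs T hTT).2.1 hu (hD₁L h)
          · exact Finset.disjoint_left.1 (hd3 T' hT' T (List.mem_append_left _ hT)) h hu
        have e1 : nb G r T ⊆ nb G r (T \ U) ∪ (U \ U₁) := by
          intro u hu
          have := hTd u (mem_nb.1 hu).1
          simp only [mem_nb, Finset.mem_union, Finset.mem_sdiff] at hu ⊢
          tauto
        have e2 : ((nb G r T).card : ℝ) ≤ (nb G r (T \ U)).card + (U \ U₁).card := by
          exact_mod_cast (Finset.card_le_card e1).trans (Finset.card_union_le _ _)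
        have e3 := hrA r hrL T hT
        have e4 : (U \ U₁).card ≤ C₁ * (L \ D₁).card := by
          have e5 : D.card ≤ (L \ D₁).card + D₁.card :=
            (Finset.card_le_card hDL).trans (card_le_sdiff_add L D₁)
          have e6 := Nat.mul_le_mul_left C₁ e5
          rw [mul_add] at e6
          omega
        have e7 : ((U \ U₁).card : ℝ) ≤ C₁ * (L \ D₁).card := by exact_mod_cast e4
        linarith) (fun S hS' => (hWs S hS').1) hQ
    have := hmax (insert r D) (Finset.insert_subset hrL hDL) ⟨hD₁D.trans (Finset.subset_insert _ _),
      U', e', hF', by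
      rw [Finset.card_insert_of_notMem hrD, mul_add]
      have := card_le_sdiff_add U' U
      omega, by
      rw [Finset.card_insert_of_notMem hrD, mul_add]
      have e1 : (U' \ U₁).card ≤ (U' \ U).card + (U \ U₁).card := by
        refine (Finset.card_le_card (t := U' \ U ∪ U \ U₁) ?_).trans (Finset.card_union_le _ _)
        intro u hu
        simp only [Finset.mem_sdiff, Finset.mem_union] at hu ⊢
        tauto
      omega, fun u hu => by
      rcases hU' u hu with h | rfl | ⟨T, hT, h⟩
      · rcases hU u h with h | h | h
        · exact .inl h
        · exact .inr (.inl (Finset.mem_insert_of_mem h))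
        · exact .inr (.inr h)
      · exact .inr (.inl (Finset.mem_insert_self _ _))
      · exact .inr (.inr ⟨T, List.mem_append_right _ hT, h⟩)⟩
    rw [Finset.card_insert_of_notMem hrD] at this
    omega
  subst hDeq
  exact ⟨U, e, hF, hU⟩

end Flexible

/-! ### Assembling the closed Hamilton `k`-path. -/

section Assembly

theorem PathOn.extend {V : Type*} [DecidableEq V] {G : SimpleGraph V} {k : ℕ} {x e e' : List V}
    {U : Finset V} (h : PathOn G k x e U) (he : e.length = k) (h' : KPath G k (e ++ e'))
    (hn : e'.Nodup) (hU : Disjoint U e'.toFinset) : PathOn G k x e' (U ∪ e'.toFinset) := by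
  obtain ⟨P, hP, hPn, rfl, hxP, A, rfl⟩ := h
  refine ⟨A ++ e ++ e', hP.glue h' he.ge, ?_, by simp only [List.toFinset_append],
    hxP.trans (List.prefix_append _ _), List.suffix_append _ _⟩
  rw [List.nodup_append]
  refine ⟨hPn, hn, fun a ha b hb hab => ?_⟩
  subst hab
  exact Finset.disjoint_left.1 hU (List.mem_toFinset.2 ha) (List.mem_toFinset.2 hb)

theorem PathOn.trans {V : Type*} [DecidableEq V] {G : SimpleGraph V} {k : ℕ} {x e f : List V}
    {U U' : Finset V} (h : PathOn G k x e U) (h' : PathOn G k e f U') (he : e.length = k)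
    (hU : U ∩ U' ⊆ e.toFinset) : PathOn G k x f (U ∪ U') := by
  obtain ⟨P, hP, hPn, rfl, hxP, A, rfl⟩ := h
  obtain ⟨P', hP', hPn', rfl, ⟨B, rfl⟩, hfP⟩ := h'
  refine ⟨A ++ e ++ B, hP.glue hP' he.ge, ?_, ?_, hxP.trans (List.prefix_append _ _), ?_⟩
  · rw [List.nodup_append]
    refine ⟨hPn, (List.nodup_append.1 hPn').2.1, fun a ha b hb hab => ?_⟩
    subst hab
    have h1 : a ∈ e := List.mem_toFinset.1 (hU (Finset.mem_inter.2
      ⟨List.mem_toFinset.2 ha, List.mem_toFinset.2 (List.mem_append_right _ hb)⟩))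
    exact (List.nodup_append.1 hPn').2.2 a h1 a hb rfl
  · ext; simp only [List.toFinset_append, Finset.mem_union]; tauto
  · refine hfP.trans ⟨A, by simp⟩

theorem PathOn.end_subset {V : Type*} [DecidableEq V] {G : SimpleGraph V} {k : ℕ} {x e : List V}
    {U : Finset V} (h : PathOn G k x e U) : e.toFinset ⊆ U := by
  obtain ⟨P, -, -, rfl, -, h⟩ := h
  intro u hu
  rw [List.mem_toFinset] at hu ⊢
  exact h.subset hu

/-- A clique of size `k` inside `B`, joined to `e`, with many common neighbours in given sets. -/
theorem exists_batch {k s : ℕ} (hks : 2 * k ≤ s + 1) {c c' : ℝ} (hc : 0 < c) (hc' : 0 < c')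
    (Q : ℕ) : ∀ᶠ ε in 𝓝[>] (0 : ℝ),
    ∀ {V : Type u} [Fintype V] [DecidableEq V] {G : SimpleGraph V} {p n : ℝ},
    Setup G s ε p n → ∀ (e : List V) (B : Finset V) (Y : Finset (Finset V)), e.length ≤ k →
    B ∈ Y → Y.card ≤ Q → (∀ S ∈ Y, c * n ≤ (S.card : ℝ)) → (∀ S ∈ Y, Good G p n c' e S) →
    ∃ e' : List V, e'.length = k ∧ (∀ u ∈ e', u ∈ B) ∧ e'.Pairwise G.Adj ∧ Cross G e e' ∧
      ∀ S ∈ Y, Good G p n (c / 2 ^ k) e' S := by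
  filter_upwards [eventually_mul_lt (4 * (Q * 2 ^ k * 2 ^ k)) (A := c' * c' / 2 ^ (2 * k - 1))
    (by positivity)] with ε hε
  intro V _ _ G p n hS e B Y he hB hQ hY hg
  have hn := hS.n_pos
  have hp := hS.jumbled.pos
  have hp1 := hS.jumbled.le_one
  have hκ := hS.jumbled.nonneg
  obtain ⟨e', h1, h2, h3, h4⟩ := hS.jumbled.greedy (List.replicate k B) e Y (c' * n) (2 * k - 1)
    (fun B' hB' => by rw [(List.mem_replicate.1 hB').2]; exact hB) (by positivity)
    (fun W hW S hS' => by
      have := hg S hS' W hW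
      linarith) (by omega) (by simp; omega) (fun _ => by
      have h5 := size_cond (s := s) (t := 2 * k - 1) (α := 0) (β := 0) (a := c' * n) (b := c' * n)
        (2 * k - 1) hp hp1 hn hc' hc' (by simp) (by simp) (by omega) le_rfl hε
      refine lt_of_le_of_lt ?_ (h5.trans_eq (by ring))
      rw [List.length_replicate]
      have h6 : (2 : ℝ) ^ e.length ≤ 2 ^ k := pow_le_pow_right₀ (by norm_num) he
      have h7 : (Y.card : ℝ) ≤ Q := by exact_mod_cast hQ
      gcongr)
  have hlen : e'.length = k := by simpa using h1.length_eq
  refine ⟨e', hlen, fun u hu => ?_, h2, h3, fun S hS' =>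
    good_of_half hp hc hn hlen.le (hY S hS') fun W hW => h4 W hW S hS'⟩
  obtain ⟨T, hT, huT⟩ := forall₂_mem_exists h1 hu
  rwa [(List.mem_replicate.1 hT).2] at huT

/-- A flexible path can be prolonged until it covers almost all vertices. -/
theorem Flexible.greedy {k s : ℕ} (hk : 1 ≤ k) (hks : 2 * k ≤ s + 1) {c c' : ℝ} (hc : 0 < c)
    (hc' : 0 < c') (hcc' : c' ≤ c / 2 ^ k / 2) (Q : ℕ) : ∀ᶠ ε in 𝓝[>] (0 : ℝ),
    ∀ {V : Type u} [Fintype V] [DecidableEq V] {G : SimpleGraph V} {p n : ℝ},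
    Setup G s ε p n → ∀ (x : List V) (Ws : Finset (Finset V)) (D U : Finset V) (e : List V),
    Flexible G k p n c' x [Finset.univ] Ws D U e → Ws.card + 1 ≤ Q →
    (∀ S ∈ Ws, c * n ≤ (S.card : ℝ)) →
    ∃ U' e', Flexible G k p n c' x [Finset.univ] Ws D U' e' ∧
      (((Finset.univ \ U').card : ℕ) : ℝ) ≤ c * n := by
  have hck : 0 < c / 2 ^ k := by positivity
  filter_upwards [exists_batch.{u} hks hc hc' Q, eventually_mul_lt (k : ℝ) (half_pos hck)]
    with ε h1 h2
  intro V _ _ G p n hS x Ws D U e hF hQ hWs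
  have hn := hS.n_pos
  have hp := hS.jumbled.pos
  have hp1 := hS.jumbled.le_one
  obtain ⟨U', -, ⟨e', hF'⟩, hmax⟩ := exists_maximal_subset (L := Finset.univ) (D₀ := U)
    (P := fun U => ∃ e, Flexible G k p n c' x [Finset.univ] Ws D U e) (Finset.subset_univ _) ⟨e, hF⟩
  refine ⟨U', e', hF', ?_⟩
  by_contra hcon
  push Not at hcon
  -- While more than `cn` vertices are uncovered, a `k`-clique among them can be appended, contrary
  -- to maximality. Its goodness again does not depend on that of the previous end.
  obtain ⟨f, hf, hfB, hfa, hfc, hfg⟩ := h1 hS e' (Finset.univ \ U') (insert (Finset.univ \ U') Ws)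
    hF'.length.le (Finset.mem_insert_self _ _) ((Finset.card_insert_le _ _).trans hQ) (by
      intro S hS'
      rcases Finset.mem_insert.1 hS' with rfl | hS'
      · exact hcon.le
      · exact hWs S hS') (by
      intro S hS'
      rcases Finset.mem_insert.1 hS' with rfl | hS'
      · exact hF'.good _ (by simp)
      · exact hF'.watch S hS')
  have hUf : Disjoint U' f.toFinset := by
    rw [Finset.disjoint_right]
    exact fun u hu => (Finset.mem_sdiff.1 (hfB u (List.mem_toFinset.1 hu))).2
  have hfn : f.Nodup := hfa.imp fun hab => hab.ne
  have hfcard : f.toFinset.card = k := by rw [List.toFinset_card_of_nodup hfn, hf]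
  have := hmax (U' ∪ f.toFinset) (Finset.subset_univ _) ⟨f, ?_, ?_, hf, hfa, ?_, ?_⟩
  · rw [Finset.card_union_of_disjoint hUf] at this
    omega
  · exact hF'.subset.trans Finset.subset_union_left
  · intro W hW
    have h5 : Disjoint f.toFinset W := Disjoint.mono_right (hW.trans hF'.subset) hUf.symm
    have := (hF'.path W hW).extend hF'.length (.of_cross hF'.adj hfa hfc (.inl hF'.length)) hfn
      (hUf.mono_left Finset.sdiff_subset)
    rwa [Finset.union_sdiff_distrib, Finset.sdiff_eq_self_of_disjoint h5]
  · intro T hT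
    obtain rfl : T = Finset.univ := by simpa using hT
    have h5 := ((hfg _ (Finset.mem_insert_self _ _)).sdiff (X := f.toFinset) (k := k) hp hp1 hn hck
      hf.le (by rw [hfcard]; exact hS.large_of_lt (by omega) (half_pos hck) h2)).mono hp hn hcc'
      subset_rfl
    rwa [sdiff_sdiff_left, Finset.sup_eq_union] at h5
  · intro S hS'
    exact (hfg S (Finset.mem_insert_of_mem hS')).mono hp hn (by linarith) subset_rfl

/-- A Hamilton `k`-path that closes up, from families of sets with large minimum degrees. -/
theorem exists_closed_path {k s M m : ℕ} (hk : 1 ≤ k) (hks : 2 * k ≤ s + 1)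
    (hm : 1 ≤ m) (habs : HasAbsorbers.{u} k s M) (hcon : Connects.{u} k s m) {α β ρ : ℝ} (hα : 0 < α)
    (hα1 : α ≤ 1) (hβ : 0 < β) (hρ : (M + m + 1 : ℕ) * ρ ≤ α / 4) :
    ∀ᶠ ε in 𝓝[>] (0 : ℝ),
    ∀ {V : Type u} [Fintype V] [DecidableEq V] {G : SimpleGraph V} {p n : ℝ},
    Setup G s ε p n → ∀ (As Cs As' Cs' Bs Ds Bs' Ds' Es : List (Finset V)) (R : Finset V),
    As.length = M → Cs.length = m → As'.length = M → Cs'.length = m →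
    Bs.length = M → Ds.length = m → Bs'.length = M → Ds'.length = m → Es.length = m →
    (As ++ Cs ++ (As' ++ Cs')).Pairwise Disjoint →
    (Bs ++ Ds ++ (Bs' ++ Ds') ++ Es).Pairwise Disjoint →
    (∀ T ∈ As ++ Cs ++ (As' ++ Cs'), Disjoint T R ∧ α * n ≤ (T.card : ℝ) ∧
      ∀ v, α * p * n ≤ ((nb G v T).card : ℝ)) →
    (∀ T ∈ Bs ++ Ds ++ (Bs' ++ Ds') ++ Es, T ⊆ R ∧ β * n ≤ (T.card : ℝ) ∧
      ∀ v, β * p * n ≤ ((nb G v T).card : ℝ)) →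
    (R.card : ℝ) ≤ ρ * n →
    ∃ l x : List V, l.Nodup ∧ (∀ v, v ∈ l) ∧ x.length = k ∧ x <+: l ∧ KPath G k (l ++ x) := by
  obtain ⟨C₁, hC₁⟩ : ∃ C₁ : ℝ, C₁ = ((M + m + 1 : ℕ) : ℝ) := ⟨_, rfl⟩
  rw [← hC₁] at hρ
  have hC₁1 : 1 ≤ C₁ := by
    rw [hC₁]
    exact_mod_cast Nat.le_add_left 1 (M + m)
  obtain ⟨c, hc, hcα, hcβ⟩ : ∃ c : ℝ, 0 < c ∧ c ≤ α / 16 ∧ c ≤ β / 4 :=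
    ⟨min (α / 16) (β / 4), lt_min (by positivity) (by positivity), min_le_left _ _,
      min_le_right _ _⟩
  -- `ζ` bounds the fraction left over by the greedy path. Absorbing the leftover takes about `C₁ζn`
  -- vertices, which must fit into sets of size `βn` in the reservoir.
  set ζ := min c (β / 4 / C₁) with hζ
  have hζ0 : 0 < ζ := lt_min hc (by positivity)
  have hζc : ζ ≤ c := min_le_left _ _
  have hζβ : C₁ * ζ ≤ β / 4 := by
    have : ζ ≤ β / 4 / C₁ := min_le_right _ _
    rw [le_div_iff₀ (by positivity)] at this
    linarith
  obtain ⟨c₁, hc₁, H⟩ := Flexible.absorb.{u} (k := k) (s := s) (by omega) (by omega) habs hcon hc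
    (by linarith) (2 * (M + m) + (2 * (M + m) + m))
  obtain ⟨c', hc', hc'1, hc'2⟩ : ∃ c' : ℝ, 0 < c' ∧ c' ≤ c₁ ∧ c' ≤ ζ / 2 ^ k / 2 :=
    ⟨min c₁ (ζ / 2 ^ k / 2), lt_min hc₁ (by positivity), min_le_left _ _, min_le_right _ _⟩
  set Q := 2 * (M + m) + (2 * (M + m) + m) + 1 with hQdef
  filter_upwards [H c' hc' hc'1, Flexible.greedy.{u} hk hks hζ0 hc' hc'2 Q,
    exists_batch.{u} hks hζ0 (show 0 < ζ by positivity) Q, hcon c' hc',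
    eventually_mul_lt (k : ℝ) (show 0 < ζ / 2 ^ k / 2 by positivity),
    eventually_mul_lt (k : ℝ) (show 0 < α / 16 by positivity),
    eventually_mul_lt (k : ℝ) (show 0 < β / 4 by positivity)] with ε h1 h2 h3 h4 h5 h6 h7
  intro V _ _ G p n hS As Cs As' Cs' Bs Ds Bs' Ds' Es R hAs hCs hAs' hCs' hBs hDs hBs' hDs' hEs
    hTd hRd hT hR hRc
  have hn := hS.n_pos
  have hp := hS.jumbled.pos
  have hp1 := hS.jumbled.le_one
  set Ts := As ++ Cs ++ (As' ++ Cs') with hTs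
  set Rs := Bs ++ Ds ++ (Bs' ++ Ds') ++ Es with hRs
  have hTl : Ts.length = 2 * (M + m) := by simp [hTs, hAs, hCs, hAs', hCs']; ring
  have hRl : Rs.length = 2 * (M + m) + m := by
    simp [hRs, hBs, hDs, hBs', hDs', hEs]; ring
  have hkn : ∀ γ : ℝ, 0 < γ → (k : ℝ) * ε < γ → (k : ℝ) ≤ γ * p * n := by
    intro γ hγ h
    have e1 := hS.large_of_lt (k := 1) (s := s) (by omega) hγ h
    rwa [pow_one] at e1
  have hpn : p * n ≤ n := by nlinarith
  have hk6 := hkn _ (by positivity) h6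
  have hk7 := hkn _ (by positivity) h7
  have hk6' : (k : ℝ) ≤ α / 16 * n := hk6.trans (by rw [mul_assoc]; gcongr)
  have hk7' : (k : ℝ) ≤ β / 4 * n := hk7.trans (by rw [mul_assoc]; gcongr)
  have hcαn : c * n ≤ α / 16 * n := by gcongr
  have hcβn : c * n ≤ β / 4 * n := by gcongr
  have hcαpn : c * p * n ≤ α / 16 * p * n := by gcongr
  have hcβpn : c * p * n ≤ β / 4 * p * n := by gcongr
  have hζn : ζ * n ≤ c * n := by gcongr
  have hαn : 0 < α * n := by positivity
  have hβn : 0 < β * n := by positivity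
  have hαpn : 0 < α * p * n := by positivity
  have hβpn : 0 < β * p * n := by positivity
  have hcn : 0 < c * n := by positivity
  -- the initial clique
  have hYs : ∀ S ∈ insert (Finset.univ \ R) (Ts.toFinset ∪ Rs.toFinset),
      ζ * n ≤ (S.card : ℝ) := by
    intro S hS'
    rcases Finset.mem_insert.1 hS' with rfl | hS'
    · have e1 : ((Finset.univ : Finset V).card : ℝ) ≤ (Finset.univ \ R).card + R.card := by
        exact_mod_cast card_le_sdiff_add Finset.univ R
      rw [Finset.card_univ, hS.card] at e1
      have e2 : ρ ≤ 1 / 4 := by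
        by_contra hcon
        push Not at hcon
        nlinarith
      have e3 : ρ * n ≤ 1 / 4 * n := by gcongr
      have e4 : α / 16 * n ≤ 1 / 16 * n := by gcongr
      linarith
    · rcases Finset.mem_union.1 hS' with hS' | hS'
      · have := (hT S (List.mem_toFinset.1 hS')).2.1
        linarith
      · have := (hR S (List.mem_toFinset.1 hS')).2.1
        linarith
  obtain ⟨x, hx, hxB, hxa, -, hxg⟩ := h3 hS [] (Finset.univ \ R)
    (insert (Finset.univ \ R) (Ts.toFinset ∪ Rs.toFinset)) (by simp) (Finset.mem_insert_self _ _)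
    (by
      refine (Finset.card_insert_le _ _).trans (Nat.add_le_add_right
        ((Finset.card_union_le _ _).trans (Nat.add_le_add ?_ ?_)) 1)
      · exact hTl ▸ List.toFinset_card_le Ts
      · exact hRl ▸ List.toFinset_card_le Rs) hYs (by
      intro S hS' W hW
      obtain rfl : W = ∅ := by simpa using hW
      simpa using hYs S hS')
  have hζk : 0 < ζ / 2 ^ k := by positivity
  have hxT : ∀ T ∈ Ts, Good G p n (ζ / 2 ^ k) x T := fun T h => hxg T
    (Finset.mem_insert_of_mem (Finset.mem_union_left _ (List.mem_toFinset.2 h)))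
  have hxR : ∀ T ∈ Rs, Good G p n c' x T := fun T h => (hxg T
    (Finset.mem_insert_of_mem (Finset.mem_union_right _ (List.mem_toFinset.2 h)))).mono hp hn
    (by linarith) subset_rfl
  have hxRd : Disjoint R x.toFinset := by
    rw [Finset.disjoint_right]
    exact fun u hu => (Finset.mem_sdiff.1 (hxB u (List.mem_toFinset.1 hu))).2
  have hxk : (x.toFinset.card : ℝ) ≤ k := by
    exact_mod_cast (List.toFinset_card_le x).trans hx.le
  set f : Finset V → Finset V := fun T => T \ x.toFinset with hf
  -- absorbing `R`
  obtain ⟨U₁, e₁, hF₁, -⟩ := h1 hS x (As.map f) (Cs.map f) (As'.map f) (Cs'.map f) Rs.toFinset R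
    hx hxa (by simpa) (by simpa) (by simpa) (by simpa) (by
      simp only [← List.map_append]
      rw [List.pairwise_map]
      exact hTd.imp fun hab => hab.mono Finset.sdiff_subset Finset.sdiff_subset) (by
      simp only [← List.map_append]
      intro T hTm
      obtain ⟨T', hT', rfl⟩ := List.mem_map.1 hTm
      refine ⟨Finset.sdiff_disjoint, (hT T' hT').1.mono_left Finset.sdiff_subset, ?_, ?_⟩
      · have e1 : (T'.card : ℝ) ≤ (f T').card + x.toFinset.card := by
          exact_mod_cast card_le_sdiff_add T' x.toFinset
        have e2 := (hT T' hT').2.1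
        have e3 : C₁ * R.card ≤ α / 4 * n := by
          calc C₁ * R.card ≤ C₁ * (ρ * n) := by gcongr
            _ = C₁ * ρ * n := by ring
            _ ≤ _ := by gcongr
        rw [← hC₁]
        linarith
      · refine ((hxT T' hT').sdiff (k := k) hp hp1 hn hζk hx.le ?_).mono hp hn hc'2 subset_rfl
        exact hxk.trans (hS.large_of_lt (by omega) (half_pos hζk) h5)) hxRd (by
      intro S hS'
      rw [List.mem_toFinset] at hS'
      have := (hR S hS').2.1
      exact ⟨by linarith, hxR S hS'⟩) (by
      intro r _ T hTm
      obtain ⟨T', hT', rfl⟩ := List.mem_map.1 hTm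
      have e1 := (hT T' (List.mem_append_right _ (List.mem_append_left _ hT'))).2.2 r
      have e2 : nb G r T' ⊆ nb G r (f T') ∪ x.toFinset := by
        intro u hu
        simp only [hf, mem_nb, Finset.mem_union, Finset.mem_sdiff] at hu ⊢
        tauto
      have e3 : ((nb G r T').card : ℝ) ≤ (nb G r (f T')).card + x.toFinset.card := by
        exact_mod_cast (Finset.card_le_card e2).trans (Finset.card_union_le _ _)
      linarith) (by
      simp only [← List.map_append, List.length_map]
      exact Nat.add_le_add hTl.le (hRl ▸ List.toFinset_card_le Rs))
  -- covering almost all vertices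
  obtain ⟨T₀, hT₀⟩ : ∃ T, T ∈ Cs := List.exists_mem_of_length_pos (by omega)
  obtain ⟨U₂, e₂, hF₂, hU₂⟩ := h2 hS x Rs.toFinset R U₁ e₁ ⟨hF₁.subset, hF₁.path, hF₁.length,
    hF₁.adj, by
      intro T hTm
      obtain rfl : T = Finset.univ := by simpa using hTm
      exact (hF₁.good (f T₀) (by simp; exact .inr (.inl ⟨T₀, hT₀, rfl⟩))).mono hp hn le_rfl
        (Finset.sdiff_subset_sdiff (Finset.subset_univ _) subset_rfl), hF₁.watch⟩ (by
      have : Rs.toFinset.card ≤ Rs.length := List.toFinset_card_le Rs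
      omega) (fun S hS' => by
      have := (hR S (List.mem_toFinset.1 hS')).2.1
      linarith)
  -- `e₂` is still the end after all of `R` has been deleted, so it is disjoint from `R`.
  have he₂ : ∀ u ∈ e₂, u ∈ U₂ ∧ u ∉ R := fun u hu => by
    have := (hF₂.path R subset_rfl).end_subset (List.mem_toFinset.2 hu)
    simpa using this
  have hRsE : ∀ {T}, T ∈ Es → T ∈ Rs := fun h => List.mem_append_right _ h
  have hRsB : ∀ {T}, T ∈ Bs ++ Ds ++ (Bs' ++ Ds') → T ∈ Rs := fun h => List.mem_append_left _ h
  -- covering the remaining vertices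
  obtain ⟨U₃, e₃, hF₃, hU₃⟩ := h1 hS e₂ Bs Ds Bs' Ds' Es.toFinset (Finset.univ \ U₂) hF₂.length
    hF₂.adj hBs hDs hBs' hDs' (List.pairwise_append.1 hRd).1 (by
      intro T hTm
      have e1 := hR T (hRsB hTm)
      refine ⟨?_, ?_, ?_, hF₂.watch T (List.mem_toFinset.2 (hRsB hTm))⟩
      · rw [Finset.disjoint_right]
        exact fun u hu huT => (he₂ u (List.mem_toFinset.1 hu)).2 (e1.1 huT)
      · rw [Finset.disjoint_left]
        exact fun u hu hu' => (Finset.mem_sdiff.1 hu').2 (hF₂.subset (e1.1 hu))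
      · have e2 : C₁ * (Finset.univ \ U₂).card ≤ β / 4 * n := by
          calc C₁ * ((Finset.univ \ U₂).card : ℝ) ≤ C₁ * (ζ * n) := by gcongr
            _ = C₁ * ζ * n := by ring
            _ ≤ _ := by gcongr
        rw [← hC₁]
        linarith [e1.2.1]) (by
      rw [Finset.disjoint_right]
      exact fun u hu hu' => (Finset.mem_sdiff.1 hu').2 (he₂ u (List.mem_toFinset.1 hu)).1) (by
      intro S hS'
      rw [List.mem_toFinset] at hS'
      have := (hR S (hRsE hS')).2.1
      exact ⟨by linarith, hF₂.watch S (List.mem_toFinset.2 (hRsE hS'))⟩) (by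
      intro r _ T hTm
      have := (hR T (hRsB (List.mem_append_right _ (List.mem_append_left _ hTm)))).2.2 r
      linarith) (by
      have e1 : Es.toFinset.card ≤ Es.length := List.toFinset_card_le Es
      have e2 : (Bs ++ Ds ++ (Bs' ++ Ds')).length = 2 * (M + m) := by
        simp [hBs, hDs, hBs', hDs']; ring
      omega)
  -- closing up
  obtain ⟨z, hz, hzP⟩ := h4 hS e₃ x Es hF₃.length hx hF₃.adj hxa hEs
    (fun T hTm => hF₃.watch T (List.mem_toFinset.2 hTm)) (fun T hTm => hxR T (hRsE hTm))
  have hzn := nodup_of_forall₂_mem hz (List.pairwise_append.1 hRd).2.1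
  have hzR : ∀ u ∈ z, u ∈ R ∧ u ∉ U₃ := by
    intro u hu
    obtain ⟨T, hTm, huT⟩ := forall₂_mem_exists hz hu
    have huR := (hR T (hRsE hTm)).1 huT
    refine ⟨huR, fun h => ?_⟩
    rcases hU₃ u h with h | h | ⟨T', hT', h⟩
    · exact (he₂ u h).2 huR
    · exact (Finset.mem_sdiff.1 h).2 (hF₂.subset huR)
    · exact Finset.disjoint_left.1 ((List.pairwise_append.1 hRd).2.2 T' hT' T hTm) h huT
  -- The reservoir vertices that now lie on the second path or on the closing path; flexibility
  -- allows them to be deleted from the first path.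
  set W := (U₃ ∪ z.toFinset) ∩ R with hW
  have hpath := (hF₂.path W Finset.inter_subset_right).trans (hF₃.path ∅ (by simp)) hF₂.length (by
    intro u hu
    simp only [hW, Finset.sdiff_empty, Finset.mem_inter, Finset.mem_sdiff, Finset.mem_union] at hu
    obtain ⟨⟨h8, h9⟩, h10⟩ := hu
    rw [List.mem_toFinset]
    rcases hU₃ u h10 with h | h | ⟨T', hT', h⟩
    · exact h
    · exact absurd h8 (Finset.mem_sdiff.1 h).2
    · exact absurd ⟨.inl h10, (hR T' (hRsB hT')).1 h⟩ h9)
  obtain ⟨P, hP, hPn, hPU, hxP, A, rfl⟩ := hpath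
  rw [Finset.sdiff_empty] at hPU
  have hmem : ∀ u, u ∈ A ++ e₃ ↔ (u ∈ U₂ ∧ u ∉ W) ∨ u ∈ U₃ := by
    intro u
    rw [← List.mem_toFinset, hPU, Finset.mem_union, Finset.mem_sdiff]
  refine ⟨A ++ e₃ ++ z, x, ?_, ?_, hx, hxP.trans (List.prefix_append _ _), ?_⟩
  · rw [List.nodup_append]
    refine ⟨hPn, hzn, fun a ha b hb hab => ?_⟩
    subst hab
    rcases (hmem a).1 ha with h | h
    · exact h.2 (Finset.mem_inter.2 ⟨Finset.mem_union_right _ (List.mem_toFinset.2 hb),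
        (hzR a hb).1⟩)
    · exact (hzR a hb).2 h
  · intro v
    rw [List.mem_append, hmem]
    by_cases hv : v ∈ U₂
    · by_cases hvW : v ∈ W
      · rcases Finset.mem_union.1 (Finset.mem_inter.1 hvW).1 with h | h
        · exact .inl (.inr h)
        · exact .inr (List.mem_toFinset.1 h)
      · exact .inl (.inl ⟨hv, hvW⟩)
    · exact .inl (.inr (hF₃.subset (by simp [hv])))
  · have := KPath.glue (A := A) (m := e₃) (B := z ++ x) hP (by simpa using hzP) hF₃.length.ge
    simpa using this

end Assembly

/-! ### A balanced partition, and the sets for the assembly. -/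

section Partition

/-- Some colouring distributes all the sets `N v` fairly evenly among the colours. -/
theorem exists_balanced_coloring {V ι : Type*} [Fintype V] [DecidableEq V] [Fintype ι]
    [DecidableEq ι] (N : V → Finset V) {d : ℕ} (hN : ∀ v, (N v).card = d) {K : ℕ}
    (hK : Fintype.card ι = K) (hK0 : 0 < K) (hd : 384 * (K : ℝ) ^ 4 ≤ d)
    (hV : (Fintype.card V : ℝ) ≤ (d : ℝ) ^ 2) :
    ∃ χ : V → ι, ∀ v c, (d : ℝ) ≤ 4 * K * ((N v).filter fun u => χ u = c).card := by
  have hK1 : (1 : ℝ) ≤ K := by exact_mod_cast hK0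
  -- An exponential moment, computed by summing over all colourings. The weight `(1/2)^t`, with `t`
  -- the number of vertices of colour `c` in `N v`, has average `(1 - 1/(2K))^d`. The sum over all
  -- `v` and `c` is then at most `exp(-d/(4K))` for some colouring, and a colour with fewer than
  -- `d/(4K)` occurrences would exceed this on its own.
  set w : V → ι → V → ι → ℝ := fun v c u i => if u ∈ N v ∧ i = c then 1 / 2 else 1 with hw
  have hprod : ∀ v c (χ : V → ι), ∏ u, w v c u (χ u) =
      (1 / 2) ^ ((N v).filter fun u => χ u = c).card := by
    intro v c χ
    simp only [hw]
    rw [Finset.prod_ite, Finset.prod_const_one, mul_one, Finset.prod_const]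
    congr 2
    ext u; simp
  have hsum : ∀ v c u, ∑ i, w v c u i = if u ∈ N v then (K : ℝ) * (1 - 1 / (2 * K)) else K := by
    intro v c u
    simp only [hw]
    split_ifs with hu
    · simp only [hu, true_and]
      have e1 : ∀ i, (if i = c then (1 / 2 : ℝ) else 1) = 1 - if i = c then 1 / 2 else 0 := by
        intro i; split_ifs <;> norm_num
      simp only [e1, Finset.sum_sub_distrib, Finset.sum_const, Finset.card_univ, hK,
        Finset.sum_ite_eq', Finset.mem_univ, if_true, nsmul_eq_mul]
      field_simp
    · simp [hu, hK]
  have htot : ∀ v c, ∑ χ : V → ι, (1 / 2 : ℝ) ^ ((N v).filter fun u => χ u = c).card =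
      (K : ℝ) ^ Fintype.card V * (1 - 1 / (2 * K)) ^ d := by
    intro v c
    simp only [← hprod]
    have h1 := Finset.prod_univ_sum (fun _ : V => (Finset.univ : Finset ι)) (fun u i => w v c u i)
    rw [Fintype.piFinset_univ] at h1
    rw [← h1]
    simp only [hsum]
    rw [Finset.prod_ite, Finset.prod_const, Finset.prod_const]
    have e1 : (Finset.univ.filter fun u => u ∈ N v) = N v := by ext; simp
    have e2 : (N v).card + (Finset.univ.filter fun u => ¬ u ∈ N v).card = Fintype.card V := by
      have := Finset.card_filter_add_card_filter_not (s := (Finset.univ : Finset V))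
        (fun u => u ∈ N v)
      rwa [e1] at this
    rw [e1, hN, mul_pow, mul_right_comm, ← pow_add]
    rw [hN] at e2
    rw [e2]
  have hfac : (Fintype.card V : ℝ) * K * (1 - 1 / (2 * K)) ^ d ≤ Real.exp (-(d / (4 * K))) := by
    -- The cubic term of the exponential series is `d³/(384 K³)`, which is where 384 comes from.
    have hx : (d : ℝ) ^ 2 * K ≤ Real.exp (d / (4 * K)) := by
      have e1 := Real.pow_div_factorial_le_exp (d / (4 * K) : ℝ) (by positivity) 3
      refine le_trans ?_ e1
      rw [div_pow, div_div, le_div_iff₀ (by positivity)]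
      have : (d : ℝ) ^ 2 * (384 * (K : ℝ) ^ 4) ≤ (d : ℝ) ^ 2 * d := by gcongr
      simp only [Nat.factorial]
      push_cast
      nlinarith
    have e0 : (0 : ℝ) ≤ 1 - 1 / (2 * K) := by
      rw [sub_nonneg, div_le_one (by positivity)]
      linarith
    have h2 : (1 - 1 / (2 * K) : ℝ) ^ d ≤ Real.exp (-(d / (2 * K))) := by
      have e1 : (1 - 1 / (2 * K) : ℝ) ≤ Real.exp (-(1 / (2 * K))) := Real.one_sub_le_exp_neg _
      calc (1 - 1 / (2 * K) : ℝ) ^ d ≤ Real.exp (-(1 / (2 * K))) ^ d := by gcongr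
        _ = _ := by rw [← Real.exp_nat_mul]; congr 1; ring
    calc (Fintype.card V : ℝ) * K * (1 - 1 / (2 * K)) ^ d
        ≤ (d : ℝ) ^ 2 * K * Real.exp (-(d / (2 * K))) := by
          have := pow_nonneg e0 d
          gcongr
      _ ≤ Real.exp (d / (4 * K)) * Real.exp (-(d / (2 * K))) := by gcongr
      _ = _ := by rw [← Real.exp_add]; congr 1; field_simp; ring
  have hex : ∃ χ ∈ (Finset.univ : Finset (V → ι)),
      ∑ v, ∑ c, (1 / 2 : ℝ) ^ ((N v).filter fun u => χ u = c).card ≤ Real.exp (-(d / (4 * K))) := by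
    have : Nonempty ι := Fintype.card_pos_iff.1 (hK ▸ hK0)
    refine Finset.exists_le_of_sum_le Finset.univ_nonempty ?_
    rw [Finset.sum_comm]
    have e1 : ∀ v, ∑ χ : V → ι, ∑ c, (1 / 2 : ℝ) ^ ((N v).filter fun u => χ u = c).card =
        K * ((K : ℝ) ^ Fintype.card V * (1 - 1 / (2 * K)) ^ d) := by
      intro v
      rw [Finset.sum_comm]
      simp only [htot, Finset.sum_const, Finset.card_univ, hK, nsmul_eq_mul]
    simp only [e1, Finset.sum_const, Finset.card_univ, nsmul_eq_mul]
    calc _ = (K : ℝ) ^ Fintype.card V * ((Fintype.card V : ℝ) * K * (1 - 1 / (2 * K)) ^ d) := by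
          ring
      _ ≤ (K : ℝ) ^ Fintype.card V * Real.exp (-(d / (4 * K))) := by gcongr
      _ = _ := by simp [hK]
  obtain ⟨χ, -, hχ⟩ := hex
  refine ⟨χ, fun v c => ?_⟩
  have h1 : (1 / 2 : ℝ) ^ ((N v).filter fun u => χ u = c).card ≤ Real.exp (-(d / (4 * K))) := by
    refine le_trans ?_ hχ
    refine le_trans ?_ (Finset.single_le_sum (f := fun v => ∑ c, (1 / 2 : ℝ) ^
      ((N v).filter fun u => χ u = c).card) (fun _ _ => by positivity) (Finset.mem_univ v))
    exact Finset.single_le_sum (f := fun c => (1 / 2 : ℝ) ^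
      ((N v).filter fun u => χ u = c).card) (fun _ _ => by positivity) (Finset.mem_univ c)
  have h2 : Real.exp (-(((N v).filter fun u => χ u = c).card : ℝ)) ≤
      (1 / 2 : ℝ) ^ ((N v).filter fun u => χ u = c).card := by
    have e1 : Real.exp (-1) ≤ 1 / 2 := by
      rw [Real.exp_neg, one_div]
      have := Real.add_one_le_exp (1 : ℝ)
      exact inv_anti₀ (by norm_num) (by linarith)
    calc _ = Real.exp (-1) ^ ((N v).filter fun u => χ u = c).card := by
          rw [← Real.exp_nat_mul]; congr 1; ring
      _ ≤ _ := by gcongr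
  have h3 := Real.exp_le_exp.1 (h2.trans h1)
  rw [neg_le_neg_iff, div_le_iff₀ (by positivity)] at h3
  linarith

theorem Setup.card_of_degree {V : Type*} [Fintype V] {G : SimpleGraph V} {s : ℕ} {ε p n γ : ℝ}
    (hS : Setup G s ε p n) {S : Finset V} (h : ∀ v, γ * p * n ≤ ((nb G v S).card : ℝ)) :
    γ * n ≤ S.card := by
  have hn := hS.n_pos
  have hp := hS.jumbled.pos
  have h1 : n * (γ * p * n) ≤ S.card * (p * n) := by
    calc n * (γ * p * n) = ∑ _v : V, γ * p * n := by
          rw [Finset.sum_const, nsmul_eq_mul, Finset.card_univ, hS.card]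
      _ ≤ ∑ v, ((nb G v S).card : ℝ) := Finset.sum_le_sum fun v _ => h v
      _ = ∑ v ∈ S, ((nb G v Finset.univ).card : ℝ) := sum_nb_comm _ _
      _ = _ := by simp only [hS.degree, Finset.sum_const, nsmul_eq_mul]
  refine le_of_mul_le_mul_right ?_ (show 0 < p * n by positivity)
  linarith

theorem exists_split {α : Type*} (l : List α) {M m : ℕ} (hl : l.length = 2 * (M + m)) :
    ∃ As Cs As' Cs' : List α, l = As ++ Cs ++ (As' ++ Cs') ∧ As.length = M ∧ Cs.length = m ∧
      As'.length = M ∧ Cs'.length = m := by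
  refine ⟨(l.take (M + m)).take M, (l.take (M + m)).drop M, (l.drop (M + m)).take M,
    (l.drop (M + m)).drop M, ?_, ?_, ?_, ?_, ?_⟩
  · simp only [List.take_append_drop]
  all_goals simp; omega

/-- A closed Hamilton `k`-path. -/
theorem Setup.exists_closed_path {k s M m : ℕ} (hk : 1 ≤ k) (hs : 2 ≤ s) (hks : 2 * k ≤ s + 1)
    (hm : 1 ≤ m) (habs : HasAbsorbers.{u} k s M) (hcon : Connects.{u} k s m) :
    ∀ᶠ ε in 𝓝[>] (0 : ℝ),
    ∀ {V : Type u} [Fintype V] [DecidableEq V] {G : SimpleGraph V} {p n : ℝ},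
    Setup G s ε p n →
    ∃ l x : List V, l.Nodup ∧ (∀ v, v ∈ l) ∧ x.length = k ∧ x <+: l ∧ KPath G k (l ++ x) := by
  -- Colours are pairs in `Fin Q × Fin a`. A value of the first coordinate taken by at most `n/Q`
  -- vertices defines the reservoir, and the second coordinate splits the reservoir and its
  -- complement into `a` disjoint sets each. The factor 32 makes `(M + m + 1)/Q` equal to `α/4` for
  -- `α = 1/(8a)`.
  set a := 2 * (M + m) + m with ha
  set Q := 32 * a * (M + m + 1) with hQ
  set K := Q * a with hK
  have ha0 : 0 < a := by omega
  have hQ0 : 0 < Q := by positivity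
  have hQ32 : 2 ≤ Q := by
    have : 1 ≤ a * (M + m + 1) := Nat.mul_pos ha0 (by omega)
    rw [hQ, mul_assoc]; omega
  have hK0 : 0 < K := Nat.mul_pos hQ0 ha0
  have haR : (1 : ℝ) ≤ a := by exact_mod_cast ha0
  have hQR : (2 : ℝ) ≤ Q := by exact_mod_cast hQ32
  have hKR : (K : ℝ) = Q * a := by rw [hK]; push_cast; ring
  have hK0R : (0 : ℝ) < K := by exact_mod_cast hK0
  filter_upwards [_root_.exists_closed_path.{u} hk hks hm habs hcon (α := 1 / (8 * a))
      (β := 1 / (4 * K)) (ρ := 1 / Q) (by positivity)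
      (by rw [div_le_one (by positivity)]; linarith) (by positivity) (by
        have : (Q : ℝ) = 32 * a * (M + m + 1 : ℕ) := by rw [hQ]; push_cast; ring
        rw [this]
        have : (0 : ℝ) < (M + m + 1 : ℕ) := by positivity
        refine le_of_eq ?_
        field_simp
        norm_num),
    eventually_mul_lt (384 * (K : ℝ) ^ 4) one_pos, eventually_mul_lt (1 : ℝ) one_pos]
    with ε h1 h2 h3
  intro V _ _ G p n hS
  classical
  have hn := hS.n_pos
  have hp := hS.jumbled.pos
  have hp1 := hS.jumbled.le_one
  have hd1 := hS.large_of_lt (k := 1) (by omega) one_pos h2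
  have hd2 := hS.large_of_lt (k := 2) (by omega) one_pos h3
  rw [one_mul] at hd1 hd2
  rw [pow_one] at hd1
  obtain ⟨v₀⟩ : Nonempty V := by
    refine Fintype.card_pos_iff.1 ?_
    have : (0 : ℝ) < Fintype.card V := by rw [hS.card]; exact hn
    exact_mod_cast this
  set d := (nb G v₀ Finset.univ).card with hd
  have hdR : (d : ℝ) = p * n := hS.degree v₀
  obtain ⟨χ, hχ⟩ := exists_balanced_coloring (ι := Fin Q × Fin a) (fun v => nb G v Finset.univ)
    (d := d) (K := K) (fun v => by
      have : ((nb G v Finset.univ).card : ℝ) = d := by rw [hS.degree, hdR]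
      exact_mod_cast this) (by simp [hK]) hK0 (by rw [hdR]; exact hd1) (by
      rw [hS.card, hdR]
      calc n = 1 * n := (one_mul n).symm
        _ ≤ p ^ 2 * n * n := by gcongr
        _ = _ := by ring)
  have : Nonempty (Fin Q) := ⟨⟨0, hQ0⟩⟩
  obtain ⟨i₀, hi₀⟩ := Fintype.exists_card_fiber_le_of_card_le_nsmul (M := ℝ) (b := 1 / Q * n)
    (fun v => (χ v).1) (by
      rw [Fintype.card_fin, hS.card, nsmul_eq_mul]
      refine le_of_eq ?_
      field_simp)
  set S : Fin Q → Fin a → Finset V := fun i j => Finset.univ.filter fun v => χ v = (i, j) with hSdef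
  set T : Fin a → Finset V := fun j =>
    Finset.univ.filter fun v => (χ v).1 ≠ i₀ ∧ (χ v).2 = j with hT
  set R : Finset V := Finset.univ.filter fun v => (χ v).1 = i₀ with hR
  have hSd : ∀ i j v, 1 / (4 * K) * p * n ≤ ((nb G v (S i j)).card : ℝ) := by
    intro i j v
    have e1 := hχ v (i, j)
    have e2 : ((nb G v Finset.univ).filter fun u => χ u = (i, j)) = nb G v (S i j) := by
      ext u; simp only [hSdef, Finset.mem_filter, mem_nb, Finset.mem_univ, true_and]; tauto
    rw [e2, hdR] at e1
    rw [mul_assoc, div_mul_eq_mul_div, one_mul, div_le_iff₀ (by positivity)]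
    linarith
  have hTd : ∀ j v, 1 / (8 * a) * p * n ≤ ((nb G v (T j)).card : ℝ) := by
    intro j v
    have e1 : (Finset.univ.erase i₀).biUnion (fun i => nb G v (S i j)) ⊆ nb G v (T j) := by
      intro u hu
      simp only [Finset.mem_biUnion, Finset.mem_erase, Finset.mem_univ, and_true, mem_nb, hSdef,
        Finset.mem_filter, true_and] at hu
      obtain ⟨i, hi, h4, h5⟩ := hu
      simp [hT, h4, hi, h5]
    have e2 := Finset.card_le_card e1
    rw [Finset.card_biUnion] at e2
    · have e3 : (((Finset.univ.erase i₀).card : ℕ) : ℝ) * (1 / (4 * K) * p * n) ≤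
          ((nb G v (T j)).card : ℝ) := by
        calc _ = ∑ i ∈ Finset.univ.erase i₀, 1 / (4 * K) * p * n := by
              rw [Finset.sum_const, nsmul_eq_mul]
          _ ≤ ∑ i ∈ Finset.univ.erase i₀, ((nb G v (S i j)).card : ℝ) :=
              Finset.sum_le_sum fun i _ => hSd i j v
          _ ≤ _ := by exact_mod_cast e2
      rw [Finset.card_erase_of_mem (Finset.mem_univ _), Finset.card_univ, Fintype.card_fin,
        Nat.cast_sub (by omega), Nat.cast_one] at e3
      refine le_trans ?_ e3
      calc 1 / (8 * a) * p * n = (Q / 2) * (1 / (4 * K) * p * n) := by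
            rw [hKR]; field_simp; norm_num
        _ ≤ _ := by gcongr; linarith
    · intro i _ i' _ hii'
      rw [Function.onFun, Finset.disjoint_left]
      intro u hu hu'
      simp only [mem_nb, hSdef, Finset.mem_filter, Finset.mem_univ, true_and] at hu hu'
      exact hii' (by simpa using hu.1.symm.trans hu'.1)
  obtain ⟨As, Cs, As', Cs', hTl, hAs, hCs, hAs', hCs'⟩ :=
    exists_split (((List.finRange a).take (2 * (M + m))).map T) (M := M) (m := m)
      (by simp; omega)
  obtain ⟨Bs, Ds, Bs', Ds', hBl, hBs, hDs, hBs', hDs'⟩ :=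
    exists_split (((List.finRange a).take (2 * (M + m))).map (S i₀)) (M := M) (m := m)
      (by simp; omega)
  have hnod : (List.finRange a).Pairwise (· ≠ ·) := List.nodup_finRange a
  refine h1 hS As Cs As' Cs' Bs Ds Bs' Ds' (((List.finRange a).drop (2 * (M + m))).map (S i₀)) R
    hAs hCs hAs' hCs' hBs hDs hBs' hDs' (by simp; omega) ?_ ?_ ?_ ?_ hi₀
  · rw [← hTl, List.pairwise_map]
    refine (hnod.sublist (List.take_sublist _ _)).imp fun {i j} hij => ?_
    rw [Finset.disjoint_left]
    intro u hu hu'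
    simp only [hT, Finset.mem_filter] at hu hu'
    exact hij (hu.2.2.symm.trans hu'.2.2)
  · rw [← hBl, ← List.map_append, List.take_append_drop, List.pairwise_map]
    refine hnod.imp fun {i j} hij => ?_
    rw [Finset.disjoint_left]
    intro u hu hu'
    simp only [hSdef, Finset.mem_filter] at hu hu'
    exact hij (by simpa using hu.2.symm.trans hu'.2)
  · rw [← hTl]
    intro T' hT'
    obtain ⟨j, -, rfl⟩ := List.mem_map.1 hT'
    refine ⟨?_, hS.card_of_degree (hTd j), hTd j⟩
    rw [Finset.disjoint_left]
    intro u hu hu'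
    simp only [hT, hR, Finset.mem_filter] at hu hu'
    exact hu.2.1 hu'.2
  · rw [← hBl, ← List.map_append, List.take_append_drop]
    intro T' hT'
    obtain ⟨j, -, rfl⟩ := List.mem_map.1 hT'
    refine ⟨?_, hS.card_of_degree (hSd i₀ j), hSd i₀ j⟩
    intro u hu
    simp only [hSdef, hR, Finset.mem_filter] at hu ⊢
    exact ⟨hu.1, by rw [hu.2]⟩

end Partition

/-! ### From the second eigenvalue to jumbledness. -/

section Spectral

theorem norm_map_le_of_eigenbasis {ι E : Type*} [Fintype ι] [NormedAddCommGroup E]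
    [InnerProductSpace ℝ E] (b : OrthonormalBasis ι ℝ E) {T : E →ₗ[ℝ] E} (hT : T.IsSymmetric)
    {μ : ι → ℝ} (hb : ∀ i, T (b i) = μ i • b i) {c : ℝ} (hc : 0 ≤ c) {g : E}
    (hg : ∀ i, c < |μ i| → inner ℝ (b i) g = 0) : ‖T g‖ ≤ c * ‖g‖ := by
  refine abs_le_of_sq_le_sq' ?_ (by positivity) |>.2
  rw [mul_pow, ← b.sum_sq_inner_right, ← b.sum_sq_inner_right, Finset.mul_sum]
  refine Finset.sum_le_sum fun i _ => ?_
  rw [← hT, hb, real_inner_smul_left, mul_pow]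
  by_cases h : c < |μ i|
  · simp [hg i h]
  · have := sq_le_sq' (by linarith [abs_nonneg (μ i)]) (not_lt.1 h)
    rw [sq_abs] at this
    gcongr

variable {V : Type*} [Fintype V] [DecidableEq V] {G : SimpleGraph V} [DecidableRel G.Adj]

theorem abs_eigenvalue_le {i : Fin (Fintype.card V)} (hi : 1 ≤ i.val) :
    |adjEigenvalues G i| ≤ secondEigenvalue G := by
  have hV : 2 ≤ Fintype.card V := by have := i.2; omega
  have hanti := (adjMatrix_real_isHermitian G).eigenvalues₀_antitone
  have h1 : adjEigenvalues G i ≤ adjEigenvalues G ⟨1, by omega⟩ := hanti hi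
  have h2 : adjEigenvalues G ⟨Fintype.card V - 1, by omega⟩ ≤ adjEigenvalues G i :=
    hanti (by rw [Fin.le_def]; have := i.2; simp; omega)
  rw [secondEigenvalue, dif_pos hV, abs_le]
  refine ⟨?_, h1.trans ((le_abs_self _).trans (le_max_left _ _))⟩
  have := (neg_abs_le (adjEigenvalues G ⟨Fintype.card V - 1, by omega⟩)).trans h2
  refine le_trans ?_ this
  exact neg_le_neg (le_max_right _ _)

theorem secondEigenvalue_nonneg : 0 ≤ secondEigenvalue G := by
  rw [secondEigenvalue]
  split_ifs
  · exact (abs_nonneg _).trans (le_max_left _ _)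
  · exact le_rfl

/-- Gershgorin's theorem: the diagonal vanishes and every row has sum `d`. -/
theorem abs_eigenvalue_le_degree {d : ℕ} (hd : G.IsRegularOfDegree d) {x : V → ℝ} {μ : ℝ}
    (hx : x ≠ 0) (h : (G.adjMatrix ℝ).mulVec x = μ • x) : |μ| ≤ d := by
  have h1 : Module.End.HasEigenvalue (Matrix.toLin' (G.adjMatrix ℝ)) μ :=
    Module.End.hasEigenvalue_of_hasEigenvector
      ⟨Module.End.mem_eigenspace_iff.2 (by rw [Matrix.toLin'_apply, h]), hx⟩
  obtain ⟨v, hv⟩ := eigenvalue_mem_ball h1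
  rw [Metric.mem_closedBall, SimpleGraph.adjMatrix_apply, if_neg (G.loopless.irrefl v), dist_zero_right,
    Real.norm_eq_abs] at hv
  refine hv.trans ?_
  calc ∑ j ∈ Finset.univ.erase v, ‖G.adjMatrix ℝ v j‖ ≤ ∑ j, ‖G.adjMatrix ℝ v j‖ :=
        Finset.sum_le_sum_of_subset_of_nonneg (Finset.erase_subset _ _) fun _ _ _ => norm_nonneg _
    _ = G.degree v := by
        rw [← SimpleGraph.card_neighborFinset_eq_degree, SimpleGraph.neighborFinset_eq_filter]
        simp [SimpleGraph.adjMatrix_apply, apply_ite]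
    _ = d := by rw [hd v]

theorem toEuclideanLin_one {d : ℕ} (hd : G.IsRegularOfDegree d) :
    (G.adjMatrix ℝ).toEuclideanLin (WithLp.toLp 2 (1 : V → ℝ)) =
      (d : ℝ) • WithLp.toLp 2 (1 : V → ℝ) := by
  apply (WithLp.equiv 2 _).injective
  ext v
  simp [Matrix.mulVec, dotProduct, SimpleGraph.adjMatrix_apply, ← hd v]
  rw [← SimpleGraph.card_neighborFinset_eq_degree, SimpleGraph.neighborFinset_eq_filter]

/-- On vectors orthogonal to the constant ones, the adjacency operator has norm at most
`λ(G)`. -/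
theorem norm_adj_le {d : ℕ} (hd : G.IsRegularOfDegree d) {g : EuclideanSpace ℝ V}
    (hg : inner ℝ (WithLp.toLp 2 (1 : V → ℝ)) g = 0) :
    ‖(G.adjMatrix ℝ).toEuclideanLin g‖ ≤ secondEigenvalue G * ‖g‖ := by
  set hA := adjMatrix_real_isHermitian G
  set one : EuclideanSpace ℝ V := WithLp.toLp 2 (1 : V → ℝ) with hone
  set T := (G.adjMatrix ℝ).toEuclideanLin with hT
  set b := hA.eigenvectorBasis
  have hsym : T.IsSymmetric := Matrix.isSymmetric_toEuclideanLin_iff.2 hA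
  have hb : ∀ i, T (b i) = hA.eigenvalues i • b i := by
    intro i
    apply (WithLp.equiv 2 _).injective
    have := hA.mulVec_eigenvectorBasis i
    simpa [hT] using this
  have hTone : T one = (d : ℝ) • one := toEuclideanLin_one hd
  -- Only the eigenvalue of index 0 can exceed `λ(G)` in absolute value. If that of `b i` does, any
  -- `b j` not orthogonal to the constant vector has eigenvalue `d ≥ |μ_i| > λ(G)`, whence `j = i`.
  -- So the constant vector is a multiple of `b i`, and `g` is orthogonal to `b i`. Neither
  -- connectedness nor simplicity of the eigenvalue `d` is needed.
  refine norm_map_le_of_eigenbasis b hsym hb secondEigenvalue_nonneg fun i hi => ?_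
  set σ := Fintype.equivOfCardEq (Fintype.card_fin (Fintype.card V)) with hσ
  have hval : ∀ j, hA.eigenvalues j = adjEigenvalues G (σ.symm j) := fun j => rfl
  have hfirst : ∀ j, secondEigenvalue G < |hA.eigenvalues j| → (σ.symm j).val = 0 := by
    intro j hj
    by_contra h
    rw [hval] at hj
    exact absurd hj (not_lt.2 (abs_eigenvalue_le (by omega)))
  have hinner : ∀ j, inner ℝ (b j) one ≠ 0 → hA.eigenvalues j = d := by
    intro j hj
    have h1 := hsym (b j) one
    rw [hb, hTone, real_inner_smul_left, real_inner_smul_right] at h1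
    exact mul_right_cancel₀ hj h1
  have hle : |hA.eigenvalues i| ≤ d := by
    refine abs_eigenvalue_le_degree hd (x := b i) ?_ (hA.mulVec_eigenvectorBasis i)
    intro h
    have : b i = 0 := by
      apply (WithLp.equiv 2 _).injective
      exact h
    have h2 := b.orthonormal.1 i
    rw [this] at h2
    simp at h2
  have hother : ∀ j, j ≠ i → inner ℝ (b j) one = 0 := by
    intro j hji
    by_contra h
    have h1 := hinner j h
    have h2 : |hA.eigenvalues j| ≤ secondEigenvalue G := by
      rw [hval]
      refine abs_eigenvalue_le ?_
      by_contra h0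
      have h3 := hfirst i hi
      apply hji
      apply σ.symm.injective
      apply Fin.ext
      omega
    rw [h1, Nat.abs_cast] at h2
    linarith
  have hsum := b.sum_inner_mul_inner one g
  rw [hg, Finset.sum_eq_single i] at hsum
  · rcases mul_eq_zero.1 hsum with h | h
    · exfalso
      have h0 : ∀ j, inner ℝ (b j) one = 0 := by
        intro j
        by_cases hji : j = i
        · rw [hji, real_inner_comm, h]
        · exact hother j hji
      have h1 := b.sum_sq_inner_right one
      simp only [h0] at h1
      have h2 : one = 0 := by
        rw [← norm_eq_zero]
        simpa using h1.symm
      have h3 := congrArg (fun z : EuclideanSpace ℝ V => z i) h2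
      simp [hone] at h3
    · exact h
  · intro j _ hji
    rw [real_inner_comm, hother j hji, zero_mul]
  · simp

/-- The expander mixing lemma. -/
theorem expander_mixing [Nonempty V] {d : ℕ} (hd : G.IsRegularOfDegree d) (X Y : Finset V) :
    ((∑ x ∈ X, ((nb G x Y).card : ℝ)) - d / Fintype.card V * X.card * Y.card) ^ 2 ≤
      secondEigenvalue G ^ 2 * X.card * Y.card := by
  set n : ℝ := (Fintype.card V : ℝ) with hn
  have hn0 : 0 < n := by rw [hn]; exact_mod_cast Fintype.card_pos
  set one : EuclideanSpace ℝ V := WithLp.toLp 2 (1 : V → ℝ) with hone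
  set ind : Finset V → EuclideanSpace ℝ V :=
    fun X => WithLp.toLp 2 (fun v => if v ∈ X then (1 : ℝ) else 0) with hind
  set T := (G.adjMatrix ℝ).toEuclideanLin with hT
  have hsym : T.IsSymmetric := Matrix.isSymmetric_toEuclideanLin_iff.2 (adjMatrix_real_isHermitian G)
  have hTone : T one = (d : ℝ) • one := toEuclideanLin_one hd
  have h11 : inner ℝ one one = n := by
    rw [real_inner_self_eq_norm_sq, EuclideanSpace.real_norm_sq_eq]
    simp [hone, hn]
  have hX1 : ∀ X, inner ℝ (ind X) one = (X.card : ℝ) := by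
    intro X
    simp [hone, hind, PiLp.inner_apply]
  have hXX : ∀ X, inner ℝ (ind X) (ind X) = (X.card : ℝ) := by
    intro X
    rw [real_inner_self_eq_norm_sq, EuclideanSpace.real_norm_sq_eq]
    simp [hind]
  have hXY : inner ℝ (ind X) (T (ind Y)) = ∑ x ∈ X, ((nb G x Y).card : ℝ) := by
    have h1 : ∀ x, (T (ind Y)) x = ((nb G x Y).card : ℝ) := by
      intro x
      simp only [hT, hind, Matrix.toLpLin_apply, Matrix.mulVec, dotProduct,
        SimpleGraph.adjMatrix_apply, mul_ite, mul_one, mul_zero]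
      rw [Finset.sum_ite_mem, Finset.univ_inter, ← Finset.sum_filter, Finset.sum_const, nsmul_eq_mul,
        mul_one]
      congr 2
      ext; simp
    simp [PiLp.inner_apply, hind, ← h1]
  -- The projections of the indicator vectors orthogonal to the constants; the discarded parts
  -- contribute exactly `d|X||Y|/n`.
  set pr : Finset V → EuclideanSpace ℝ V := fun X => ind X - (X.card / n) • one with hpr
  have hpr1 : ∀ X, inner ℝ one (pr X) = 0 := by
    intro X
    rw [hpr, inner_sub_right, real_inner_smul_right, real_inner_comm, hX1, h11]
    field_simp
    ring
  have hprn : ∀ X, ‖pr X‖ ^ 2 ≤ (X.card : ℝ) := by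
    intro X
    rw [← real_inner_self_eq_norm_sq]
    have h1 : inner ℝ (pr X) (pr X) = inner ℝ (ind X) (pr X) := by
      conv_lhs => rw [hpr]
      rw [inner_sub_left, real_inner_smul_left, hpr1, mul_zero, sub_zero]
    rw [h1, hpr, inner_sub_right, real_inner_smul_right, hX1, hXX]
    have : (0 : ℝ) ≤ X.card / n * X.card := by positivity
    linarith
  have hmain : inner ℝ (pr X) (T (pr Y)) =
      (∑ x ∈ X, ((nb G x Y).card : ℝ)) - d / n * X.card * Y.card := by
    have h1 : inner ℝ (pr X) (T (pr Y)) = inner ℝ (ind X) (T (pr Y)) := by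
      have h0 : inner ℝ one (T (pr Y)) = 0 := by
        rw [← hsym one (pr Y), hTone, real_inner_smul_left, hpr1, mul_zero]
      calc inner ℝ (pr X) (T (pr Y)) = inner ℝ (ind X - (X.card / n) • one) (T (pr Y)) := rfl
        _ = _ := by rw [inner_sub_left, real_inner_smul_left, h0, mul_zero, sub_zero]
    rw [h1, hpr, map_sub, map_smul, hTone, inner_sub_right, real_inner_smul_right,
      real_inner_smul_right, hX1, hXY]
    ring
  rw [← hmain]
  have h1 := abs_real_inner_le_norm (pr X) (T (pr Y))
  have h2 := norm_adj_le hd (hpr1 Y)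
  have hΛ : 0 ≤ secondEigenvalue G := secondEigenvalue_nonneg
  calc inner ℝ (pr X) (T (pr Y)) ^ 2 = |inner ℝ (pr X) (T (pr Y))| ^ 2 := (sq_abs _).symm
    _ ≤ (‖pr X‖ * (secondEigenvalue G * ‖pr Y‖)) ^ 2 := by
        gcongr
        exact h1.trans (by gcongr)
    _ = ‖pr X‖ ^ 2 * (secondEigenvalue G ^ 2 * ‖pr Y‖ ^ 2) := by ring
    _ ≤ X.card * (secondEigenvalue G ^ 2 * Y.card) := by
        gcongr
        · exact hprn X
        · exact hprn Y
    _ = _ := by ring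

omit [DecidableEq V] in
theorem card_nb_univ {d : ℕ} (hd : G.IsRegularOfDegree d) (v : V) :
    (nb G v Finset.univ).card = d := by
  rw [← hd v, ← SimpleGraph.card_neighborFinset_eq_degree]
  congr 1
  ext; simp

omit [DecidableEq V] [DecidableRel G.Adj] in
/-- A jumbled regular graph is dense enough for the embedding lemmas. -/
theorem Setup.of_jumbled {s : ℕ} {ε ε₁ p n : ℝ} (hε : 0 < ε) (hε₁ : 0 ≤ ε₁) (h4 : 4 * ε₁ ≤ ε)
    (h2 : 4 ^ s * ε₁ ≤ ε ^ 2) (hJ : Jumbled G p (ε₁ * (p ^ s * n ^ 2)))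
    (hn : (Fintype.card V : ℝ) = n) (hn0 : 0 < n)
    (hd : ∀ v, ((nb G v Finset.univ).card : ℝ) = p * n) : Setup G s ε p n := by
  have hp := hJ.pos
  have hp1 := hJ.le_one
  obtain ⟨v⟩ : Nonempty V := by
    refine Fintype.card_pos_iff.1 ?_
    have : (0 : ℝ) < Fintype.card V := by rw [hn]; exact hn0
    exact_mod_cast this
  refine ⟨⟨hp, hp1, by positivity, fun X Y => (hJ.dev X Y).trans ?_⟩, hn, hd, ?_, hε⟩
  · have : ε₁ ≤ ε := by linarith
    gcongr
  -- A single vertex spans no edge, so its deviation from the expected count is `p`.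
  have h1 : 1 ≤ ε₁ * (p ^ s * n ^ 2) := by
    have h3 := hJ.dev {v} {v}
    have h5 : (nb G v {v}).card = 0 := by
      rw [Finset.card_eq_zero]
      ext u
      simp only [mem_nb, Finset.mem_singleton, Finset.notMem_empty, iff_false]
      rintro ⟨rfl, h⟩
      exact h.ne rfl
    simp only [Finset.sum_singleton, h5, Finset.card_singleton, Nat.cast_zero, Nat.cast_one, mul_one,
      zero_sub] at h3
    have h6 : p ^ 2 * 1 ≤ p ^ 2 * (ε₁ * (p ^ s * n ^ 2)) := by linarith
    exact le_of_mul_le_mul_left h6 (by positivity)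
  -- For `p ≤ 1/2` a vertex and its neighbourhood span `pn` edges where only `p·pn` are expected,
  -- which forces `ε₁p^s n` to be bounded below. For larger `p` the powers of `p` are bounded below,
  -- and `1 ≤ ε₁p^s n²` yields the claim after taking a square root.
  by_cases hhalf : p ≤ 1 / 2
  · have h3 := hJ.dev {v} (nb G v Finset.univ)
    have h5 : nb G v (nb G v Finset.univ) = nb G v Finset.univ := by
      ext u; simp
    simp only [Finset.sum_singleton, h5, Finset.card_singleton, Nat.cast_one, mul_one, hd] at h3
    have h6 : p ^ 2 * n ^ 2 * (1 - p) ^ 2 ≤ p ^ 2 * n ^ 2 * (ε₁ * (p ^ s * n) * p) := by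
      calc p ^ 2 * n ^ 2 * (1 - p) ^ 2 = (p * n - p * (p * n)) ^ 2 := by ring
        _ ≤ _ := h3
        _ = _ := by ring
    have h7 := le_of_mul_le_mul_left h6 (by positivity)
    have h8 : (1 / 4 : ℝ) ≤ (1 - p) ^ 2 := by nlinarith
    have h9 : ε₁ * (p ^ s * n) * p ≤ ε₁ * (p ^ s * n) := by
      have : 0 ≤ ε₁ * (p ^ s * n) := by positivity
      nlinarith
    have h10 : 4 * ε₁ * (p ^ s * n) ≤ ε * (p ^ s * n) := by gcongr
    linarith
  · push Not at hhalf
    have h3 : 1 ≤ (ε * (p ^ s * n)) ^ 2 := by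
      calc 1 ≤ ε₁ * (p ^ s * n ^ 2) := h1
        _ = 4 ^ s * ε₁ * ((1 / 2) ^ s * (1 / 2) ^ s) * (p ^ s * n ^ 2) := by
            rw [← mul_pow]
            have : (4 : ℝ) ^ s * (1 / 2 * (1 / 2)) ^ s = 1 := by
              rw [← mul_pow]; norm_num
            calc _ = (4 ^ s * (1 / 2 * (1 / 2)) ^ s) * (ε₁ * (p ^ s * n ^ 2)) := by
                  rw [this, one_mul]
              _ = _ := by ring
        _ ≤ ε ^ 2 * (p ^ s * 1) * (p ^ s * n ^ 2) := by
            have : ((1 : ℝ) / 2) ^ s ≤ p ^ s := by gcongr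
            have h1' : ((1 : ℝ) / 2) ^ s ≤ 1 := pow_le_one₀ (by norm_num) (by norm_num)
            gcongr
        _ = _ := by ring
    by_contra hcon
    push Not at hcon
    have : (ε * (p ^ s * n)) ^ 2 < 1 := by
      have h0 : 0 ≤ ε * (p ^ s * n) := by positivity
      nlinarith
    linarith

end Spectral

/-! ### From closed `k`-paths to powers of cycles and clique factors. -/

section Cycles

/-- Each step of a walk changes the position by `±1` modulo `n`, so a bound on the distance becomes
a congruence with a small remainder. -/
theorem cycleGraph_walk_dvd {n : ℕ} {u v : Fin n} (w : (SimpleGraph.cycleGraph n).Walk u v) :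
    ∃ t : ℤ, |t| ≤ w.length ∧ (n : ℤ) ∣ v - u - t := by
  induction w with
  | nil => exact ⟨0, by simp⟩
  | @cons a b c h w ih =>
    obtain ⟨t, ht, hdvd⟩ := ih
    have key : ∀ x y : Fin n, (x - y).val = 1 → (n : ℤ) ∣ (x : ℤ) - y - 1 := by
      intro x y hxy
      rw [Fin.sub_def] at hxy
      simp only at hxy
      have h1 := Nat.div_add_mod (n - y.val + x.val) n
      rw [hxy] at h1
      refine ⟨((n - y.val + x.val) / n : ℕ) - 1, ?_⟩
      have hy := y.2
      have h2 : ((n - y.val : ℕ) : ℤ) = n - y := by omega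
      have h3 : (n : ℤ) * ((n - y.val + x.val) / n : ℕ) + 1 = (n - y.val : ℕ) + x.val := by
        exact_mod_cast h1
      rw [mul_sub]
      omega
    rw [SimpleGraph.Walk.length_cons]
    rcases SimpleGraph.cycleGraph_adj'.1 h with h | h
    · refine ⟨t - 1, ?_, ?_⟩
      · rw [abs_le] at ht ⊢
        push_cast
        omega
      · have e : (c : ℤ) - a - (t - 1) = -((a : ℤ) - b - 1) + (c - b - t) := by ring
        rw [e]
        exact (dvd_neg.2 (key _ _ h)).add hdvd
    · refine ⟨t + 1, ?_, ?_⟩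
      · rw [abs_le] at ht ⊢
        push_cast
        omega
      · have e : (c : ℤ) - a - (t + 1) = ((b : ℤ) - a - 1) + (c - b - t) := by ring
        rw [e]
        exact (key _ _ h).add hdvd

variable {V : Type*} {G : SimpleGraph V} {k : ℕ}

/-- The congruence means `j = i + t` or `j + |l| = i + t`. In the second case `j < k`, and entry
`|l| + j` of `l ++ x` is `l[j]` again because `x` is the beginning of `l`. -/
theorem KPath.adj_of_closed {l x : List V} (h : KPath G k (l ++ x)) (hx : x <+: l)
    (hxk : x.length = k) {i j t : ℕ} (hi : i < l.length) (hj : j < l.length) (hij : i ≠ j)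
    (ht : t ≤ k) (hdvd : (l.length : ℤ) ∣ (j : ℤ) - i - t) : G.Adj l[i] l[j] := by
  have hkl : k ≤ l.length := hxk ▸ hx.length_le
  obtain ⟨c, hc⟩ := hdvd
  have hc0 : c = 0 ∨ c = -1 := by
    have h1 : -2 < c := by
      by_contra hcon
      nlinarith [mul_le_mul_of_nonneg_left (not_lt.1 hcon) (Int.natCast_nonneg l.length)]
    have h2 : c < 1 := by
      by_contra hcon
      nlinarith [mul_le_mul_of_nonneg_left (not_lt.1 hcon) (Int.natCast_nonneg l.length)]
    omega
  have hli : (l ++ x)[i]? = some l[i] := by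
    rw [List.getElem?_append_left hi, List.getElem?_eq_getElem hi]
  rcases hc0 with rfl | rfl
  · refine h i j _ _ (by omega) (by omega) hli ?_
    rw [List.getElem?_append_left hj, List.getElem?_eq_getElem hj]
  · refine h i (l.length + j) _ _ (by omega) (by omega) hli ?_
    rw [List.getElem?_append_right (by omega), Nat.add_sub_cancel_left]
    obtain ⟨r, rfl⟩ := hx
    have hjx : j < x.length := by omega
    rw [List.getElem?_eq_getElem hjx, List.getElem_append_left hjx]

theorem containsHamiltonCyclePower_of_closed_path [Fintype V] (h3 : 3 ≤ Fintype.card V)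
    {l x : List V} (hl : l.Nodup) (hall : ∀ v, v ∈ l) (hxk : x.length = k) (hx : x <+: l)
    (h : KPath G k (l ++ x)) : ContainsHamiltonCyclePower G k := by
  classical
  have hlen : l.length = Fintype.card V := by
    rw [← List.toFinset_card_of_nodup hl, ← Finset.card_univ]
    congr 1
    ext v; simp [hall v]
  refine ⟨h3, ⟨⟨⟨fun i => l[i.val]'(by rw [hlen]; exact i.2), ?_⟩, ?_⟩⟩⟩
  · rintro i j ⟨hij, hdist⟩
    have hij' : i.val ≠ j.val := fun h => hij (Fin.ext h)
    obtain ⟨L, hL⟩ := ENat.ne_top_iff_exists.1 (ne_top_of_le_ne_top (ENat.natCast_ne_top k) hdist)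
    obtain ⟨w, hw⟩ := SimpleGraph.exists_walk_of_edist_eq_coe hL.symm
    have hLk : L ≤ k := by
      rw [← hL] at hdist
      exact_mod_cast hdist
    obtain ⟨t, ht, hdvd⟩ := cycleGraph_walk_dvd w
    replace hdvd : (l.length : ℤ) ∣ (j : ℤ) - i - t := by rw [hlen]; exact hdvd
    rw [hw, abs_le] at ht
    rcases le_total 0 t with h0 | h0
    · refine h.adj_of_closed hx hxk (t := t.toNat) _ _ hij' (by omega) ?_
      rwa [Int.toNat_of_nonneg h0]
    · refine (h.adj_of_closed hx hxk (t := (-t).toNat) _ _ hij'.symm (by omega) ?_).symm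
      rw [Int.toNat_of_nonneg (by omega)]
      have e : (i : ℤ) - j - -t = -(j - i - t) := by ring
      rw [e]
      exact dvd_neg.2 hdvd
  · intro i j hij
    exact Fin.ext ((hl.getElem_inj_iff).1 hij)

/-- Any `k + 1` consecutive entries of a `k`-path form a clique, so the list is cut into blocks of
that length. -/
theorem hasCliqueFactor_of_path [Fintype V] {l : List V} (hl : l.Nodup) (hall : ∀ v, v ∈ l)
    (h : KPath G k l) (hdvd : k + 1 ∣ Fintype.card V) : HasCliqueFactor G (k + 1) := by
  classical
  have hlen : l.length = Fintype.card V := by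
    rw [← List.toFinset_card_of_nodup hl, ← Finset.card_univ]
    congr 1
    ext v; simp [hall v]
  obtain ⟨m, hm⟩ := hdvd
  rw [← hlen] at hm
  set C : ℕ → List V := fun q => (l.drop (q * (k + 1))).take (k + 1) with hC
  have hsplit : ∀ q, l.take (q * (k + 1)) ++ (C q ++ (l.drop (q * (k + 1))).drop (k + 1)) = l := by
    intro q
    rw [hC, List.take_append_drop, List.take_append_drop]
  have hmem : ∀ (q i : ℕ) (hi : i < l.length), l[i] ∈ C q ↔ i / (k + 1) = q := by
    intro q i hi
    rw [Nat.div_eq_iff (Nat.succ_pos k), Nat.succ_eq_add_one, hC, List.mem_iff_getElem?]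
    constructor
    · rintro ⟨j, hj⟩
      rw [List.getElem?_take] at hj
      split_ifs at hj with hjk
      rw [List.getElem?_drop, ← List.getElem?_eq_getElem hi] at hj
      have := (List.getElem?_inj hi hl).1 hj.symm
      omega
    · intro hq
      refine ⟨i - q * (k + 1), ?_⟩
      rw [List.getElem?_take, if_pos (by omega), List.getElem?_drop, Nat.add_sub_cancel' (by omega),
        List.getElem?_eq_getElem hi]
  refine ⟨{s | ∃ q < m, s = (C q).toFinset}, ?_, fun v => ?_⟩
  · rintro s ⟨q, hq, rfl⟩
    have hnd : (C q).Nodup := ((List.take_sublist _ _).trans (List.drop_sublist _ _)).nodup hl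
    have hCl : (C q).length = k + 1 := by
      rw [hC, List.length_take, List.length_drop, hm]
      have : (q + 1) * (k + 1) ≤ (k + 1) * m := by
        rw [mul_comm (k + 1)]
        exact Nat.mul_le_mul_right _ hq
      rw [add_mul] at this
      omega
    have hpath : KPath G k (C q) := by
      rw [← hsplit q] at h
      exact h.right.left
    rw [SimpleGraph.isNClique_iff, List.toFinset_card_of_nodup hnd]
    refine ⟨?_, hCl⟩
    intro a ha b hb hab
    have : Std.Symm G.Adj := G.symm
    exact (hpath.pairwise hCl.le).forall (by simpa using ha) (by simpa using hb) hab
  · obtain ⟨i, hi, rfl⟩ := List.getElem_of_mem (hall v)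
    refine ⟨(C (i / (k + 1))).toFinset, ⟨⟨_, ?_, rfl⟩, ?_⟩, ?_⟩
    · rw [Nat.div_lt_iff_lt_mul (Nat.succ_pos k), mul_comm, ← hm]
      exact hi
    · rw [List.mem_toFinset, hmem]
    · rintro s ⟨⟨q, hq, rfl⟩, hs⟩
      rw [List.mem_toFinset, hmem] at hs
      rw [hs]

end Cycles

/-! ### The main theorem. -/

section Main

theorem jumbled_of_secondEigenvalue {V : Type*} [Fintype V] [DecidableEq V] [Nonempty V]
    {G : SimpleGraph V} [DecidableRel G.Adj] {d s : ℕ} {ε : ℝ} (hd1 : 1 ≤ d)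
    (hd : G.IsRegularOfDegree d) (hε : 0 ≤ ε)
    (h : secondEigenvalue G ^ 2 ≤
      ε * ((d / Fintype.card V : ℝ) ^ (s + 2) * (Fintype.card V : ℝ) ^ 2)) :
    Jumbled G (d / Fintype.card V)
      (ε * ((d / Fintype.card V : ℝ) ^ s * (Fintype.card V : ℝ) ^ 2)) := by
  have hn : (0 : ℝ) < Fintype.card V := by exact_mod_cast Fintype.card_pos
  have hd0 : (0 : ℝ) < d := by exact_mod_cast hd1
  have hdn : d ≤ Fintype.card V := by
    obtain ⟨v⟩ := ‹Nonempty V›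
    rw [← hd v]
    exact (G.degree_lt_card_verts v).le
  refine ⟨by positivity, ?_, by positivity, fun X Y => ?_⟩
  · rw [div_le_one hn]
    exact_mod_cast hdn
  · refine (expander_mixing hd X Y).trans ?_
    refine mul_le_mul_of_nonneg_right (mul_le_mul_of_nonneg_right (h.trans ?_) ?_) ?_
    · rw [pow_add]
      exact le_of_eq (by ring)
    · positivity
    · positivity

theorem exists_closed_path_of_secondEigenvalue {k s M m : ℕ} (hk : 1 ≤ k) (hs : 2 ≤ s)
    (hks : 2 * k ≤ s + 1) (hm : 1 ≤ m) (habs : HasAbsorbers.{u} k s M)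
    (hcon : Connects.{u} k s m) :
    ∃ ε : ℝ, 0 < ε ∧ ∀ {V : Type u} [Fintype V] [DecidableEq V] [Nonempty V] {G : SimpleGraph V}
      [DecidableRel G.Adj] {d : ℕ}, 1 ≤ d → G.IsRegularOfDegree d →
      secondEigenvalue G ^ 2 ≤
        ε * ((d / Fintype.card V : ℝ) ^ (s + 2) * (Fintype.card V : ℝ) ^ 2) →
      3 ≤ Fintype.card V ∧ ∃ l x : List V, l.Nodup ∧ (∀ v, v ∈ l) ∧ x.length = k ∧ x <+: l ∧
        KPath G k (l ++ x) := by
  have hev := (Setup.exists_closed_path hk hs hks hm habs hcon).and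
    ((eventually_mul_lt 3 one_pos).and self_mem_nhdsWithin)
  obtain ⟨ε, hpath, h3, hε⟩ := hev.exists
  replace hε : 0 < ε := hε
  refine ⟨min (ε / 4) (ε ^ 2 / 4 ^ s), by positivity, ?_⟩
  intro V _ _ _ G _ d hd1 hd h
  have hn : (0 : ℝ) < Fintype.card V := by exact_mod_cast Fintype.card_pos
  have hmin : 0 ≤ min (ε / 4) (ε ^ 2 / 4 ^ s) := by positivity
  have hS : Setup G s ε (d / Fintype.card V) (Fintype.card V) := by
    refine Setup.of_jumbled hε hmin ?_ ?_ (jumbled_of_secondEigenvalue hd1 hd hmin h) rfl hn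
      fun v => ?_
    · linarith [min_le_left (ε / 4) (ε ^ 2 / 4 ^ s)]
    · have := min_le_right (ε / 4) (ε ^ 2 / 4 ^ s)
      rw [le_div_iff₀ (by positivity)] at this
      linarith
    · rw [card_nb_univ hd v]
      field_simp
  refine ⟨?_, hpath hS⟩
  have := hS.large_of_lt (Nat.zero_le s) one_pos h3
  rw [pow_zero, one_mul, one_mul] at this
  exact_mod_cast this

theorem sq_rpow_mul_rpow {x y : ℝ} (hx : 0 < x) (hy : 0 < y) (a : ℕ) :
    (x ^ ((a : ℝ) / 2) * y ^ (1 - (a : ℝ) / 2)) ^ 2 = (x / y) ^ a * y ^ 2 := by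
  have e1 : (x ^ ((a : ℝ) / 2)) ^ 2 = x ^ a := by
    rw [← Real.rpow_natCast, ← Real.rpow_mul hx.le, ← Real.rpow_natCast]
    congr 1
    push_cast; ring
  have e2 : (y ^ (1 - (a : ℝ) / 2)) ^ 2 = y ^ 2 / y ^ a := by
    rw [← Real.rpow_natCast, ← Real.rpow_mul hy.le, ← Real.rpow_natCast, ← Real.rpow_natCast,
      ← Real.rpow_sub hy]
    congr 1
    push_cast; ring
  rw [mul_pow, e1, e2, div_pow]
  ring

/-- Graphs with a small second eigenvalue contain spanning powers of cycles and clique factors. -/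
theorem exists_secondEigenvalue_bound {k s a M m : ℕ} (hk : 1 ≤ k) (hs : 2 ≤ s)
    (hks : 2 * k ≤ s + 1) (hm : 1 ≤ m) (ha : s + 2 ≤ a) (habs : HasAbsorbers.{u} k s M)
    (hcon : Connects.{u} k s m) :
    ∃ ε₀ : ℝ, 0 < ε₀ ∧ ∀ ε, 0 < ε → ε ≤ ε₀ → ∀ (V : Type u) [Fintype V] [DecidableEq V]
      (G : SimpleGraph V) [DecidableRel G.Adj] (n d : ℕ) (lam : ℝ), 1 ≤ n → 1 ≤ d →
      IsNDLambdaGraph G n d lam →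
      lam ≤ ε * (d : ℝ) ^ ((a : ℝ) / 2) * (n : ℝ) ^ (1 - (a : ℝ) / 2) →
      ContainsHamiltonCyclePower G k ∧ (k + 1 ∣ n → HasCliqueFactor G (k + 1)) := by
  obtain ⟨ε₁, hε₁, hmain⟩ := exists_closed_path_of_secondEigenvalue hk hs hks hm habs hcon
  refine ⟨min 1 ε₁, by positivity, ?_⟩
  intro ε hε hεle V _ _ G _ n d lam hn hd hG hlam
  obtain ⟨rfl, hreg, hle⟩ := hG
  have : Nonempty V := Fintype.card_pos_iff.1 hn
  have hn0 : (0 : ℝ) < Fintype.card V := by exact_mod_cast hn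
  have hd0 : (0 : ℝ) < d := by exact_mod_cast hd
  have hdn : (d : ℝ) / Fintype.card V ≤ 1 := by
    obtain ⟨v⟩ := this
    rw [div_le_one hn0, ← hreg v]
    exact_mod_cast (G.degree_lt_card_verts v).le
  have hsq : secondEigenvalue G ^ 2 ≤
      ε₁ * ((d / Fintype.card V : ℝ) ^ (s + 2) * (Fintype.card V : ℝ) ^ 2) := by
    calc secondEigenvalue G ^ 2
        ≤ (ε * (d : ℝ) ^ ((a : ℝ) / 2) * (Fintype.card V : ℝ) ^ (1 - (a : ℝ) / 2)) ^ 2 :=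
          pow_le_pow_left₀ secondEigenvalue_nonneg (hle.trans hlam) 2
      _ = ε ^ 2 * ((d / Fintype.card V : ℝ) ^ a * (Fintype.card V : ℝ) ^ 2) := by
          rw [mul_assoc, mul_pow, sq_rpow_mul_rpow hd0 hn0]
      _ ≤ _ := by
          have h1 : ε ^ 2 ≤ ε₁ := by
            have h2 := hεle.trans (min_le_left _ _)
            have h3 := hεle.trans (min_le_right _ _)
            nlinarith
          have h4 := pow_le_pow_of_le_one (by positivity) hdn ha
          gcongr
  obtain ⟨h3, l, x, hl, hall, hxk, hx, hpath⟩ := hmain hd hreg hsq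
  exact ⟨containsHamiltonCyclePower_of_closed_path h3 hl hall hxk hx hpath,
    hasCliqueFactor_of_path hl hall hpath.left⟩

end Main

theorem corollary1p4 (k : ℕ) (hk : 2 ≤ k) :
    ∃ ε : ℝ, 0 < ε ∧
      ∀ (V : Type*) [Fintype V] [DecidableEq V] (G : SimpleGraph V) [DecidableRel G.Adj]
        (n d : ℕ) (lam : ℝ), 1 ≤ n → 1 ≤ d → IsNDLambdaGraph G n d lam →
        (lam ≤ ε * (d : ℝ) ^ (5 / 2 : ℝ) * (n : ℝ) ^ (-(3 / 2) : ℝ) →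
          ContainsHamiltonCyclePower G 2 ∧ (3 ∣ n → HasCliqueFactor G 3)) ∧
        (lam ≤ ε * (d : ℝ) ^ (3 * (k : ℝ) / 2) * (n : ℝ) ^ (1 - 3 * (k : ℝ) / 2) →
          ContainsHamiltonCyclePower G k ∧ (k + 1 ∣ n → HasCliqueFactor G (k + 1))) := by
  have hcon2 := leftReach_square.connects (by norm_num) (by norm_num)
  have habs2 := absorbs_square hcon2
  obtain ⟨ε₁, hε₁, h₁⟩ := exists_secondEigenvalue_bound (a := 5) (by norm_num) (by norm_num)
    (by norm_num) (by norm_num) le_rfl habs2 hcon2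
  obtain ⟨ε₂, hε₂, h₂⟩ : ∃ ε₀ : ℝ, 0 < ε₀ ∧ ∀ ε, 0 < ε → ε ≤ ε₀ →
      ∀ (V : Type _) [Fintype V] [DecidableEq V]
      (G : SimpleGraph V) [DecidableRel G.Adj] (n d : ℕ) (lam : ℝ), 1 ≤ n → 1 ≤ d →
      IsNDLambdaGraph G n d lam →
      lam ≤ ε * (d : ℝ) ^ (((3 * k : ℕ) : ℝ) / 2) * (n : ℝ) ^ (1 - ((3 * k : ℕ) : ℝ) / 2) →
      ContainsHamiltonCyclePower G k ∧ (k + 1 ∣ n → HasCliqueFactor G (k + 1)) := by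
    -- For `k = 2` the bound in (b) has `p^6` where (a) has `p^5`, so it is the stronger hypothesis
    -- and the case `s = 3` applies. For `k ≥ 3` the general connections and absorbers apply with `s
    -- = 3k - 2`.
    rcases hk.eq_or_lt with rfl | hk3
    · exact exists_secondEigenvalue_bound (by norm_num) (by norm_num) (by norm_num) (by norm_num)
        (by norm_num) habs2 hcon2
    · have hs : 3 * k = (3 * k - 2) + 2 := by omega
      exact exists_secondEigenvalue_bound (by omega) (by omega) (by omega) (by omega) hs.ge
        (absorbs_general hk3 hs)
        ((leftReach_general hk hs).connects (by omega) (by omega))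
  refine ⟨min ε₁ ε₂, lt_min hε₁ hε₂, ?_⟩
  intro V _ _ G _ n d lam hn hd hG
  refine ⟨fun hlam => ?_, fun hlam => ?_⟩
  · refine h₁ _ (lt_min hε₁ hε₂) (min_le_left _ _) V G n d lam hn hd hG (hlam.trans_eq ?_)
    norm_num
  · refine h₂ _ (lt_min hε₁ hε₂) (min_le_right _ _) V G n d lam hn hd hG (hlam.trans_eq ?_)
    push_cast
    rfl
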